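/- **Setting.** Let $d\ge 1$, $L>0$, $\Lambda=[-L/2,L/2]^d$, $k_{\mathbf j}=\frac{2\pi}{L}\mathbf j$ for $\mathbf j\in\mathbb Z^d$. The pair potential $\phi$ is a bounded, real-valued, $L$-periodic, even function with Fourier coefficients $\phi_{\mathbf j}=\int_\Lambda\phi(x)e^{-ik_{\mathbf j}\cdot x}dx\ge 0$, only finitely many of which are nonzero. For $N\geq 2$ even let $\mathcal F^N$ be the $N$-particle subspace of the bosonic Fock space over $L^2(\Lambda)$, with annihilation and creation operators $a_{\mathbf j},a^*_{\mathbf j}$. For $\mathbf j\neq\mathbf 0$ put $$W_{\mathbf j}=\tfrac{\phi_{\mathbf j}}{N}a^*_{\mathbf 0}a^*_{\mathbf 0}a_{\mathbf j}a_{-\mathbf j},\qquad \hat H^{Bog}_{\mathbf j}=\sum_{\mathbf j'=\pm\mathbf j}\Big(k_{\mathbf j}^2+\phi_{\mathbf j}\tfrac{a_{\mathbf 0}^*a_{\mathbf 0}}{N}\Big)a^*_{\mathbf j'}a_{\mathbf j'}+W_{\mathbf j}+W_{\mathbf j}^*,$$ and, whenever $\phi_{\mathbf j}>0$, $\epsilon_{\mathbf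 j}=k_{\mathbf j}^2/\phi_{\mathbf j}$ and $E^{Bog}_{\mathbf j}=-\big[k_{\mathbf j}^2+\phi_{\mathbf j}-\sqrt{(k_{\mathbf j}^2)^2+2\phi_{\mathbf j}k_{\mathbf j}^2}\,\big]$. Let $m\ge1$ and let $\mathbf j_1,\dots,\mathbf j_m\in\mathbb Z^d\setminus\{\mathbf 0\}$ satisfy $\phi_{\mathbf j_l}\ne0$ and $\mathbf j_l\neq\pm\mathbf j_{l'}$ for $l\ne l'$. Put $$H^{Bog}_{\mathbf j_1,\dots,\mathbf j_m}=\sum_{\mathbf j\notin\{\pm\mathbf j_1,\dots,\pm\mathbf j_m\}}k_{\mathbf j}^2a^*_{\mathbf j}a_{\mathbf j}+\sum_{l=1}^m\hat H^{Bog}_{\mathbf j_l},$$ and let $z^{Bog}_{\mathbf j_1,\dots,\mathbf j_{m-1}}$ be the ground state energy of $H^{Bog}_{\mathbf j_1,\dots,\mathbf j_{m-1}}$ if $m\ge 2$, and $0$ if $m=1$. For even $i$, $0\le i\le N-2$, let $Q^{(i,i+1)}$ be the projection of $\mathcal F^N$ onto the states with $N-i$ or $N-i-1$ particles in the modes $\pm\mathbf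 j_m$, and $Q^{(>i+1)}$ the projection onto the states with fewer than $N-i-1$ particles in these modes. For $w\in\mathbb R$ let $\mathcal K^{(-2)}(w)=H^{Bog}_{\mathbf j_1,\dots,\mathbf j_m}-w$ and, for $i=0,2,\dots,N-2$, let $\mathcal K^{(i)}(w)$ be the image of $\mathcal K^{(i-2)}(w)$ under the Feshbach–Schur map with $\mathscr P=Q^{(>i+1)}$, $\overline{\mathscr P}=Q^{(i,i+1)}$, $$K\mapsto \mathscr PK\mathscr P-\mathscr PK\overline{\mathscr P}\,\frac{1}{\overline{\mathscr P}K\overline{\mathscr P}}\,\overline{\mathscr P}K\mathscr P .$$ It is *well defined* if at each step up to the $i$-th one $\overline{\mathscr P}K\overline{\mathscr P}$ has a bounded inverse on $\overline{\mathscr P}\mathcal F^N$. Put $W_{i,i'}=Q^{(i,i+1)}W_{\mathbf j_m}Q^{(i',i'+1)}$, $W^*_{i,i'}=Q^{(i,i+1)}W^*_{\mathbf j_m}Q^{(i',i'+1)}$, $$R_{i}(w)=Q^{(i,i+1)}\frac1{Q^{(i,i+1)}(H^{Bog}_{\mathbf j_1,\dots,\mathbf j_m}-w)Q^{(i,i+1)}}Q^{(i,i+1)},$$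 $$\Gamma_2=W_{2,0}R_0W^*_{0,2},\qquad \Gamma_i=W_{i,i-2}R_{i-2}\sum_{l\ge0}[\Gamma_{i-2}R_{i-2}]^lW^*_{i-2,i}\quad(4\le i\le N-2),\qquad \check\Gamma_i=\sum_{l\ge0}\big[R_i^{1/2}\Gamma_iR_i^{1/2}\big]^l .$$ For $\epsilon>0$ let $\delta=1+\sqrt\epsilon$, $\eta=1-\sqrt\epsilon$, $b_\epsilon=(1+\epsilon)\,\delta\,\chi_{[0,2)}(\delta)\sqrt{\epsilon^2+2\epsilon}$, $c_\epsilon=-(1-\delta^2\chi_{[0,2)}(\delta))(\epsilon^2+2\epsilon)$ and, for a given function $\epsilon\mapsto a_\epsilon$, $$X_0=1,\qquad X_{2j+2}=1-\frac{1}{4\Big(1+a_\epsilon-\frac{2b_\epsilon}{N-2j-1}-\frac{1-c_\epsilon}{(N-2j-1)^2}\Big)X_{2j}} .$$ **Theorem.** Let $\nu>\frac{11}8$ and $\Theta=\min\{2(\nu-\frac{11}8),\frac14\}$. There are $C,\epsilon_0>0$ and a function $\epsilon\mapsto a_\epsilon$ with $|a_\epsilon-2\epsilon|\le C\epsilon^\nu$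 for $0<\epsilon<\epsilon_0$, depending only on $\nu$, such that the following holds for all $d,L,\phi,m,\mathbf j_1,\dots,\mathbf j_m$ as above with $\epsilon:=\epsilon_{\mathbf j_m}<\epsilon_0$. One has $E^{Bog}_{\mathbf j_m}+(\delta-1)\phi_{\mathbf j_m}\sqrt{\epsilon^2+2\epsilon}<0$, and there is $N_0$ (depending on all these data) such that for every even $N\ge N_0$ for which $$\operatorname{infspec}\Big[\sum_{l=1}^{m-1}\hat H^{Bog}_{\mathbf j_l}\Big]-z^{Bog}_{\mathbf j_1,\dots,\mathbf j_{m-1}}\ \ge\ -\frac{m-1}{(\ln N)^{1/8}},$$ every $z\le E^{Bog}_{\mathbf j_m}+(\delta-1)\phi_{\mathbf j_m}\sqrt{\epsilon^2+2\epsilon}$, and $w=z+z^{Bog}_{\mathbf j_1,\dots,\mathbf j_{m-1}}$: 1. For all even $0\le i\le N-2$, $\mathcal K^{(i)}(w)$ is well defined and self-adjoint on the domain of $Q^{(>i+1)}(H^{Bog}_{\mathbf j_1,\dots,\mathbf j_m}-w)Q^{(>i+1)}$; the bounded operator $R_i(w)$ exists and is nonnegative. 2. $\mathcal K^{(0)}(w)=Q^{(>1)}(H^{Bog}_{\mathbf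 j_1,\dots,\mathbf j_m}-w)Q^{(>1)}-Q^{(>1)}W_{\mathbf j_m}R_0(w)W^*_{\mathbf j_m}Q^{(>1)}$, and for all even $2\le i\le N-2$, with norm convergent series, $$\mathcal K^{(i)}(w)=Q^{(>i+1)}(H^{Bog}_{\mathbf j_1,\dots,\mathbf j_m}-w)Q^{(>i+1)}-Q^{(>i+1)}W_{\mathbf j_m}R_i(w)\sum_{l\ge0}[\Gamma_i(w)R_i(w)]^l\,W^*_{\mathbf j_m}Q^{(>i+1)} .$$ 3. For all even $2\le i\le N-2$ the series $\check\Gamma_i(w)$ converges in norm and $\|\check\Gamma_i(w)\|\le 1/X_i$. 4. For all $j\ge0$ with $2j\le N-2$, $$X_{2j}\ \ge\ \frac12\Big[1+\sqrt{\eta a_\epsilon}-\frac{b_\epsilon/\sqrt{\eta a_\epsilon}}{N-2j-\epsilon^\Theta}\Big]\ >\ 0 .$$ -/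

import Mathlib

noncomputable section

namespace BoseGas

/-! ### The box, the modes and the pair potential -/

/-- A mode `j ∈ ℤ^d`; its wave vector is `k_j = (2π/L) j`. -/
abbrev Mode (d : ℕ) : Type := Fin d → ℤ

/-- `k_j²`, the squared length of the wave vector `k_j = (2π/L) j`. -/
def kSq {d : ℕ} (L : ℝ) (j : Mode d) : ℝ := (2 * Real.pi / L) ^ 2 * ∑ i, (j i : ℝ) ^ 2

/-- The Fourier coefficient `f_j = ∫_Λ f(x) e^{-i k_j·x} dx` over the box `Λ = [-L/2, L/2]^d`. -/
def fourierCoeffBox {d : ℕ} (L : ℝ) (f : (Fin d → ℝ) → ℝ) (j : Mode d) : ℂ :=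
  ∫ x in Set.Icc (fun _ : Fin d => -(L / 2)) (fun _ : Fin d => L / 2),
    (f x : ℂ) * Complex.exp (-(Complex.I * ((∑ i, 2 * Real.pi / L * (j i : ℝ) * x i : ℝ) : ℂ)))

/-- A pair potential: bounded, real-valued, `L`-periodic, even, of positive type, and with an
ultraviolet cutoff (finitely many nonzero Fourier coefficients). -/
structure PairPotential (d : ℕ) (L : ℝ) where
  /-- the function `φ(z)` -/
  toFun : (Fin d → ℝ) → ℝ
  measurable : Measurable toFun
  bounded : ∃ C : ℝ, ∀ x, |toFun x| ≤ C
  periodic : ∀ (x : Fin d → ℝ) (j : Mode d), toFun (fun i => x i + (j i : ℝ) * L) = toFun x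
  even : ∀ x, toFun (-x) = toFun x
  positive_type : ∀ j : Mode d,
    0 ≤ (fourierCoeffBox L toFun j).re ∧ (fourierCoeffBox L toFun j).im = 0
  finite_support : {j : Mode d | fourierCoeffBox L toFun j ≠ 0}.Finite

variable {d : ℕ} {L : ℝ}

/-- The (real, nonnegative) Fourier coefficient `φ_j`. -/
def PairPotential.coeff (φ : PairPotential d L) (j : Mode d) : ℝ :=
  (fourierCoeffBox L φ.toFun j).re

/-- `ε_j = k_j² / φ_j`. -/
def PairPotential.eps (φ : PairPotential d L) (j : Mode d) : ℝ := kSq L j / φ.coeff j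

/-- `E^Bog_j = -[k_j² + φ_j - √((k_j²)² + 2 φ_j k_j²)]`. -/
def PairPotential.energyBog (φ : PairPotential d L) (j : Mode d) : ℝ :=
  -(kSq L j + φ.coeff j - Real.sqrt ((kSq L j) ^ 2 + 2 * φ.coeff j * kSq L j))

/-- `J 1, …, J m` are interacting nonzero modes representing `m` distinct couples `±J l`. -/
structure InteractingModes (φ : PairPotential d L) (m : ℕ) (J : ℕ → Mode d) : Prop where
  ne_zero : ∀ l ∈ Finset.Icc 1 m, J l ≠ 0
  interacting : ∀ l ∈ Finset.Icc 1 m, φ.coeff (J l) ≠ 0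
  distinct : ∀ l ∈ Finset.Icc 1 m, ∀ l' ∈ Finset.Icc 1 m, l ≠ l' → J l ≠ J l' ∧ J l ≠ -J l'

/-! ### Operators on `ℓ²` spaces -/

section Operators

/-- The Hilbert space `ℓ²(ι)`. -/
abbrev L2 (ι : Type) : Type := lp (fun _ : ι => ℂ) 2

theorem memℓp_weightedComp {ι κ : Type} (c : κ → ℝ) (τ : κ → ι)
    (hτ : Function.Injective τ) (B : ℝ) (hB : 0 ≤ B) (hc : ∀ k, |c k| ≤ B) (ψ : L2 ι) :
    Memℓp (fun k => (c k : ℂ) * ψ (τ k)) 2 ∧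
      ∑' k, ‖(c k : ℂ) * ψ (τ k)‖ ^ (2 : ℝ) ≤ (B * ‖ψ‖) ^ (2 : ℝ) := by
  have h2 : (0 : ℝ) < (2 : ENNReal).toReal := by norm_num
  have h2' : (2 : ENNReal).toReal = 2 := by norm_num
  have hψ : Summable fun i => ‖ψ i‖ ^ (2 : ℝ) := by
    have := (lp.memℓp ψ).summable h2
    rwa [h2'] at this
  have hψτ : Summable fun k => B ^ (2 : ℝ) * ‖ψ (τ k)‖ ^ (2 : ℝ) :=
    (hψ.comp_injective hτ).mul_left _
  have hle : ∀ k, ‖(c k : ℂ) * ψ (τ k)‖ ^ (2 : ℝ) ≤ B ^ (2 : ℝ) * ‖ψ (τ k)‖ ^ (2 : ℝ) := by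
    intro k
    rw [norm_mul, Complex.norm_real, Real.norm_eq_abs,
      Real.mul_rpow (abs_nonneg _) (norm_nonneg _)]
    gcongr
    exact hc k
  have hs : Summable fun k => ‖(c k : ℂ) * ψ (τ k)‖ ^ (2 : ℝ) :=
    Summable.of_nonneg_of_le (fun k => by positivity) hle hψτ
  refine ⟨memℓp_gen (by rw [h2']; exact hs), ?_⟩
  calc ∑' k, ‖(c k : ℂ) * ψ (τ k)‖ ^ (2 : ℝ)
      ≤ ∑' k, B ^ (2 : ℝ) * ‖ψ (τ k)‖ ^ (2 : ℝ) := hs.tsum_le_tsum hle hψτ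
    _ = B ^ (2 : ℝ) * ∑' k, ‖ψ (τ k)‖ ^ (2 : ℝ) := tsum_mul_left
    _ ≤ B ^ (2 : ℝ) * ∑' i, ‖ψ i‖ ^ (2 : ℝ) := by
        gcongr
        exact tsum_comp_le_tsum_of_inj hψ (fun i => by positivity) hτ
    _ = (B * ‖ψ‖) ^ (2 : ℝ) := by
        rw [Real.mul_rpow hB (norm_nonneg _)]
        have := lp.norm_rpow_eq_tsum h2 ψ
        rw [h2'] at this
        rw [this]

/-- The bounded operator `(A ψ)(k) = c(k) ψ(τ k)`, for `c` bounded by `B` and `τ` injective. -/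
def weightedComp {ι κ : Type} (c : κ → ℝ) (τ : κ → ι) (hτ : Function.Injective τ) (B : ℝ)
    (hB : 0 ≤ B) (hc : ∀ k, |c k| ≤ B) : L2 ι →L[ℂ] L2 κ :=
  LinearMap.mkContinuous
    { toFun := fun ψ => ⟨fun k => (c k : ℂ) * ψ (τ k), (memℓp_weightedComp c τ hτ B hB hc ψ).1⟩
      map_add' := fun ψ χ => by
        ext k
        exact mul_add _ _ _
      map_smul' := fun a ψ => by
        ext k
        simp [mul_left_comm] }
    B
    (fun ψ => by
      refine lp.norm_le_of_tsum_le (by norm_num) (by positivity) ?_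
      simpa using (memℓp_weightedComp c τ hτ B hB hc ψ).2)

/-- The self-adjoint operator of multiplication by `f`, on its maximal domain
`{ψ | f ψ ∈ ℓ²}`. -/
def diagPMap {ι : Type} (f : ι → ℝ) : L2 ι →ₗ.[ℂ] L2 ι where
  domain :=
    { carrier := {ψ | Memℓp (fun k => (f k : ℂ) * ψ k) 2}
      add_mem' := fun {ψ χ} hψ hχ => by
        have := Memℓp.add hψ hχ
        refine cast (congrArg (fun g => Memℓp g 2) ?_) this
        funext k
        simp [mul_add]
      zero_mem' := by
        refine cast (congrArg (fun g => Memℓp g 2) ?_) (zero_memℓp (E := fun _ : ι => ℂ) (p := 2))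
        funext k
        simp
      smul_mem' := fun a ψ hψ => by
        have := Memℓp.const_smul hψ a
        refine cast (congrArg (fun g => Memℓp g 2) ?_) this
        funext k
        simp [mul_left_comm] }
  toFun :=
    { toFun := fun ψ => ⟨fun k => (f k : ℂ) * (ψ : L2 ι) k, ψ.2⟩
      map_add' := fun ψ χ => by
        ext k
        exact mul_add _ _ _
      map_smul' := fun a ψ => by
        ext k
        simp [mul_left_comm] }

variable {H : Type} [NormedAddCommGroup H] [InnerProductSpace ℂ H] [CompleteSpace H]

/-- A bounded operator, seen as an everywhere defined element of the unbounded operators. -/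
def ofCLM (A : H →L[ℂ] H) : H →ₗ.[ℂ] H := (A : H →ₗ[ℂ] H).toPMap ⊤

/-- The product `S T` of unbounded operators, on the domain `{ψ ∈ D(T) | T ψ ∈ D(S)}`. -/
def pcomp (S T : H →ₗ.[ℂ] H) : H →ₗ.[ℂ] H :=
  S.comp (T.domRestrict ((S.domain.comap T.toFun).map T.domain.subtype)) (by
    intro x
    obtain ⟨y, hy, hyx⟩ := Submodule.mem_map.1 x.2.1
    have hy' : T y ∈ S.domain := hy
    have : y = ⟨x, x.2.2⟩ := Subtype.ext hyx
    rw [this] at hy'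
    exact hy')

/-- `R` is the operator `P (P K P)⁻¹ P`, where the inverse of `P K P` is taken on the range of the
projection `P` and is bounded. -/
structure IsReducedInverse (P : H →L[ℂ] H) (K : H →ₗ.[ℂ] H) (R : H →L[ℂ] H) : Prop where
  left : P ∘L R = R
  right : R ∘L P = R
  right_inv : ∀ ψ : H, ∃ h : R ψ ∈ K.domain, P (K ⟨R ψ, h⟩) = P ψ
  left_inv : ∀ ψ : K.domain, P ψ = ψ → R (P (K ψ)) = ψ

/-- `P K P` has a bounded inverse on the range of `P`. -/
def ReducedInvertible (P : H →L[ℂ] H) (K : H →ₗ.[ℂ] H) : Prop := ∃ R, IsReducedInverse P K R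

open Classical in
/-- `P (P K P)⁻¹ P` (and `0` if `P K P` has no bounded inverse on the range of `P`). -/
def reducedInv (P : H →L[ℂ] H) (K : H →ₗ.[ℂ] H) : H →L[ℂ] H :=
  if h : ReducedInvertible P K then h.choose else 0

/-- The positive square root of a positive bounded operator. -/
def posSqrt (R : H →L[ℂ] H) : H →L[ℂ] H := CFC.sqrt R

/-- The Feshbach-Schur map associated with the projections `P` and `Pbar`,
`F(K) = P K P - P K Pbar (Pbar K Pbar)⁻¹ Pbar K P`.  As an operator on the range of `P` it is
extended by `0` to the whole space.  It is well defined if `ReducedInvertible Pbar K`. -/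
def feshbach (P Pbar : H →L[ℂ] H) (K : H →ₗ.[ℂ] H) : H →ₗ.[ℂ] H :=
  pcomp (ofCLM P) (pcomp K (ofCLM P)) -
    pcomp (ofCLM P) (pcomp K (pcomp (ofCLM (reducedInv Pbar K))
      (pcomp (ofCLM Pbar) (pcomp K (ofCLM P)))))

/-- The real part of the spectrum: the real `E` for which `T - E` has no bounded inverse. -/
def realSpectrum (T : H →ₗ.[ℂ] H) : Set ℝ :=
  {E | ¬ ReducedInvertible (ContinuousLinearMap.id ℂ H)
    (T - ofCLM ((E : ℂ) • ContinuousLinearMap.id ℂ H))}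

/-- The bottom of the spectrum of a self-adjoint operator. -/
def infspec (T : H →ₗ.[ℂ] H) : ℝ := sInf (realSpectrum T)

end Operators

/-! ### The `N`-particle space, in the occupation number representation -/

/-- The occupation numbers of the modes, for `N` particles in total. -/
abbrev Occ (d N : ℕ) : Type := {n : Mode d →₀ ℕ // n.degree = N}

/-- The `N`-particle subspace `𝓕^N` of the bosonic Fock space over `L²(Λ)`, written in the
orthonormal basis of occupation number states. -/
abbrev FockN (d N : ℕ) : Type := L2 (Occ d N)

/-- Add one particle in the mode `j`. -/
def Occ.addOne {N : ℕ} (j : Mode d) (n : Occ d N) : Occ d (N + 1) :=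
  ⟨n.1 + Finsupp.single j 1, by simp [n.2]⟩

theorem Occ.addOne_injective {N : ℕ} (j : Mode d) :
    Function.Injective (Occ.addOne (N := N) j) := by
  intro n n' h
  have := congrArg Subtype.val h
  exact Subtype.ext (add_right_cancel this)

theorem Occ.apply_le {N : ℕ} (j : Mode d) (n : Occ d N) : n.1 j ≤ N :=
  (Finsupp.le_degree j n.1).trans n.2.le

/-- The annihilation operator `a_j : 𝓕^{N+1} → 𝓕^N`, `(a_j ψ)(n) = √(n_j + 1) ψ(n + e_j)`. -/
def annihilation (N : ℕ) (j : Mode d) : FockN d (N + 1) →L[ℂ] FockN d N :=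
  weightedComp (fun n : Occ d N => Real.sqrt (n.1 j + 1)) (Occ.addOne j)
    (Occ.addOne_injective j) (Real.sqrt (N + 1)) (Real.sqrt_nonneg _) (fun n => by
      rw [abs_of_nonneg (Real.sqrt_nonneg _)]
      have : (n.1 j : ℝ) ≤ N := by exact_mod_cast Occ.apply_le j n
      exact Real.sqrt_le_sqrt (by linarith))

/-- The creation operator `a*_j : 𝓕^N → 𝓕^{N+1}`. -/
def creation (N : ℕ) (j : Mode d) : FockN d N →L[ℂ] FockN d (N + 1) :=
  ContinuousLinearMap.adjoint (annihilation N j)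

/-- The number operator `a*_j a_j` on `𝓕^N`: multiplication by the occupation number `n_j`. -/
def numberOp (N : ℕ) (j : Mode d) : FockN d N →L[ℂ] FockN d N :=
  weightedComp (fun n : Occ d N => (n.1 j : ℝ)) id Function.injective_id N (Nat.cast_nonneg _)
    (fun n => by
      rw [abs_of_nonneg (Nat.cast_nonneg _)]
      exact_mod_cast Occ.apply_le j n)

open Classical in
/-- The projection of `𝓕^N` onto the span of the occupation number states with property `p`. -/
def occProj {N : ℕ} (p : Occ d N → Prop) : FockN d N →L[ℂ] FockN d N :=
  weightedComp (fun n => if p n then 1 else 0) id Function.injective_id 1 zero_le_one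
    (fun n => by
      show |(if p n then (1 : ℝ) else 0)| ≤ 1
      split_ifs <;> simp)

/-- The number of particles in the modes `j` and `-j`. -/
def Occ.pair {N : ℕ} (j : Mode d) (n : Occ d N) : ℕ := n.1 j + n.1 (-j)

/-- `Q_j^{(i,i+1)}`: there are `N - i` or `N - i - 1` particles in the modes `±j`. -/
def Qeq (N : ℕ) (j : Mode d) (i : ℕ) : FockN d N →L[ℂ] FockN d N :=
  occProj fun n => n.pair j + i = N ∨ n.pair j + (i + 1) = N

/-- `Q_j^{(>i+1)}`: there are fewer than `N - i - 1` particles in the modes `±j`. -/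
def Qgt (N : ℕ) (j : Mode d) (i : ℕ) : FockN d N →L[ℂ] FockN d N :=
  occProj fun n => n.pair j + (i + 1) < N

/-! ### The Bogoliubov Hamiltonians -/

/-- `W_j = (φ_j / N) a*_0 a*_0 a_j a_{-j}` for `j ≠ 0`; since `a_{±j}` commute with `a*_0` the
creation operators may be applied first. -/
def W (φ : PairPotential d L) (N : ℕ) (j : Mode d) : FockN d N →L[ℂ] FockN d N :=
  ((φ.coeff j / N : ℝ) : ℂ) •
    (annihilation N j ∘L annihilation (N + 1) (-j) ∘L creation (N + 1) 0 ∘L creation N 0)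

/-- `W*_j = (φ_j / N) a_0 a_0 a*_j a*_{-j}`. -/
def Wstar (φ : PairPotential d L) (N : ℕ) (j : Mode d) : FockN d N →L[ℂ] FockN d N :=
  ((φ.coeff j / N : ℝ) : ℂ) •
    (annihilation N 0 ∘L annihilation (N + 1) 0 ∘L creation (N + 1) j ∘L creation N (-j))

/-- `Ĥ⁰_j = (k_j² + φ_j a*_0 a_0 / N) a*_j a_j + (k_j² + φ_j a*_0 a_0 / N) a*_{-j} a_{-j}`. -/
def Hhat0 (φ : PairPotential d L) (N : ℕ) (j : Mode d) : FockN d N →L[ℂ] FockN d N :=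
  (((kSq L j : ℝ) : ℂ) • ContinuousLinearMap.id ℂ _ +
      ((φ.coeff j / N : ℝ) : ℂ) • numberOp N 0) ∘L (numberOp N j) +
    (((kSq L j : ℝ) : ℂ) • ContinuousLinearMap.id ℂ _ +
      ((φ.coeff j / N : ℝ) : ℂ) • numberOp N 0) ∘L (numberOp N (-j))

/-- `Ĥ^Bog_j = Ĥ⁰_j + W_j + W*_j`. -/
def HhatBog (φ : PairPotential d L) (N : ℕ) (j : Mode d) : FockN d N →L[ℂ] FockN d N :=
  Hhat0 φ N j + W φ N j + Wstar φ N j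

/-- `∑_{l=1}^m Ĥ^Bog_{j_l}`. -/
def sumHhatBog (φ : PairPotential d L) (N : ℕ) (J : ℕ → Mode d) (m : ℕ) :
    FockN d N →L[ℂ] FockN d N :=
  ∑ l ∈ Finset.Icc 1 m, HhatBog φ N (J l)

open Classical in
/-- `∑_j k_j² a*_j a_j` over the modes `j` different from `±j_1, …, ±j_m`. -/
def kineticOutside (L : ℝ) (N : ℕ) (J : ℕ → Mode d) (m : ℕ) : FockN d N →ₗ.[ℂ] FockN d N :=
  diagPMap fun n : Occ d N =>
    ∑ j ∈ n.1.support.filter (fun j => ∀ l ∈ Finset.Icc 1 m, j ≠ J l ∧ j ≠ -J l),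
      kSq L j * (n.1 j : ℝ)

/-- The Hamiltonian `H^Bog_{j_1,…,j_m}`. -/
def HBog (φ : PairPotential d L) (N : ℕ) (J : ℕ → Mode d) (m : ℕ) : FockN d N →ₗ.[ℂ] FockN d N :=
  kineticOutside L N J m + ofCLM (sumHhatBog φ N J m)

/-- `z^Bog_{j_1,…,j_m}`, the ground state energy of `H^Bog_{j_1,…,j_m}` for `m ≥ 1`, and `0` for
`m = 0`. -/
def zBog (φ : PairPotential d L) (N : ℕ) (J : ℕ → Mode d) : ℕ → ℝ
  | 0 => 0
  | m + 1 => infspec (HBog φ N J (m + 1))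

/-! ### The Feshbach-Schur flow.  The even index `i` is written `i = 2 s`. -/

section Flow

variable (φ : PairPotential d L) (N : ℕ) (J : ℕ → Mode d) (m : ℕ) (w : ℝ)

/-- `H^Bog_{j_1,…,j_m} - w`. -/
def HBogSub : FockN d N →ₗ.[ℂ] FockN d N :=
  HBog φ N J m - ofCLM ((w : ℂ) • ContinuousLinearMap.id ℂ _)

/-- The iterated Feshbach-Schur Hamiltonians `𝒦^{Bog(2s)}_{j_1,…,j_m}(w)`: starting from
`H^Bog_{j_1,…,j_m} - w`, at the step `i = 2s` one applies the Feshbach-Schur map associated with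
the projections `Q^{(>i+1)}_{j_m}` and `Q^{(i,i+1)}_{j_m}`. -/
def KBog : ℕ → (FockN d N →ₗ.[ℂ] FockN d N)
  | 0 => feshbach (Qgt N (J m) 0) (Qeq N (J m) 0) (HBogSub φ N J m w)
  | s + 1 => feshbach (Qgt N (J m) (2 * (s + 1))) (Qeq N (J m) (2 * (s + 1))) (KBog s)

/-- The `i`-th step of the flow (`i = 2s`) is well defined: the operator to be inverted in the
Feshbach-Schur map has a bounded inverse on the range of `Q^{(i,i+1)}_{j_m}`. -/
def StepDefined : ℕ → Prop
  | 0 => ReducedInvertible (Qeq N (J m) 0) (HBogSub φ N J m w)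
  | s + 1 => ReducedInvertible (Qeq N (J m) (2 * (s + 1))) (KBog φ N J m w s)

/-- `R^Bog_{j_1,…,j_m; i,i}(w)` for `i = 2s`. -/
def RBog (s : ℕ) : FockN d N →L[ℂ] FockN d N :=
  reducedInv (Qeq N (J m) (2 * s)) (HBogSub φ N J m w)

/-- `W_{j_m; i,i'} = Q^{(i,i+1)} W_{j_m} Q^{(i',i'+1)}`. -/
def WBlock (i i' : ℕ) : FockN d N →L[ℂ] FockN d N :=
  Qeq N (J m) i ∘L W φ N (J m) ∘L Qeq N (J m) i'

/-- `W*_{j_m; i,i'} = Q^{(i,i+1)} W*_{j_m} Q^{(i',i'+1)}`. -/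
def WstarBlock (i i' : ℕ) : FockN d N →L[ℂ] FockN d N :=
  Qeq N (J m) i ∘L Wstar φ N (J m) ∘L Qeq N (J m) i'

/-- `Γ^Bog_{j_1,…,j_m; i,i}(w)` for `i = 2s ≥ 2` (the value at `s = 0` is not used). -/
def GammaBog : ℕ → (FockN d N →L[ℂ] FockN d N)
  | 0 => 0
  | 1 => WBlock φ N J m 2 0 ∘L RBog φ N J m w 0 ∘L WstarBlock φ N J m 0 2
  | s + 2 =>
    WBlock φ N J m (2 * (s + 2)) (2 * (s + 1)) ∘L RBog φ N J m w (s + 1) ∘L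
      (∑' l : ℕ, (GammaBog (s + 1) ∘L RBog φ N J m w (s + 1)) ^ l) ∘L
      WstarBlock φ N J m (2 * (s + 1)) (2 * (s + 2))

/-- The operator `R^{1/2} Γ R^{1/2}` at `i = 2s`. -/
def GammaSym (s : ℕ) : FockN d N →L[ℂ] FockN d N :=
  posSqrt (RBog φ N J m w s) ∘L GammaBog φ N J m w s ∘L posSqrt (RBog φ N J m w s)

/-- `Γ̌^Bog_{j_1,…,j_m; i,i}(w) = ∑_{l ≥ 0} [R^{1/2} Γ R^{1/2}]^l` at `i = 2s`. -/
def GammaCheck (s : ℕ) : FockN d N →L[ℂ] FockN d N := ∑' l : ℕ, (GammaSym φ N J m w s) ^ l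

/-- `Q^{(>1)} (H - w) Q^{(>1)} - Q^{(>1)} W R_{0,0} W* Q^{(>1)}`. -/
def KFormulaZero : FockN d N →ₗ.[ℂ] FockN d N :=
  pcomp (ofCLM (Qgt N (J m) 0)) (pcomp (HBogSub φ N J m w) (ofCLM (Qgt N (J m) 0))) -
    ofCLM (Qgt N (J m) 0 ∘L W φ N (J m) ∘L RBog φ N J m w 0 ∘L
      Wstar φ N (J m) ∘L Qgt N (J m) 0)

/-- `Q^{(>i+1)} (H - w) Q^{(>i+1)} - Q^{(>i+1)} W R_{i,i} ∑_l [Γ_{i,i} R_{i,i}]^l W* Q^{(>i+1)}`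
for `i = 2s ≥ 2`. -/
def KFormula (s : ℕ) : FockN d N →ₗ.[ℂ] FockN d N :=
  pcomp (ofCLM (Qgt N (J m) (2 * s))) (pcomp (HBogSub φ N J m w) (ofCLM (Qgt N (J m) (2 * s)))) -
    ofCLM (Qgt N (J m) (2 * s) ∘L W φ N (J m) ∘L RBog φ N J m w s ∘L
      (∑' l : ℕ, (GammaBog φ N J m w s ∘L RBog φ N J m w s) ^ l) ∘L
      Wstar φ N (J m) ∘L Qgt N (J m) (2 * s))

end Flow

/-! ### The comparison sequence -/

/-- `δ = 1 + √ε`. -/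
def deltaEps (ε : ℝ) : ℝ := 1 + Real.sqrt ε

/-- `b_ε = (1+ε) δ χ_{[0,2)}(δ) √(ε²+2ε)` at `δ = 1 + √ε`. -/
def bEps (ε : ℝ) : ℝ :=
  (1 + ε) * deltaEps ε * (Set.Ico (0 : ℝ) 2).indicator 1 (deltaEps ε) * Real.sqrt (ε ^ 2 + 2 * ε)

/-- `c_ε = -(1 - δ² χ_{[0,2)}(δ)) (ε²+2ε)` at `δ = 1 + √ε`. -/
def cEps (ε : ℝ) : ℝ :=
  -(1 - deltaEps ε ^ 2 * (Set.Ico (0 : ℝ) 2).indicator 1 (deltaEps ε)) * (ε ^ 2 + 2 * ε)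

/-- `X_{2j}`, with `a` standing for the value `a_ε`. -/
def XSeq (a ε : ℝ) (N : ℕ) : ℕ → ℝ
  | 0 => 1
  | j + 1 =>
    1 - 1 / (4 * (1 + a - 2 * bEps ε / ((N : ℝ) - 2 * j - 1)
      - (1 - cEps ε) / ((N : ℝ) - 2 * j - 1) ^ 2) * XSeq a ε N j)

/-- The lower bound `½ [1 + √(η a) - (b/√(η a)) / (N - 2j - ε^Θ)]` for `X_{2j}`, with `η = 1 - √ε`
and `Θ = min {2 (ν - 11/8), 1/4}`. -/
def XLower (ν a ε : ℝ) (N j : ℕ) : ℝ :=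
  1 / 2 * (1 + Real.sqrt ((1 - Real.sqrt ε) * a)
    - (bEps ε / Real.sqrt ((1 - Real.sqrt ε) * a))
      / ((N : ℝ) - 2 * j - ε ^ (min (2 * (ν - 11 / 8)) (1 / 4))))

end BoseGas

end

noncomputable section

namespace BoseGas

/-! ### Graphs of unbounded operators -/

section Graphs

variable {H : Type} [NormedAddCommGroup H] [InnerProductSpace ℂ H]

/-! Only `W` and `Wstar` for the couple `±j_m` change the number of particles in the modes `±j_m`:
the first lowers it by two, the second raises it by two, and everything else in the Hamiltonian
preserves it. Grouping pair numbers two at a time, the blocks `Qeq` make the Hamiltonian block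
tridiagonal. Eliminating a block by the Feshbach-Schur map therefore alters the rest only inside the
next block, where it subtracts `Γ_{s+1} = W D_s W*`, with `D_s` the inverse of the current
Hamiltonian on block `s`. A Neumann series gives `D_s = R_s ∑ (Γ_s R_s)^l`, so the flow is an
operator-valued continued fraction. The algebra is in `FlowRelations.feshbach_succ`, the inverse in
`IsReducedInverse.geometric`, the induction in `stepDefined_and_KBog_eq`.

What has to be estimated is the hopping `R_{s+1}^{1/2} W R_s^{1/2}`. The assumption on the bottom of
the spectrum of the other couples gives `H - w ≥ D` as forms on each block, where `D` is a positive
diagonal energy (`re_inner_Hhat0_le_boundedPart`). Hence `D^{1/2} R_s^{1/2}` is a contraction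
(`norm_mul_sqrt_le_one`), and the hopping is bounded by `D^{-1/2} W D^{-1/2}`. The latter is a
weighted shift in the occupation basis, whose norm is bounded by any common bound for its entries.
By `hopping_le` the squared entries that start in block `s` are at most `x_s = 1 / (4 U_s)`, where
`U_s` is the bracket in the recursion for `XSeq`. If the sum of the series `Γ̌_s` has norm at most
`1 / X_s`, the next term `R^{1/2} Γ R^{1/2}` has norm at most `x_s / X_s`, and its geometric series
has norm at most `1 / (1 - x_s / X_s) = 1 / X_{s+1}`.

It remains to keep `X_s` positive. `XLower` is a subsolution of the recursion, by the one step
inequality `one_le_mul_mul_of_small`. The choice `a_ε = 2 ε` suffices: the diagonal energies would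
allow `(1 + ε)² = 1 + 2 ε + ε²`, and the spare `ε²` absorbs all errors that vanish for large `N`. -/

theorem mem_graph_iff_exists_domain {T : H →ₗ.[ℂ] H} {x y : H} :
    (x, y) ∈ T.graph ↔ ∃ h : x ∈ T.domain, T ⟨x, h⟩ = y := by
  rw [LinearPMap.mem_graph_iff]
  constructor
  · rintro ⟨⟨z, hz⟩, rfl, h⟩
    exact ⟨hz, h⟩
  · rintro ⟨h, rfl⟩
    exact ⟨⟨x, h⟩, rfl, rfl⟩

/-- A graph records domain and values together, so the identities between unbounded operators below
need no separate comparison of domains. -/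
theorem eq_of_forall_mem_graph_iff {S T : H →ₗ.[ℂ] H}
    (h : ∀ x y, (x, y) ∈ S.graph ↔ (x, y) ∈ T.graph) : S = T :=
  LinearPMap.eq_of_eq_graph (SetLike.ext fun ⟨x, y⟩ => h x y)

theorem mem_graph_ofCLM {A : H →L[ℂ] H} {x y : H} : (x, y) ∈ (ofCLM A).graph ↔ A x = y := by
  rw [mem_graph_iff_exists_domain]
  exact ⟨fun ⟨_, h⟩ => h, fun h => ⟨trivial, h⟩⟩

theorem mem_graph_pcomp {S T : H →ₗ.[ℂ] H} {x z : H} :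
    (x, z) ∈ (pcomp S T).graph ↔ ∃ y, (x, y) ∈ T.graph ∧ (y, z) ∈ S.graph := by
  simp only [mem_graph_iff_exists_domain]
  constructor
  · rintro ⟨h, rfl⟩
    obtain ⟨⟨y, hy1⟩, hy, hyx⟩ := Submodule.mem_map.1 h.1
    obtain rfl : y = x := hyx
    exact ⟨T ⟨y, hy1⟩, ⟨hy1, rfl⟩, hy, rfl⟩
  · rintro ⟨y, ⟨h, rfl⟩, h', rfl⟩
    exact ⟨⟨Submodule.mem_map.2 ⟨⟨x, h⟩, h', rfl⟩, h⟩, rfl⟩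

theorem mem_graph_add {S T : H →ₗ.[ℂ] H} {x z : H} :
    (x, z) ∈ (S + T).graph ↔ ∃ y y', (x, y) ∈ S.graph ∧ (x, y') ∈ T.graph ∧ z = y + y' := by
  simp only [mem_graph_iff_exists_domain]
  constructor
  · rintro ⟨h, rfl⟩
    exact ⟨_, _, ⟨h.1, rfl⟩, ⟨h.2, rfl⟩, rfl⟩
  · rintro ⟨_, _, ⟨h, rfl⟩, ⟨h', rfl⟩, rfl⟩
    exact ⟨⟨h, h'⟩, rfl⟩

theorem mem_graph_sub {S T : H →ₗ.[ℂ] H} {x z : H} :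
    (x, z) ∈ (S - T).graph ↔ ∃ y y', (x, y) ∈ S.graph ∧ (x, y') ∈ T.graph ∧ z = y - y' := by
  simp only [mem_graph_iff_exists_domain]
  constructor
  · rintro ⟨h, rfl⟩
    exact ⟨_, _, ⟨h.1, rfl⟩, ⟨h.2, rfl⟩, LinearPMap.sub_apply S T _⟩
  · rintro ⟨_, _, ⟨h, rfl⟩, ⟨h', rfl⟩, rfl⟩
    exact ⟨⟨h, h'⟩, LinearPMap.sub_apply S T _⟩

theorem IsReducedInverse.exists_graph {P : H →L[ℂ] H} {K : H →ₗ.[ℂ] H} {R : H →L[ℂ] H}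
    (h : IsReducedInverse P K R) (ψ : H) : ∃ z, (R ψ, z) ∈ K.graph ∧ P z = P ψ := by
  obtain ⟨h1, h2⟩ := h.right_inv ψ
  exact ⟨_, mem_graph_iff_exists_domain.2 ⟨h1, rfl⟩, h2⟩

theorem IsReducedInverse.apply_of_graph {P : H →L[ℂ] H} {K : H →ₗ.[ℂ] H} {R : H →L[ℂ] H}
    (h : IsReducedInverse P K R) {x z : H} (hx : (x, z) ∈ K.graph) (hP : P x = x) :
    R (P z) = x := by
  obtain ⟨h1, rfl⟩ := mem_graph_iff_exists_domain.1 hx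
  exact h.left_inv ⟨x, h1⟩ hP

theorem IsReducedInverse.of_graph {P : H →L[ℂ] H} {K : H →ₗ.[ℂ] H} {R : H →L[ℂ] H}
    (h1 : P ∘L R = R) (h2 : R ∘L P = R)
    (h3 : ∀ ψ, ∃ z, (R ψ, z) ∈ K.graph ∧ P z = P ψ)
    (h4 : ∀ x z, (x, z) ∈ K.graph → P x = x → R (P z) = x) : IsReducedInverse P K R where
  left := h1
  right := h2
  right_inv ψ := by
    obtain ⟨z, hz, hP⟩ := h3 ψ
    obtain ⟨h, rfl⟩ := mem_graph_iff_exists_domain.1 hz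
    exact ⟨h, hP⟩
  left_inv ψ hψ := h4 ψ _ (mem_graph_iff_exists_domain.2 ⟨ψ.2, rfl⟩) hψ

theorem IsReducedInverse.unique {P : H →L[ℂ] H} {K : H →ₗ.[ℂ] H} {R R' : H →L[ℂ] H}
    (h : IsReducedInverse P K R) (h' : IsReducedInverse P K R') : R = R' := by
  ext1 ψ
  obtain ⟨z, hz, hP⟩ := h'.exists_graph ψ
  have h1 := h.apply_of_graph hz (congrArg (fun A : H →L[ℂ] H => A ψ) h'.left)
  rw [hP] at h1
  rw [← h1]
  exact (congrArg (fun A : H →L[ℂ] H => A ψ) h.right).symm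

/-- By uniqueness the operator that `reducedInv` selects by choice can be identified by exhibiting
any candidate. -/
theorem IsReducedInverse.reducedInv_eq {P : H →L[ℂ] H} {K : H →ₗ.[ℂ] H} {R : H →L[ℂ] H}
    (h : IsReducedInverse P K R) : reducedInv P K = R := by
  have hex : ReducedInvertible P K := ⟨R, h⟩
  rw [reducedInv, dif_pos hex]
  exact hex.choose_spec.unique h

theorem ReducedInvertible.isReducedInverse {P : H →L[ℂ] H} {K : H →ₗ.[ℂ] H}
    (h : ReducedInvertible P K) : IsReducedInverse P K (reducedInv P K) := by
  obtain ⟨R, hR⟩ := h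
  rwa [hR.reducedInv_eq]

end Graphs

/-! ### Diagonal operators with bounded perturbations -/

section Diagonal

variable {ι : Type}

open Classical in
/-- The projection of `ℓ²(ι)` onto the coordinates with property `p`. -/
def coordProj (p : ι → Prop) : L2 ι →L[ℂ] L2 ι :=
  weightedComp (fun n => if p n then 1 else 0) id Function.injective_id 1 zero_le_one
    (fun n => by
      show |(if p n then (1 : ℝ) else 0)| ≤ 1
      split_ifs <;> simp)

open Classical in
theorem coordProj_apply (p : ι → Prop) (ψ : L2 ι) (k : ι) :
    coordProj p ψ k = if p k then ψ k else 0 := by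
  show (((if p k then (1 : ℝ) else 0) : ℝ) : ℂ) * ψ k = _
  split_ifs <;> simp

theorem coordProj_apply_of_neg {p : ι → Prop} {k : ι} (h : ¬ p k) (ψ : L2 ι) :
    coordProj p ψ k = 0 := by
  rw [coordProj_apply, if_neg h]

theorem coordProj_mul (p q : ι → Prop) :
    coordProj p * coordProj q = coordProj fun k => p k ∧ q k := by
  ext ψ k
  show coordProj p (coordProj q ψ) k = _
  by_cases hp : p k <;> by_cases hq : q k <;> simp [coordProj_apply, hp, hq]

theorem coordProj_false {p : ι → Prop} (h : ∀ k, ¬ p k) : coordProj p = 0 := by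
  ext ψ k
  simp [coordProj_apply, h k]

theorem inner_weightedComp_id {c : ι → ℝ} {C : ℝ} (hC : 0 ≤ C) (hc : ∀ k, |c k| ≤ C)
    (ψ χ : L2 ι) :
    inner ℂ (weightedComp c id Function.injective_id C hC hc ψ) χ =
      inner ℂ ψ (weightedComp c id Function.injective_id C hC hc χ) := by
  rw [lp.inner_eq_tsum, lp.inner_eq_tsum]
  congr 1
  funext k
  show inner ℂ ((c k : ℂ) * ψ k) (χ k) = inner ℂ (ψ k) ((c k : ℂ) * χ k)
  simp only [RCLike.inner_apply, map_mul, Complex.conj_ofReal]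
  ring

theorem isSelfAdjoint_weightedComp_id {c : ι → ℝ} {C : ℝ} (hC : 0 ≤ C) (hc : ∀ k, |c k| ≤ C) :
    IsSelfAdjoint (weightedComp c id Function.injective_id C hC hc) := by
  rw [ContinuousLinearMap.isSelfAdjoint_iff_isSymmetric]
  exact fun ψ χ => inner_weightedComp_id hC hc ψ χ

theorem isSelfAdjoint_coordProj (p : ι → Prop) : IsSelfAdjoint (coordProj p) :=
  isSelfAdjoint_weightedComp_id _ _

/-- The domain is maximal: that `y` lies in `ℓ²` and equals `f x` coordinatewise already puts `x`
into it. -/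
theorem mem_graph_diagPMap {f : ι → ℝ} {x y : L2 ι} :
    (x, y) ∈ (diagPMap f).graph ↔ ∀ k, y k = (f k : ℂ) * x k := by
  rw [mem_graph_iff_exists_domain]
  constructor
  · rintro ⟨h, rfl⟩ k
    rfl
  · intro h
    have hx : x ∈ (diagPMap f).domain := by
      show Memℓp (fun k => (f k : ℂ) * x k) 2
      have h' : (fun k => (f k : ℂ) * x k) = (y : ∀ k, ℂ) := funext fun k => (h k).symm
      rw [h']
      exact lp.memℓp y
    refine ⟨hx, ?_⟩
    ext k
    exact (h k).symm

theorem mem_graph_diagPMap_add {f : ι → ℝ} {B : L2 ι →L[ℂ] L2 ι} {x z : L2 ι} :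
    (x, z) ∈ (diagPMap f + ofCLM B).graph ↔ ∀ k, z k = (f k : ℂ) * x k + B x k := by
  rw [mem_graph_add]
  simp only [mem_graph_diagPMap, mem_graph_ofCLM]
  constructor
  · rintro ⟨y, _, h, rfl, rfl⟩ k
    rw [← h k]
    rfl
  · intro h
    refine ⟨z - B x, B x, fun k => ?_, rfl, by simp⟩
    show z k - B x k = _
    rw [h k]
    ring

theorem diagPMap_add_ofCLM_sub (f : ι → ℝ) (A B : L2 ι →L[ℂ] L2 ι) :
    (diagPMap f + ofCLM A) - ofCLM B = diagPMap f + ofCLM (A - B) := by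
  refine eq_of_forall_mem_graph_iff fun x z => ?_
  rw [mem_graph_sub]
  simp only [mem_graph_diagPMap_add, mem_graph_ofCLM]
  constructor
  · rintro ⟨y, _, h, rfl, rfl⟩ k
    show y k - B x k = _ + (A x k - B x k)
    rw [h k]
    ring
  · intro h
    refine ⟨z + B x, B x, fun k => ?_, rfl, by simp⟩
    show z k + B x k = _
    rw [h k]
    show _ + (A x k - B x k) + B x k = _
    ring

open Classical in
/-- The function `f`, cut off to the set where `p` holds. -/
def cutoff (p : ι → Prop) (f : ι → ℝ) : ι → ℝ := fun k => if p k then f k else 0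

theorem cutoff_of_pos {p : ι → Prop} {k : ι} (h : p k) (f : ι → ℝ) : cutoff p f k = f k :=
  if_pos h

theorem cutoff_of_neg {p : ι → Prop} {k : ι} (h : ¬ p k) (f : ι → ℝ) : cutoff p f k = 0 :=
  if_neg h

theorem cutoff_cutoff {p q : ι → Prop} (h : ∀ k, p k → q k) (f : ι → ℝ) :
    cutoff p (cutoff q f) = cutoff p f := by
  funext k
  by_cases hp : p k
  · rw [cutoff_of_pos hp, cutoff_of_pos hp, cutoff_of_pos (h k hp)]
  · rw [cutoff_of_neg hp, cutoff_of_neg hp]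

/-- A coordinate projection commutes with multiplication by `f`. The compression is defined at `x`
exactly when `f` times the projected `x` lies in `ℓ²`, which is the domain of multiplication by the
cut off function. -/
theorem coordProj_compress (f : ι → ℝ) (B : L2 ι →L[ℂ] L2 ι) (p : ι → Prop) :
    pcomp (ofCLM (coordProj p)) (pcomp (diagPMap f + ofCLM B) (ofCLM (coordProj p))) =
      diagPMap (cutoff p f) + ofCLM (coordProj p * B * coordProj p) := by
  refine eq_of_forall_mem_graph_iff fun x z => ?_
  simp only [mem_graph_pcomp, mem_graph_ofCLM, mem_graph_diagPMap_add]
  have hx : ∀ k, (coordProj p * B * coordProj p) x k =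
      coordProj p (B (coordProj p x)) k := fun _ => rfl
  constructor
  · rintro ⟨y, ⟨_, rfl, hy⟩, rfl⟩ k
    rw [hx]
    by_cases h : p k
    · simp [coordProj_apply, cutoff, h, hy k]
    · simp [coordProj_apply, cutoff, h]
  · intro h
    refine ⟨z - coordProj p (B (coordProj p x)) + B (coordProj p x), ⟨_, rfl, fun k => ?_⟩, ?_⟩
    · show z k - coordProj p (B (coordProj p x)) k + B (coordProj p x) k = _
      rw [h k, hx]
      by_cases hp : p k <;> simp [hp, coordProj_apply, cutoff]
    · ext k
      rw [coordProj_apply]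
      have h' := h k
      rw [hx] at h'
      by_cases hp : p k
      · rw [if_pos hp]
        show z k - coordProj p (B (coordProj p x)) k + B (coordProj p x) k = _
        rw [coordProj_apply, if_pos hp]
        ring
      · rw [if_neg hp, h', cutoff_of_neg hp, coordProj_apply, if_neg hp]
        simp

/-- The Feshbach-Schur map for a diagonal operator with a bounded perturbation. -/
theorem feshbach_diagPMap_add {f : ι → ℝ} {B R : L2 ι →L[ℂ] L2 ι} {p q : ι → Prop}
    (hpq : ∀ k, p k → ¬ q k)
    (hR : IsReducedInverse (coordProj q) (diagPMap f + ofCLM B) R) :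
    feshbach (coordProj p) (coordProj q) (diagPMap f + ofCLM B) =
      diagPMap (cutoff p f) +
        ofCLM (coordProj p * B * coordProj p - coordProj p * B * R * B * coordProj p) := by
  rw [feshbach, hR.reducedInv_eq, coordProj_compress, ← diagPMap_add_ofCLM_sub]
  have hRq : ∀ v, coordProj q (R v) = R v := fun v =>
    congrArg (fun A : L2 ι →L[ℂ] L2 ι => A v) hR.left
  have hRq' : ∀ v, R (coordProj q v) = R v := fun v =>
    congrArg (fun A : L2 ι →L[ℂ] L2 ι => A v) hR.right
  have key : ∀ x y z, (∀ k, y k = (f k : ℂ) * coordProj p x k + B (coordProj p x) k) →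
      (R (coordProj q y), z) ∈ (diagPMap f + ofCLM B).graph →
        coordProj p z = (coordProj p * B * R * B * coordProj p) x := by
    intro x y z hy hz
    rw [mem_graph_diagPMap_add] at hz
    -- The projected vector vanishes on the coordinates of `q`, so the unbounded part does not
    -- contribute there: the two ranges are coupled only through the bounded `B`.
    have h1 : coordProj q y = coordProj q (B (coordProj p x)) := by
      ext k
      rw [coordProj_apply, coordProj_apply, hy k]
      by_cases hq : q k
      · have : ¬ p k := fun h => hpq k h hq
        simp [hq, coordProj_apply, this]
      · simp [hq]
    rw [h1, hRq'] at hz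
    show _ = coordProj p (B (R (B (coordProj p x))))
    ext k
    rw [coordProj_apply, coordProj_apply, hz k]
    by_cases hp : p k
    · rw [if_pos hp, if_pos hp, ← hRq, coordProj_apply_of_neg (hpq k hp)]
      simp
    · simp [hp]
  refine eq_of_forall_mem_graph_iff fun x z => ?_
  rw [mem_graph_sub, mem_graph_sub]
  constructor
  · rintro ⟨y, y', h1, h2, rfl⟩
    refine ⟨y, y', h1, ?_, rfl⟩
    simp only [mem_graph_pcomp, mem_graph_ofCLM] at h2 ⊢
    obtain ⟨u, ⟨_, ⟨_, ⟨v, ⟨_, rfl, hv⟩, rfl⟩, rfl⟩, hu⟩, rfl⟩ := h2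
    exact (key x v u (mem_graph_diagPMap_add.1 hv) hu).symm
  · rintro ⟨y, y', h1, h2, rfl⟩
    refine ⟨y, y', h1, ?_, rfl⟩
    rw [← coordProj_compress] at h1
    simp only [mem_graph_pcomp, mem_graph_ofCLM] at h1 h2 ⊢
    obtain ⟨v, ⟨_, rfl, hv⟩, rfl⟩ := h1
    -- `R` maps everything into the domain of the operator, so the subtracted term imposes no
    -- further domain condition.
    obtain ⟨u, hu, -⟩ := hR.exists_graph (coordProj q v)
    refine ⟨u, ⟨_, ⟨_, ⟨v, ⟨_, rfl, hv⟩, rfl⟩, rfl⟩, hu⟩, ?_⟩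
    rw [key x v u (mem_graph_diagPMap_add.1 hv) hu, h2]

open Classical in
theorem single_mem_graph_diagPMap_add (f : ι → ℝ) (B : L2 ι →L[ℂ] L2 ι) (k : ι) :
    (lp.single 2 k (1 : ℂ), lp.single 2 k (f k : ℂ) + B (lp.single 2 k (1 : ℂ))) ∈
      (diagPMap f + ofCLM B).graph := by
  rw [mem_graph_diagPMap_add]
  intro i
  show (lp.single 2 k (f k : ℂ) : L2 ι) i + _ = _
  by_cases h : i = k
  · subst h
    simp
  · simp [Pi.single_eq_of_ne h]

theorem dense_diagPMap_add_domain (f : ι → ℝ) (B : L2 ι →L[ℂ] L2 ι) :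
    Dense ((diagPMap f + ofCLM B).domain : Set (L2 ι)) := by
  classical
  rw [Submodule.dense_iff_topologicalClosure_eq_top, Submodule.topologicalClosure_eq_top_iff,
    Submodule.eq_bot_iff]
  intro x hx
  ext k
  obtain ⟨hk, -⟩ := mem_graph_iff_exists_domain.1 (single_mem_graph_diagPMap_add f B k)
  have := (Submodule.mem_orthogonal _ _).1 hx _ hk
  rw [lp.inner_single_left] at this
  simpa using this

theorem isSelfAdjoint_diagPMap_add (f : ι → ℝ) {B : L2 ι →L[ℂ] L2 ι} (hB : IsSelfAdjoint B) :
    IsSelfAdjoint (diagPMap f + ofCLM B) := by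
  classical
  set T := diagPMap f + ofCLM B with hT
  have hdense := dense_diagPMap_add_domain f B
  have hBs : ∀ x y, inner ℂ (B x) y = inner ℂ x (B y) :=
    (ContinuousLinearMap.isSelfAdjoint_iff_isSymmetric.1 hB)
  have hsymm : T.IsFormalAdjoint T := by
    intro x y
    obtain ⟨x, hx⟩ := x
    obtain ⟨y, hy⟩ := y
    have gx := mem_graph_diagPMap_add.1 (mem_graph_iff_exists_domain.2 ⟨hx, rfl⟩)
    have gy := mem_graph_diagPMap_add.1 (mem_graph_iff_exists_domain.2 ⟨hy, rfl⟩)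
    have e1 : inner ℂ (T ⟨x, hx⟩ - B x) y = inner ℂ x (T ⟨y, hy⟩ - B y) := by
      rw [lp.inner_eq_tsum, lp.inner_eq_tsum]
      congr 1
      funext k
      show inner ℂ (T ⟨x, hx⟩ k - B x k) (y k) = inner ℂ (x k) (T ⟨y, hy⟩ k - B y k)
      rw [gx k, gy k]
      simp only [RCLike.inner_apply, map_mul, map_sub, map_add, Complex.conj_ofReal]
      ring
    rw [inner_sub_left, inner_sub_right, hBs] at e1
    exact sub_left_injective e1
  rw [LinearPMap.isSelfAdjoint_def]
  refine (LinearPMap.eq_of_le_of_domain_eq (hsymm.le_adjoint hdense) ?_).symm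
  refine le_antisymm (hsymm.le_adjoint hdense).1 ?_
  intro y hy
  have hadj := LinearPMap.adjoint_isFormalAdjoint hdense
  -- Pairing with the basis vectors, which lie in the domain, computes every coordinate of the
  -- adjoint at `y`; maximality of the domain then places `y` in it.
  have : (y, T.adjoint ⟨y, hy⟩) ∈ T.graph := by
    rw [mem_graph_diagPMap_add]
    intro k
    obtain ⟨hk, hTk⟩ := mem_graph_iff_exists_domain.1 (single_mem_graph_diagPMap_add f B k)
    have h1 := hadj ⟨y, hy⟩ ⟨_, hk⟩
    rw [hTk, inner_add_right, ← hBs] at h1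
    simp only [lp.inner_single_right] at h1
    have h2 := congrArg (starRingEnd ℂ) h1
    simpa [mul_comm] using h2
  exact (mem_graph_iff_exists_domain.1 this).1

end Diagonal

/-! ### Geometric series in a `C*`-algebra -/

section Series

variable {A : Type*} [NormedRing A]

/-- With `R = r²`, this moves the series in `Γ R`, whose ratio need not have norm below one, to the
series in the symmetric ratio `r Γ r`, whose norm is under control. -/
theorem mul_sq_pow_succ (Γ r : A) (l : ℕ) :
    (Γ * (r * r)) ^ (l + 1) = Γ * r * (r * Γ * r) ^ l * r := by
  induction l with
  | zero => simp [mul_assoc]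
  | succ l ih => rw [pow_succ, ih, pow_succ (r * Γ * r)]; simp only [mul_assoc]

theorem isSelfAdjoint_tsum_pow [StarRing A] [ContinuousStar A] {X : A} (h : IsSelfAdjoint X) :
    IsSelfAdjoint (∑' l : ℕ, X ^ l) := by
  rw [IsSelfAdjoint, tsum_star]
  simp [h.star_eq]

variable [CompleteSpace A]

theorem summable_mul_sq_pow {Γ r : A} (h : ‖r * Γ * r‖ < 1) :
    Summable fun l : ℕ => (Γ * (r * r)) ^ l := by
  rw [← summable_nat_add_iff 1]
  simp only [mul_sq_pow_succ]
  exact ((summable_geometric_of_norm_lt_one h).mul_left _).mul_right _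

theorem tsum_mul_sq_pow {Γ r : A} (h : ‖r * Γ * r‖ < 1) :
    ∑' l : ℕ, (Γ * (r * r)) ^ l = 1 + Γ * r * (∑' l : ℕ, (r * Γ * r) ^ l) * r := by
  rw [(summable_mul_sq_pow h).tsum_eq_zero_add]
  simp only [mul_sq_pow_succ, pow_zero]
  have hs := summable_geometric_of_norm_lt_one h
  rw [(hs.mul_left _).tsum_mul_right, hs.tsum_mul_left]

theorem sq_mul_tsum_mul_sq_pow {Γ r : A} (h : ‖r * Γ * r‖ < 1) :
    r * r * ∑' l : ℕ, (Γ * (r * r)) ^ l = r * (∑' l : ℕ, (r * Γ * r) ^ l) * r := by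
  rw [tsum_mul_sq_pow h]
  have h1 := mul_neg_geom_series (r * Γ * r) h
  set T := ∑' l : ℕ, (r * Γ * r) ^ l
  have h2 : T = 1 + r * Γ * r * T := by rw [← h1]; noncomm_ring
  conv_rhs => rw [h2]
  noncomm_ring

/-- The fixed point equation `D = R + D Γ R` for the dressed inverse. Together with
`tsum_eq_one_add_mul` it makes `D` a two-sided inverse. -/
theorem sq_mul_tsum_eq_right {Γ r : A} (h : ‖r * Γ * r‖ < 1) :
    r * r * ∑' l : ℕ, (Γ * (r * r)) ^ l =
      r * r + (r * r * ∑' l : ℕ, (Γ * (r * r)) ^ l) * Γ * (r * r) := by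
  rw [sq_mul_tsum_mul_sq_pow h]
  have h1 := geom_series_mul_neg (r * Γ * r) h
  set T := ∑' l : ℕ, (r * Γ * r) ^ l
  have h2 : T = 1 + T * (r * Γ * r) := by rw [← h1]; noncomm_ring
  conv_lhs => rw [h2]
  noncomm_ring

end Series

/-! ### Contractions built from square roots of positive elements -/

section Positivity

variable {A : Type*} [CStarAlgebra A] [PartialOrder A] [StarOrderedRing A]

/-- Conjugating the hypothesis by `E` shows that `Z = E R E` satisfies `Z² ≤ Z`. Hence `‖Z‖ ≤ 1`,
and `‖Z‖` is the square of the norm in question. -/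
theorem norm_mul_sqrt_le_one {R E : A} (hR : 0 ≤ R) (hE : IsSelfAdjoint E)
    (h : R * (E * E) * R ≤ R) : ‖E * CFC.sqrt R‖ ≤ 1 := by
  have hr : IsSelfAdjoint (CFC.sqrt R) := (CFC.sqrt_nonneg R).isSelfAdjoint
  have hZ : 0 ≤ E * R * E := hE.conjugate_nonneg hR
  have hZZ : E * R * E * (E * R * E) ≤ E * R * E := by
    have := hE.conjugate_le_conjugate h
    calc E * R * E * (E * R * E) = E * (R * (E * E) * R) * E := by simp only [mul_assoc]
      _ ≤ _ := this
  have h0 : 0 ≤ E * R * E * (E * R * E) := by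
    have := star_mul_self_nonneg (E * R * E)
    rwa [hZ.isSelfAdjoint.star_eq] at this
  have h1 : ‖E * R * E‖ * ‖E * R * E‖ ≤ ‖E * R * E‖ := by
    have h2 := CStarRing.norm_star_mul_self (x := E * R * E)
    rw [hZ.isSelfAdjoint.star_eq] at h2
    rw [← h2]
    exact CStarAlgebra.norm_le_norm_of_nonneg_of_le h0 hZZ
  have h3 : ‖E * CFC.sqrt R‖ * ‖E * CFC.sqrt R‖ = ‖E * R * E‖ := by
    rw [← CStarRing.norm_self_mul_star, star_mul, hr.star_eq, hE.star_eq]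
    congr 1
    calc E * CFC.sqrt R * (CFC.sqrt R * E) = E * (CFC.sqrt R * CFC.sqrt R) * E := by
          simp only [mul_assoc]
      _ = _ := by rw [CFC.sqrt_mul_sqrt_self R hR]
  have h4 : ‖E * R * E‖ ≤ 1 := by
    by_contra! h4
    nlinarith
  nlinarith [norm_nonneg (E * CFC.sqrt R)]

/-- Inserting `E F = F E = 1` on both sides of `V` leaves two contractions around `F V F`. This
replaces inexplicit resolvents by an explicit diagonal weight `F = E⁻¹`. -/
theorem norm_sqrt_mul_mul_sqrt_le {R R' E F V : A} (hR : 0 ≤ R) (hR' : 0 ≤ R')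
    (hE : IsSelfAdjoint E) (hEF : E * F = 1) (hFE : F * E = 1)
    (h : R * (E * E) * R ≤ R) (h' : R' * (E * E) * R' ≤ R') :
    ‖CFC.sqrt R' * V * CFC.sqrt R‖ ≤ ‖F * V * F‖ := by
  have e : CFC.sqrt R' * V * CFC.sqrt R =
      (CFC.sqrt R' * E) * (F * V * F) * (E * CFC.sqrt R) := by
    calc CFC.sqrt R' * V * CFC.sqrt R = CFC.sqrt R' * (E * F) * V * (F * E) * CFC.sqrt R := by
          rw [hEF, hFE, mul_one, mul_one]
      _ = _ := by simp only [mul_assoc]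
  have h1 : ‖CFC.sqrt R' * E‖ ≤ 1 := by
    rw [← norm_star, star_mul, hE.star_eq, (CFC.sqrt_nonneg R').isSelfAdjoint.star_eq]
    exact norm_mul_sqrt_le_one hR' hE h'
  have h2 := norm_mul_sqrt_le_one hR hE h
  rw [e]
  calc _ ≤ ‖CFC.sqrt R' * E‖ * ‖F * V * F‖ * ‖E * CFC.sqrt R‖ := norm_mul₃_le
    _ ≤ 1 * ‖F * V * F‖ * 1 := by gcongr
    _ = _ := by ring

end Positivity

/-! ### Reduced inverses of semibounded operators -/

section ReducedInverse

variable {ι : Type}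

theorem inner_graph_diagPMap_add {f : ι → ℝ} (hf : ∀ k, 0 ≤ f k) {B : L2 ι →L[ℂ] L2 ι}
    {x z : L2 ι} (h : (x, z) ∈ (diagPMap f + ofCLM B).graph) :
    ∃ r : ℝ, 0 ≤ r ∧ inner ℂ x z = (r : ℂ) + inner ℂ x (B x) := by
  rw [mem_graph_diagPMap_add] at h
  refine ⟨∑' k, f k * ‖x k‖ ^ 2, tsum_nonneg fun k => mul_nonneg (hf k) (sq_nonneg _), ?_⟩
  have e : inner ℂ x (z - B x) = ((∑' k, f k * ‖x k‖ ^ 2 : ℝ) : ℂ) := by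
    rw [lp.inner_eq_tsum, Complex.ofReal_tsum]
    congr 1
    funext k
    show inner ℂ (x k) (z k - B x k) = _
    rw [h k, add_sub_cancel_right, RCLike.inner_apply, mul_assoc, Complex.mul_conj']
    push_cast
    ring
  rw [← e, inner_sub_right]
  ring

theorem isPositive_of_inner {T : L2 ι →L[ℂ] L2 ι}
    (h : ∀ x, ∃ r : ℝ, 0 ≤ r ∧ inner ℂ (T x) x = (r : ℂ)) : 0 ≤ T := by
  rw [ContinuousLinearMap.nonneg_iff_isPositive, ContinuousLinearMap.isPositive_iff_complex]
  intro x
  obtain ⟨r, hr, h⟩ := h x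
  rw [h]
  simpa using hr

theorem inner_self_ofReal {B : L2 ι →L[ℂ] L2 ι} (hB : IsSelfAdjoint B) (x : L2 ι) :
    inner ℂ x (B x) = (((inner ℂ x (B x) : ℂ).re : ℝ) : ℂ) := by
  have h := ContinuousLinearMap.isSelfAdjoint_iff_isSymmetric.1 hB x x
  have h' : (starRingEnd ℂ) (inner ℂ x (B x)) = inner ℂ x (B x) := by
    rw [inner_conj_symm]
    exact h
  exact (Complex.conj_eq_iff_re.1 h').symm

/-- For `x = R ψ`, the equation for the reduced inverse gives `⟨R ψ, ψ⟩ = ⟨x, (f + B) x⟩`, which is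
at least `⟨x, D x⟩ = ⟨ψ, R D R ψ⟩ ≥ 0`. No commutation between `D` and `R` is required. -/
theorem IsReducedInverse.nonneg_and_mul_le {f : ι → ℝ} (hf : ∀ k, 0 ≤ f k)
    {B D P R : L2 ι →L[ℂ] L2 ι} (hB : IsSelfAdjoint B) (hD : 0 ≤ D) (hP : IsSelfAdjoint P)
    (hBD : ∀ ψ, P ψ = ψ → (inner ℂ ψ (D ψ) : ℂ).re ≤ (inner ℂ ψ (B ψ) : ℂ).re)
    (hR : IsReducedInverse P (diagPMap f + ofCLM B) R) : 0 ≤ R ∧ R * D * R ≤ R := by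
  have key : ∀ ψ, ∃ r : ℝ, 0 ≤ r ∧
      inner ℂ (R ψ) ψ = (r : ℂ) + inner ℂ (R ψ) (D (R ψ)) := by
    intro ψ
    obtain ⟨z, hz, hPz⟩ := hR.exists_graph ψ
    obtain ⟨r, hr, h⟩ := inner_graph_diagPMap_add hf hz
    have hPR : P (R ψ) = R ψ := congrArg (fun A : L2 ι →L[ℂ] L2 ι => A ψ) hR.left
    have hPs := ContinuousLinearMap.isSelfAdjoint_iff_isSymmetric.1 hP
    have e : inner ℂ (R ψ) ψ = inner ℂ (R ψ) z := by
      rw [← hPR]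
      refine (hPs _ _).trans ?_
      refine Eq.trans ?_ (hPs _ _).symm
      show inner ℂ _ (P ψ) = inner ℂ _ (P z)
      rw [hPz]
    refine ⟨r + ((inner ℂ (R ψ) (B (R ψ)) : ℂ).re - (inner ℂ (R ψ) (D (R ψ)) : ℂ).re),
      add_nonneg hr (sub_nonneg.2 (hBD _ hPR)), ?_⟩
    rw [e, h, inner_self_ofReal hB, inner_self_ofReal hD.isSelfAdjoint]
    push_cast
    simp only [Complex.ofReal_re]
    ring
  have hDpos : ∀ ψ, ∃ r : ℝ, 0 ≤ r ∧ inner ℂ ψ (D ψ) = (r : ℂ) := by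
    intro ψ
    refine ⟨_, ?_, inner_self_ofReal hD.isSelfAdjoint ψ⟩
    exact ((ContinuousLinearMap.nonneg_iff_isPositive D).1 hD).re_inner_nonneg_right ψ
  have hR0 : 0 ≤ R := by
    refine isPositive_of_inner fun ψ => ?_
    obtain ⟨r, hr, h⟩ := key ψ
    obtain ⟨r', hr', h'⟩ := hDpos (R ψ)
    exact ⟨r + r', add_nonneg hr hr', by rw [h, h']; push_cast; rfl⟩
  refine ⟨hR0, sub_nonneg.1 (isPositive_of_inner fun ψ => ?_)⟩
  obtain ⟨r, hr, h⟩ := key ψ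
  refine ⟨r, hr, ?_⟩
  have hRs := ContinuousLinearMap.isSelfAdjoint_iff_isSymmetric.1 hR0.isSelfAdjoint
  have hDs := ContinuousLinearMap.isSelfAdjoint_iff_isSymmetric.1 hD.isSelfAdjoint
  show inner ℂ (R ψ - R (D (R ψ))) ψ = _
  rw [inner_sub_left, h]
  have e1 : inner ℂ (R (D (R ψ))) ψ = inner ℂ (R ψ) (D (R ψ)) := (hRs _ _).trans (hDs _ _)
  rw [e1]
  ring

/-- On the range of `P` the compressed operator is `f + c + C` with `C = P (B - c) P ≥ 0`. With `S =
(f + c)^{-1/2}`, which is bounded, the inverse is `S (1 + S C S)⁻¹ S`: the middle factor exists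
because `1 + S C S ≥ 1`, and everything commutes with `P`. -/
theorem reducedInvertible_of_bounded_below {f : ι → ℝ} (hf : ∀ k, 0 ≤ f k)
    {B : L2 ι →L[ℂ] L2 ι} (hB : IsSelfAdjoint B) (p : ι → Prop) {c : ℝ} (hc : 0 < c)
    (h : ∀ ψ, coordProj p ψ = ψ → c * ‖ψ‖ ^ 2 ≤ (inner ℂ ψ (B ψ) : ℂ).re) :
    ReducedInvertible (coordProj p) (diagPMap f + ofCLM B) := by
  set P : L2 ι →L[ℂ] L2 ι := coordProj p with hPdef
  have hPP : P * P = P := by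
    rw [hPdef, coordProj_mul]
    simp
  have hPs : IsSelfAdjoint P := isSelfAdjoint_coordProj p
  have hPP' : ∀ ψ, P (P ψ) = P ψ := fun ψ => congrArg (fun A : L2 ι →L[ℂ] L2 ι => A ψ) hPP
  have hPsym := ContinuousLinearMap.isSelfAdjoint_iff_isSymmetric.1 hPs
  set C : L2 ι →L[ℂ] L2 ι := P * (B - (c : ℂ) • 1) * P with hCdef
  have hCapp : ∀ ψ, C ψ = P (B (P ψ)) - (c : ℂ) • P ψ := by
    intro ψ
    show P (B (P ψ) - (c : ℂ) • P ψ) = _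
    rw [map_sub, map_smul, hPP']
  have hC : 0 ≤ C := by
    refine isPositive_of_inner fun ψ => ?_
    refine ⟨(inner ℂ (P ψ) (B (P ψ)) : ℂ).re - c * ‖P ψ‖ ^ 2, sub_nonneg.2 (h _ (hPP' ψ)), ?_⟩
    have hBsym := ContinuousLinearMap.isSelfAdjoint_iff_isSymmetric.1 hB
    rw [hCapp, inner_sub_left]
    have e1 : inner ℂ (P (B (P ψ))) ψ = inner ℂ (P ψ) (B (P ψ)) :=
      (hPsym _ _).trans (hBsym _ _)
    have e2 : inner ℂ (P ψ) ψ = ((‖P ψ‖ : ℂ)) ^ 2 := by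
      refine Eq.trans ?_ (inner_self_eq_norm_sq_to_K (𝕜 := ℂ) (P ψ))
      have h1 : inner ℂ (P (P ψ)) ψ = inner ℂ (P ψ) (P ψ) := hPsym _ _
      rwa [hPP'] at h1
    rw [e1, inner_smul_left, e2, inner_self_ofReal hB]
    simp
  have hs : ∀ k, |(Real.sqrt (f k + c))⁻¹| ≤ (Real.sqrt c)⁻¹ := by
    intro k
    rw [abs_of_nonneg (by positivity)]
    have : 0 < Real.sqrt c := Real.sqrt_pos.2 hc
    gcongr
    linarith [hf k]
  set S : L2 ι →L[ℂ] L2 ι := weightedComp (fun k => (Real.sqrt (f k + c))⁻¹) id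
    Function.injective_id (Real.sqrt c)⁻¹ (by positivity) hs with hSdef
  have hSs : IsSelfAdjoint S := isSelfAdjoint_weightedComp_id _ _
  have hSapp : ∀ ψ k, S ψ k = (((Real.sqrt (f k + c))⁻¹ : ℝ) : ℂ) * ψ k := fun _ _ => rfl
  have hSS : ∀ ψ k, ((f k : ℂ) + c) * S (S ψ) k = ψ k := by
    intro ψ k
    have h0 : 0 < f k + c := by linarith [hf k]
    rw [hSapp, hSapp, ← mul_assoc, ← mul_assoc, ← Complex.ofReal_add, ← Complex.ofReal_mul,
      ← Complex.ofReal_mul]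
    have : (f k + c) * (Real.sqrt (f k + c))⁻¹ * (Real.sqrt (f k + c))⁻¹ = 1 := by
      rw [mul_assoc, ← mul_inv, Real.mul_self_sqrt h0.le, mul_inv_cancel₀ h0.ne']
    rw [this]
    simp
  have hPS : P * S = S * P := by
    ext ψ k
    show P (S ψ) k = S (P ψ) k
    rw [hSapp, coordProj_apply, coordProj_apply, hSapp]
    split_ifs <;> simp
  have hPC : P * C = C := by rw [hCdef, ← mul_assoc, ← mul_assoc, hPP]
  have hCP : C * P = C := by rw [hCdef, mul_assoc, hPP]
  set G : L2 ι →L[ℂ] L2 ι := 1 + S * C * S with hGdef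
  have hG : IsUnit G := by
    have h1 : (1 : L2 ι →L[ℂ] L2 ι) ≤ G := le_add_of_nonneg_right (hSs.conjugate_nonneg hC)
    exact CStarAlgebra.isUnit_of_le 1 h1
  obtain ⟨u, hu⟩ := hG
  set E : L2 ι →L[ℂ] L2 ι := ↑u⁻¹ with hEdef
  have hGE : G * E = 1 := by rw [← hu]; exact u.mul_inv
  have hEG : E * G = 1 := by rw [← hu]; exact u.inv_mul
  have hPG : P * G = G * P := by
    rw [hGdef, mul_add, add_mul, mul_one, one_mul]
    congr 1
    calc P * (S * C * S) = P * S * C * S := by simp only [mul_assoc]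
      _ = S * (P * C) * S := by rw [hPS]; simp only [mul_assoc]
      _ = S * (C * P) * S := by rw [hPC, hCP]
      _ = S * C * (P * S) := by simp only [mul_assoc]
      _ = _ := by rw [hPS]; simp only [mul_assoc]
  have hPE : P * E = E * P := by
    calc P * E = E * G * (P * E) := by rw [hEG, one_mul]
      _ = E * (G * P) * E := by simp only [mul_assoc]
      _ = E * (P * G) * E := by rw [hPG]
      _ = E * P * (G * E) := by simp only [mul_assoc]
      _ = _ := by rw [hGE, mul_one]
  set T : L2 ι →L[ℂ] L2 ι := S * E * S with hTdef
  have hPT : P * T = T * P := by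
    calc P * (S * E * S) = P * S * E * S := by simp only [mul_assoc]
      _ = S * (P * E) * S := by rw [hPS]; simp only [mul_assoc]
      _ = S * E * (P * S) := by rw [hPE]; simp only [mul_assoc]
      _ = S * E * S * P := by rw [hPS]; simp only [mul_assoc]
  -- Since `S²` inverts `f + c`, this says `(f + c) T = 1 - C T`; in particular `T` maps into the
  -- domain of multiplication by `f`.
  have hT : T = S * S * (1 - C * T) := by
    have e1 : E = 1 - S * C * S * E := by
      rw [← hGE, hGdef]
      noncomm_ring
    calc T = S * E * S := rfl
      _ = S * (1 - S * C * S * E) * S := by rw [← e1]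
      _ = S * S * (1 - C * (S * E * S)) := by noncomm_ring
  have hPTP : ∀ ψ, P (T (P ψ)) = T (P ψ) := by
    intro ψ
    have : P (T (P ψ)) = T (P (P ψ)) := congrArg (fun A : L2 ι →L[ℂ] L2 ι => A (P ψ)) hPT
    rw [this, hPP']
  refine ⟨T * P, IsReducedInverse.of_graph ?_ ?_ ?_ ?_⟩
  · show P * (T * P) = T * P
    rw [← mul_assoc, hPT, mul_assoc, hPP]
  · show T * P * P = T * P
    rw [mul_assoc, hPP]
  · intro ψ
    refine ⟨P ψ - C (T (P ψ)) - (c : ℂ) • T (P ψ) + B (T (P ψ)), ?_, ?_⟩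
    · rw [mem_graph_diagPMap_add]
      intro k
      have h1 : T (P ψ) = S (S (P ψ - C (T (P ψ)))) :=
        congrArg (fun A : L2 ι →L[ℂ] L2 ι => A (P ψ)) hT
      have h2 := hSS (P ψ - C (T (P ψ))) k
      rw [← h1] at h2
      show (P ψ - C (T (P ψ))) k - (c : ℂ) * T (P ψ) k + B (T (P ψ)) k =
        (f k : ℂ) * T (P ψ) k + B (T (P ψ)) k
      rw [← h2]
      ring
    · have h3 : P (C (T (P ψ))) = C (T (P ψ)) :=
        congrArg (fun A : L2 ι →L[ℂ] L2 ι => A (T (P ψ))) hPC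
      rw [map_add, map_sub, map_sub, h3, hPP', map_smul, hPTP, hCapp, hPTP]
      abel
  · intro x z hz hx
    rw [mem_graph_diagPMap_add] at hz
    show T (P (P z)) = x
    rw [hPP']
    have e1 : x = S (S (z - B x + (c : ℂ) • x)) := by
      ext k
      have h1 := hSS (z - B x + (c : ℂ) • x) k
      have h2 : (z - B x + (c : ℂ) • x) k = ((f k : ℂ) + c) * x k := by
        show z k - B x k + (c : ℂ) * x k = _
        rw [hz k]
        ring
      rw [h2] at h1
      have h0 : ((f k : ℂ) + c) ≠ 0 := by
        rw [← Complex.ofReal_add]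
        exact_mod_cast (by linarith [hf k] : 0 < f k + c).ne'
      exact (mul_left_cancel₀ h0 h1).symm
    have e2 : P (z - B x) = z - B x := by
      ext k
      have h2 : (z - B x) k = (f k : ℂ) * x k := by
        show z k - B x k = _
        rw [hz k]
        ring
      rw [coordProj_apply, h2]
      by_cases hp : p k
      · rw [if_pos hp]
      · rw [if_neg hp, ← hx, coordProj_apply_of_neg hp, mul_zero]
    set g := z - B x + (c : ℂ) • x with hg
    have e3 : P z = g + C (S (S g)) := by
      rw [← e1, hCapp, hx]
      have : z = (z - B x) + B x := by abel
      rw [this, map_add, e2, hg]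
      abel
    have e4 : T * (1 + C * (S * S)) = S * S := by
      calc S * E * S * (1 + C * (S * S)) = S * (E * (1 + S * C * S)) * S := by noncomm_ring
        _ = _ := by rw [← hGdef, hEG, mul_one]
    rw [e3]
    have e5 : T (g + C (S (S g))) = S (S g) := congrArg (fun A : L2 ι →L[ℂ] L2 ι => A g) e4
    rw [e5, ← e1]

end ReducedInverse

/-! ### Diagonal operators and weighted shifts -/

section DiagonalOperators

variable {ι : Type}

/-- `T` is multiplication by the real function `c`. -/
def IsDiagonal (T : L2 ι →L[ℂ] L2 ι) (c : ι → ℝ) : Prop := ∀ ψ k, T ψ k = (c k : ℂ) * ψ k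

theorem IsDiagonal.isSelfAdjoint {T : L2 ι →L[ℂ] L2 ι} {c : ι → ℝ} (h : IsDiagonal T c) :
    IsSelfAdjoint T := by
  rw [ContinuousLinearMap.isSelfAdjoint_iff_isSymmetric]
  intro ψ χ
  show inner ℂ (T ψ) χ = inner ℂ ψ (T χ)
  rw [lp.inner_eq_tsum, lp.inner_eq_tsum]
  congr 1
  funext k
  rw [h, h]
  simp only [RCLike.inner_apply, map_mul, Complex.conj_ofReal]
  ring

theorem IsDiagonal.mul_coordProj {T : L2 ι →L[ℂ] L2 ι} {c : ι → ℝ} (h : IsDiagonal T c)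
    (p : ι → Prop) : T * coordProj p = coordProj p * T := by
  ext ψ k
  show T (coordProj p ψ) k = coordProj p (T ψ) k
  rw [h, coordProj_apply, coordProj_apply, h]
  split_ifs <;> simp

theorem IsDiagonal.ext {T T' : L2 ι →L[ℂ] L2 ι} {c c' : ι → ℝ} (h : IsDiagonal T c)
    (h' : IsDiagonal T' c') (hc : ∀ k, c k = c' k) : T = T' := by
  ext ψ k
  rw [h, h', hc]

theorem IsDiagonal.mul {T T' : L2 ι →L[ℂ] L2 ι} {c c' : ι → ℝ} (h : IsDiagonal T c)
    (h' : IsDiagonal T' c') : IsDiagonal (T * T') fun k => c k * c' k := by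
  intro ψ k
  show T (T' ψ) k = _
  rw [h, h']
  push_cast
  ring

theorem isDiagonal_one : IsDiagonal (1 : L2 ι →L[ℂ] L2 ι) fun _ => 1 := by
  intro ψ k
  simp

theorem exists_isDiagonal {c : ι → ℝ} {C : ℝ} (hc : ∀ k, |c k| ≤ C) :
    ∃ T : L2 ι →L[ℂ] L2 ι, IsDiagonal T c :=
  ⟨weightedComp c id Function.injective_id |C| (abs_nonneg C)
    fun k => (hc k).trans (le_abs_self C), fun _ _ => rfl⟩

theorem norm_sq_eq_tsum (ψ : L2 ι) : ‖ψ‖ ^ 2 = ∑' k, ‖ψ k‖ ^ 2 := by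
  have h := lp.norm_rpow_eq_tsum (p := 2) (by norm_num) ψ
  simpa using h

theorem summable_norm_sq (ψ : L2 ι) : Summable fun k => ‖ψ k‖ ^ 2 := by
  have h := (lp.memℓp ψ).summable (by norm_num)
  simpa using h

/-- An operator whose matrix has at most one nonzero entry in each row and column, along the
injections `α` and `β`, is bounded by the largest entry. -/
theorem opNorm_le_of_weighted_shift {κ : Type} {T : L2 ι →L[ℂ] L2 ι} {α β : κ → ι}
    (hα : Function.Injective α) (hβ : Function.Injective β) {C : ℝ} (hC : 0 ≤ C)
    (h0 : ∀ ψ k, k ∉ Set.range α → T ψ k = 0)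
    (h : ∀ ψ m, ‖T ψ (α m)‖ ≤ C * ‖ψ (β m)‖) : ‖T‖ ≤ C := by
  refine ContinuousLinearMap.opNorm_le_bound _ hC fun ψ => ?_
  refine le_of_sq_le_sq ?_ (by positivity)
  have hs := (summable_norm_sq ψ).comp_injective hβ
  rw [norm_sq_eq_tsum, ← hα.tsum_eq (f := fun k => ‖T ψ k‖ ^ 2), mul_pow, norm_sq_eq_tsum]
  · calc ∑' m, ‖T ψ (α m)‖ ^ 2 ≤ ∑' m, C ^ 2 * ‖ψ (β m)‖ ^ 2 := by
          refine Summable.tsum_le_tsum (fun m => ?_)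
            ((summable_norm_sq (T ψ)).comp_injective hα) (hs.mul_left _)
          rw [← mul_pow]
          exact pow_le_pow_left₀ (norm_nonneg _) (h ψ m) 2
      _ = C ^ 2 * ∑' m, ‖ψ (β m)‖ ^ 2 := tsum_mul_left
      _ ≤ _ := by
          gcongr
          exact tsum_comp_le_tsum_of_inj (summable_norm_sq ψ) (fun _ => by positivity) hβ
  · intro k hk
    by_contra hk'
    exact hk (by simp [h0 ψ k hk'])

end DiagonalOperators

/-! ### Creation and annihilation operators on occupation number states -/

section Fock

variable {d N : ℕ}

theorem Occ.addOne_apply_self (j : Mode d) (n : Occ d N) : (n.addOne j).1 j = n.1 j + 1 := by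
  simp [Occ.addOne]

theorem Occ.addOne_apply_of_ne {i j : Mode d} (h : i ≠ j) (n : Occ d N) :
    (n.addOne i).1 j = n.1 j := by
  simp [Occ.addOne, h]

theorem Occ.addOne_comm (i j : Mode d) (n : Occ d N) :
    (n.addOne i).addOne j = (n.addOne j).addOne i :=
  Subtype.ext (add_right_comm _ _ _)

theorem Occ.exists_addOne {j : Mode d} {n : Occ d (N + 1)} (h : n.1 j ≠ 0) :
    ∃ n' : Occ d N, n'.addOne j = n := by
  have hle : Finsupp.single j 1 ≤ n.1 := Finsupp.single_le_iff.2 (Nat.one_le_iff_ne_zero.2 h)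
  have he : n.1 - Finsupp.single j 1 + Finsupp.single j 1 = n.1 := tsub_add_cancel_of_le hle
  refine ⟨⟨n.1 - Finsupp.single j 1, ?_⟩, Subtype.ext he⟩
  have := congrArg Finsupp.degree he
  rw [map_add, Finsupp.degree_single, n.2] at this
  exact Nat.add_right_cancel this

theorem Occ.zero_add_pair_le {j : Mode d} (hj : j ≠ 0) (n : Occ d N) : n.1 0 + n.pair j ≤ N := by
  have hj' : j ≠ -j := fun h => hj (self_eq_neg.1 h)
  have h : ∑ i ∈ ({0, j, -j} : Finset (Mode d)), n.1 i ≤ ∑ i ∈ n.1.support, n.1 i :=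
    Finset.sum_le_sum_of_ne_zero fun i _ hi => Finsupp.mem_support_iff.2 hi
  have h2 : ∑ i ∈ n.1.support, n.1 i = N := n.2
  rw [h2, Finset.sum_insert, Finset.sum_pair hj'] at h
  · exact h
  · simp only [Finset.mem_insert, Finset.mem_singleton, not_or]
    exact ⟨hj.symm, fun h => hj (neg_eq_zero.1 h.symm)⟩

theorem annihilation_apply (j : Mode d) (ψ : FockN d (N + 1)) (n : Occ d N) :
    annihilation N j ψ n = (Real.sqrt (n.1 j + 1) : ℂ) * ψ (n.addOne j) := rfl

open Classical in
theorem creation_apply (j : Mode d) (ψ : FockN d N) (n : Occ d (N + 1)) :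
    creation N j ψ n = inner ℂ (annihilation N j (lp.single 2 n 1)) ψ := by
  rw [← ContinuousLinearMap.adjoint_inner_right, lp.inner_single_left]
  simp [creation]

/-- The coordinates of an adjoint are read off by pairing with basis vectors, which annihilation
maps to multiples of basis vectors. -/
theorem creation_apply_addOne (j : Mode d) (ψ : FockN d N) (n : Occ d N) :
    creation N j ψ (n.addOne j) = (Real.sqrt (n.1 j + 1) : ℂ) * ψ n := by
  classical
  have h : annihilation N j (lp.single 2 (n.addOne j) 1) =
      lp.single 2 n (Real.sqrt (n.1 j + 1) : ℂ) := by
    ext k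
    rw [annihilation_apply]
    by_cases h : k = n
    · subst h
      simp
    · have : k.addOne j ≠ n.addOne j := fun h' => h (Occ.addOne_injective j h')
      simp [Pi.single_eq_of_ne h, Pi.single_eq_of_ne this]
  rw [creation_apply, h, lp.inner_single_left]
  simp [mul_comm]

theorem creation_apply_of_eq_zero {j : Mode d} (ψ : FockN d N) {n : Occ d (N + 1)}
    (hn : n.1 j = 0) : creation N j ψ n = 0 := by
  classical
  have h : annihilation N j (lp.single 2 n 1) = 0 := by
    ext k
    have : k.addOne j ≠ n := by
      rintro rfl
      rw [Occ.addOne_apply_self] at hn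
      exact absurd hn (Nat.succ_ne_zero _)
    rw [annihilation_apply]
    simp [Pi.single_eq_of_ne this]
  rw [creation_apply, h, inner_zero_left]

theorem annihilation_comm (i j : Mode d) :
    annihilation N i ∘L annihilation (N + 1) j = annihilation N j ∘L annihilation (N + 1) i := by
  by_cases h : i = j
  · rw [h]
  ext ψ n
  show annihilation N i (annihilation (N + 1) j ψ) n = annihilation N j (annihilation (N + 1) i ψ) n
  simp only [annihilation_apply]
  rw [Occ.addOne_apply_of_ne h, Occ.addOne_apply_of_ne (Ne.symm h), Occ.addOne_comm]
  ring

theorem creation_comm (i j : Mode d) :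
    creation (N + 1) i ∘L creation N j = creation (N + 1) j ∘L creation N i := by
  have := congrArg ContinuousLinearMap.adjoint (annihilation_comm (N := N) i j)
  rw [ContinuousLinearMap.adjoint_comp, ContinuousLinearMap.adjoint_comp] at this
  exact this.symm

/-! ### Matrix elements of the pair hopping operators -/

variable {L : ℝ}

theorem adjoint_W (φ : PairPotential d L) (N : ℕ) (j : Mode d) :
    ContinuousLinearMap.adjoint (W φ N j) = Wstar φ N j := by
  rw [W, Wstar, map_smulₛₗ, Complex.conj_ofReal]
  congr 1
  rw [ContinuousLinearMap.adjoint_comp, ContinuousLinearMap.adjoint_comp,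
    ContinuousLinearMap.adjoint_comp]
  show ((_ ∘L _) ∘L _) ∘L _ = _
  simp only [creation, ContinuousLinearMap.adjoint_adjoint]
  have := creation_comm (N := N) j (-j)
  simp only [creation] at this
  rw [this]
  rfl

/-- `a*_0 a*_0` cannot produce a state with fewer than two particles in the zero mode. With
`W_apply` this shows that `W` is a weighted shift, indexed by the states of the particles that do
not take part. -/
theorem W_apply_eq_zero (φ : PairPotential d L) {j : Mode d} (hj : j ≠ 0)
    (ψ : FockN d (N + 2)) {n : Occ d (N + 2)}
    (hn : n ∉ Set.range fun m : Occ d N => (m.addOne 0).addOne 0) : W φ (N + 2) j ψ n = 0 := by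
  have key : creation (N + 3) 0 (creation (N + 2) 0 ψ) ((n.addOne j).addOne (-j)) = 0 := by
    by_cases h0 : n.1 0 = 0
    · apply creation_apply_of_eq_zero
      rw [Occ.addOne_apply_of_ne (neg_ne_zero.2 hj), Occ.addOne_apply_of_ne hj, h0]
    · obtain ⟨n', rfl⟩ := Occ.exists_addOne h0
      have h1 : n'.1 0 = 0 := by
        by_contra h1
        obtain ⟨m, rfl⟩ := Occ.exists_addOne h1
        exact hn ⟨m, rfl⟩
      rw [Occ.addOne_comm 0 j, Occ.addOne_comm 0 (-j), creation_apply_addOne,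
        creation_apply_of_eq_zero, mul_zero]
      rw [Occ.addOne_apply_of_ne (neg_ne_zero.2 hj), Occ.addOne_apply_of_ne hj, h1]
  show ((φ.coeff j / (N + 2 : ℕ) : ℝ) : ℂ) * (annihilation (N + 2) j (annihilation (N + 3) (-j)
    (creation (N + 3) 0 (creation (N + 2) 0 ψ))) n) = 0
  rw [annihilation_apply, annihilation_apply, key]
  simp

theorem W_apply (φ : PairPotential d L) {j : Mode d} (hj : j ≠ 0)
    (ψ : FockN d (N + 2)) (m : Occ d N) :
    W φ (N + 2) j ψ ((m.addOne 0).addOne 0) =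
      ((φ.coeff j / (N + 2 : ℕ) * (Real.sqrt (m.1 j + 1) * Real.sqrt (m.1 (-j) + 1) *
        (Real.sqrt (m.1 0 + 1 + 1) * Real.sqrt (m.1 0 + 1))) : ℝ) : ℂ) *
          ψ ((m.addOne j).addOne (-j)) := by
  have hj' : j ≠ -j := fun h => hj (self_eq_neg.1 h)
  have e : ((((m.addOne 0).addOne 0).addOne j).addOne (-j)) =
      (((m.addOne j).addOne (-j)).addOne 0).addOne 0 := by
    rw [Occ.addOne_comm 0 j, Occ.addOne_comm 0 j, Occ.addOne_comm 0 (-j), Occ.addOne_comm 0 (-j)]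
  show ((φ.coeff j / (N + 2 : ℕ) : ℝ) : ℂ) * (annihilation (N + 2) j (annihilation (N + 3) (-j)
    (creation (N + 3) 0 (creation (N + 2) 0 ψ))) _) = _
  rw [annihilation_apply, annihilation_apply, e, creation_apply_addOne, creation_apply_addOne,
    Occ.addOne_apply_self, Occ.addOne_apply_of_ne (neg_ne_zero.2 hj), Occ.addOne_apply_of_ne hj,
    Occ.addOne_apply_of_ne hj', Occ.addOne_apply_of_ne (neg_ne_zero.2 hj).symm,
    Occ.addOne_apply_of_ne (neg_ne_zero.2 hj).symm, Occ.addOne_apply_of_ne hj.symm,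
    Occ.addOne_apply_of_ne hj.symm]
  push_cast
  ring

/-! ### Projections onto pair numbers -/

/-- The projection onto the states whose number of particles in the modes `±j` satisfies `π`. -/
def pairProj (N : ℕ) (j : Mode d) (π : ℕ → Prop) : FockN d N →L[ℂ] FockN d N :=
  coordProj fun n : Occ d N => π (n.pair j)

theorem isSelfAdjoint_pairProj (j : Mode d) (π : ℕ → Prop) :
    IsSelfAdjoint (pairProj N j π) := isSelfAdjoint_coordProj _

theorem pairProj_comp_annihilation {i j : Mode d} {c : ℕ}
    (hc : ∀ n : Occ d N, (n.addOne i).pair j = n.pair j + c) (π : ℕ → Prop) :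
    pairProj N j (fun k => π (k + c)) ∘L annihilation N i =
      annihilation N i ∘L pairProj (N + 1) j π := by
  classical
  ext ψ n
  show coordProj _ (annihilation N i ψ) n = annihilation N i (coordProj _ ψ) n
  rw [coordProj_apply, annihilation_apply, annihilation_apply, coordProj_apply, hc]
  split_ifs <;> simp

theorem creation_comp_pairProj {i j : Mode d} {c : ℕ}
    (hc : ∀ n : Occ d N, (n.addOne i).pair j = n.pair j + c) (π : ℕ → Prop) :
    creation N i ∘L pairProj N j (fun k => π (k + c)) =
      pairProj (N + 1) j π ∘L creation N i := by
  have := congrArg ContinuousLinearMap.adjoint (pairProj_comp_annihilation hc π)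
  rw [ContinuousLinearMap.adjoint_comp, ContinuousLinearMap.adjoint_comp] at this
  rwa [← ContinuousLinearMap.star_eq_adjoint, ← ContinuousLinearMap.star_eq_adjoint,
    (isSelfAdjoint_pairProj j _).star_eq, (isSelfAdjoint_pairProj j _).star_eq] at this

theorem Occ.pair_addOne_of_ne {i j : Mode d} (h : i ≠ j) (h' : i ≠ -j) (n : Occ d N) :
    (n.addOne i).pair j = n.pair j + 0 := by
  rw [Occ.pair, Occ.addOne_apply_of_ne h, Occ.addOne_apply_of_ne h']
  rfl

theorem Occ.pair_addOne_self {j : Mode d} (hj : j ≠ 0) (n : Occ d N) :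
    (n.addOne j).pair j = n.pair j + 1 := by
  have hj' : j ≠ -j := fun h => hj (self_eq_neg.1 h)
  rw [Occ.pair, Occ.addOne_apply_self, Occ.addOne_apply_of_ne hj', Occ.pair]
  ring

theorem Occ.pair_addOne_neg {j : Mode d} (hj : j ≠ 0) (n : Occ d N) :
    (n.addOne (-j)).pair j = n.pair j + 1 := by
  have hj' : -j ≠ j := fun h => hj (self_eq_neg.1 h.symm)
  rw [Occ.pair, Occ.addOne_apply_self, Occ.addOne_apply_of_ne hj', Occ.pair]
  ring

/-- The shifts `c` and `c'` serve two cases: they are `1` when `i` is the mode `j` itself, where `W`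
lowers the pair number by two, and `0` when `i` is neither `j` nor `-j`, where `W` commutes with the
projections. The zero mode never counts in the pair number. -/
theorem pairProj_mul_W_of_shift (φ : PairPotential d L) {i j : Mode d} (hj : j ≠ 0) {c c' : ℕ}
    (hc : ∀ (N : ℕ) (n : Occ d N), (n.addOne i).pair j = n.pair j + c)
    (hc' : ∀ (N : ℕ) (n : Occ d N), (n.addOne (-i)).pair j = n.pair j + c') (π : ℕ → Prop) :
    pairProj N j (fun k => π (k + c + c')) * W φ N i = W φ N i * pairProj N j π := by
  have h0 : ∀ (N : ℕ) (n : Occ d N), (n.addOne 0).pair j = n.pair j + 0 :=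
    fun N n => Occ.pair_addOne_of_ne hj.symm (neg_ne_zero.2 hj).symm n
  rw [W, mul_smul_comm, smul_mul_assoc]
  congr 1
  show pairProj N j (fun k => π (k + c + c')) ∘L annihilation N i ∘L annihilation (N + 1) (-i) ∘L
    creation (N + 1) 0 ∘L creation N 0 = (annihilation N i ∘L annihilation (N + 1) (-i) ∘L
    creation (N + 1) 0 ∘L creation N 0) ∘L pairProj N j π
  have e1 := pairProj_comp_annihilation (hc N) (fun k => π (k + c'))
  have e2 := pairProj_comp_annihilation (hc' (N + 1)) π
  have e3 := creation_comp_pairProj (h0 (N + 1)) π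
  have e4 := creation_comp_pairProj (h0 N) π
  simp only [add_zero] at e3 e4
  simp only [ContinuousLinearMap.comp_assoc]
  rw [e4, ← ContinuousLinearMap.comp_assoc, e1]
  simp only [← ContinuousLinearMap.comp_assoc]
  simp only [ContinuousLinearMap.comp_assoc]
  congr 1
  rw [← ContinuousLinearMap.comp_assoc, e2, ContinuousLinearMap.comp_assoc]
  congr 1
  rw [← ContinuousLinearMap.comp_assoc, ← e3, ContinuousLinearMap.comp_assoc]

theorem pairProj_mul_W (φ : PairPotential d L) {j : Mode d} (hj : j ≠ 0) (π : ℕ → Prop) :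
    pairProj N j (fun k => π (k + 2)) * W φ N j = W φ N j * pairProj N j π :=
  pairProj_mul_W_of_shift φ hj (c := 1) (c' := 1) (fun _ n => Occ.pair_addOne_self hj n)
    (fun _ n => Occ.pair_addOne_neg hj n) π

theorem star_W (φ : PairPotential d L) (N : ℕ) (j : Mode d) : star (W φ N j) = Wstar φ N j :=
  adjoint_W φ N j

theorem star_Wstar (φ : PairPotential d L) (N : ℕ) (j : Mode d) :
    star (Wstar φ N j) = W φ N j := by
  rw [← star_W, star_star]

theorem Wstar_mul_pairProj (φ : PairPotential d L) {j : Mode d} (hj : j ≠ 0) (π : ℕ → Prop) :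
    Wstar φ N j * pairProj N j (fun k => π (k + 2)) = pairProj N j π * Wstar φ N j := by
  have := congrArg star (pairProj_mul_W (N := N) φ hj π)
  rwa [star_mul, star_mul, star_W, (isSelfAdjoint_pairProj j _).star_eq,
    (isSelfAdjoint_pairProj j _).star_eq] at this

theorem pairProj_mul_W_of_ne (φ : PairPotential d L) {i j : Mode d} (hj : j ≠ 0) (h : i ≠ j)
    (h' : i ≠ -j) (π : ℕ → Prop) : pairProj N j π * W φ N i = W φ N i * pairProj N j π :=
  pairProj_mul_W_of_shift φ hj (c := 0) (c' := 0) (fun _ n => Occ.pair_addOne_of_ne h h' n)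
    (fun _ n => Occ.pair_addOne_of_ne (fun e => h' (by rw [← e, neg_neg]))
      (fun e => h (neg_injective e)) n) π

theorem Wstar_mul_pairProj_of_ne (φ : PairPotential d L) {i j : Mode d} (hj : j ≠ 0) (h : i ≠ j)
    (h' : i ≠ -j) (π : ℕ → Prop) :
    Wstar φ N i * pairProj N j π = pairProj N j π * Wstar φ N i := by
  have := congrArg star (pairProj_mul_W_of_ne (N := N) φ hj h h' π)
  rwa [star_mul, star_mul, star_W, (isSelfAdjoint_pairProj j _).star_eq] at this

theorem isDiagonal_Hhat0 (φ : PairPotential d L) (N : ℕ) (j : Mode d) :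
    IsDiagonal (Hhat0 φ N j) fun n =>
      (kSq L j + φ.coeff j / N * (n.1 0 : ℝ)) * (n.pair j : ℝ) := by
  intro ψ n
  show ((kSq L j : ℝ) : ℂ) * (((n.1 j : ℝ) : ℂ) * ψ n) +
      ((φ.coeff j / N : ℝ) : ℂ) * (((n.1 0 : ℝ) : ℂ) * (((n.1 j : ℝ) : ℂ) * ψ n)) +
    (((kSq L j : ℝ) : ℂ) * (((n.1 (-j) : ℝ) : ℂ) * ψ n) +
      ((φ.coeff j / N : ℝ) : ℂ) * (((n.1 0 : ℝ) : ℂ) * (((n.1 (-j) : ℝ) : ℂ) * ψ n))) = _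
  simp only [Occ.pair]
  push_cast
  ring

theorem isSelfAdjoint_HhatBog (φ : PairPotential d L) (N : ℕ) (j : Mode d) :
    IsSelfAdjoint (HhatBog φ N j) := by
  rw [IsSelfAdjoint, HhatBog, star_add, star_add, star_W, star_Wstar,
    (isDiagonal_Hhat0 φ N j).isSelfAdjoint.star_eq]
  abel

theorem isSelfAdjoint_sumHhatBog (φ : PairPotential d L) (N : ℕ) (J : ℕ → Mode d) (m : ℕ) :
    IsSelfAdjoint (sumHhatBog φ N J m) :=
  isSelfAdjoint_sum _ fun l _ => isSelfAdjoint_HhatBog φ N (J l)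

theorem HhatBog_mul_pairProj_of_ne (φ : PairPotential d L) {i j : Mode d} (hj : j ≠ 0)
    (h : i ≠ j) (h' : i ≠ -j) (π : ℕ → Prop) :
    HhatBog φ N i * pairProj N j π = pairProj N j π * HhatBog φ N i := by
  rw [HhatBog, add_mul, add_mul, mul_add, mul_add, Wstar_mul_pairProj_of_ne φ hj h h',
    pairProj_mul_W_of_ne φ hj h h']
  congr 2
  exact (isDiagonal_Hhat0 φ N i).mul_coordProj _

theorem sumHhatBog_mul_pairProj {φ : PairPotential d L} {m : ℕ} {J : ℕ → Mode d}
    (hJ : InteractingModes φ (m + 1) J) (π : ℕ → Prop) :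
    sumHhatBog φ N J m * pairProj N (J (m + 1)) π =
      pairProj N (J (m + 1)) π * sumHhatBog φ N J m := by
  rw [sumHhatBog, Finset.sum_mul, Finset.mul_sum]
  refine Finset.sum_congr rfl fun l hl => ?_
  have hl' := Finset.mem_Icc.1 hl
  have hm : m + 1 ∈ Finset.Icc 1 (m + 1) := Finset.mem_Icc.2 ⟨by omega, le_rfl⟩
  have h := hJ.distinct l (Finset.mem_Icc.2 ⟨hl'.1, by omega⟩) (m + 1) hm (by omega)
  exact HhatBog_mul_pairProj_of_ne φ (hJ.ne_zero _ hm) h.1 h.2 π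

/-- The weighted norm of the part of `W_j` that starts from pair numbers satisfying `π`. -/
theorem norm_weighted_W_le (φ : PairPotential d L) {j : Mode d} (hj : j ≠ 0)
    {D : Occ d (N + 2) → ℝ} (hD : ∀ n, 0 < D n) {F : FockN d (N + 2) →L[ℂ] FockN d (N + 2)}
    (hF : IsDiagonal F fun n => (Real.sqrt (D n))⁻¹) {G : ℝ} {π : ℕ → Prop}
    (h : ∀ m : Occ d N, π (m.pair j + 2) →
      (φ.coeff j / (N + 2 : ℕ)) ^ 2 * ((m.1 j + 1) * (m.1 (-j) + 1) *
        ((m.1 0 + 1 + 1) * (m.1 0 + 1))) ≤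
          G * (D ((m.addOne 0).addOne 0) * D ((m.addOne j).addOne (-j)))) :
    ‖F * (W φ (N + 2) j * pairProj (N + 2) j π) * F‖ ≤ Real.sqrt G := by
  classical
  refine opNorm_le_of_weighted_shift (α := fun m : Occ d N => (m.addOne 0).addOne 0)
    (β := fun m : Occ d N => (m.addOne j).addOne (-j))
    ((Occ.addOne_injective _).comp (Occ.addOne_injective _))
    ((Occ.addOne_injective _).comp (Occ.addOne_injective _)) (Real.sqrt_nonneg _) ?_ ?_
  · intro ψ k hk
    show F (W φ (N + 2) j _) k = 0
    rw [hF, W_apply_eq_zero φ hj _ hk, mul_zero]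
  · intro ψ m
    show ‖F (W φ (N + 2) j (coordProj _ (F ψ))) _‖ ≤ _
    rw [hF, W_apply φ hj, coordProj_apply, hF, Occ.pair_addOne_neg hj, Occ.pair_addOne_self hj]
    set D1 := D ((m.addOne 0).addOne 0)
    set D2 := D ((m.addOne j).addOne (-j))
    have hD1 : 0 < D1 := hD _
    have hD2 : 0 < D2 := hD _
    by_cases hp : π (m.pair j + 1 + 1)
    · rw [if_pos hp, ← mul_assoc, ← mul_assoc, ← Complex.ofReal_mul, ← Complex.ofReal_mul,
        norm_mul, Complex.norm_real, Real.norm_eq_abs]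
      refine mul_le_mul_of_nonneg_right ?_ (norm_nonneg _)
      refine Real.abs_le_sqrt ?_
      have h1 := h m hp
      simp only [mul_pow, inv_pow]
      rw [Real.sq_sqrt hD1.le, Real.sq_sqrt hD2.le, Real.sq_sqrt (by positivity),
        Real.sq_sqrt (by positivity), Real.sq_sqrt (by positivity), Real.sq_sqrt (by positivity)]
      rw [← div_eq_mul_inv, ← div_eq_inv_mul, div_div, div_le_iff₀ (by positivity)]
      exact h1
    · rw [if_neg hp]
      simp
      positivity

end Fock

/-! ### Elementary estimates for the comparison sequence -/

theorem deltaEps_indicator {ε : ℝ} (h : Real.sqrt ε < 1) :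
    (Set.Ico (0 : ℝ) 2).indicator (1 : ℝ → ℝ) (deltaEps ε) = 1 := by
  rw [Set.indicator_of_mem]
  · rfl
  · rw [deltaEps]
    exact ⟨by positivity, by linarith⟩

theorem bEps_eq {ε : ℝ} (h : Real.sqrt ε < 1) :
    bEps ε = (1 + ε) * (deltaEps ε * Real.sqrt (ε ^ 2 + 2 * ε)) := by
  rw [bEps, deltaEps_indicator h]
  ring

theorem one_sub_cEps_eq {ε : ℝ} (hε : 0 ≤ ε) (h : Real.sqrt ε < 1) :
    1 - cEps ε = (1 + ε) ^ 2 - (deltaEps ε * Real.sqrt (ε ^ 2 + 2 * ε)) ^ 2 := by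
  rw [cEps, deltaEps_indicator h, mul_pow, Real.sq_sqrt (by positivity)]
  ring

theorem cEps_nonneg {ε : ℝ} (hε : 0 ≤ ε) (h : Real.sqrt ε < 1) : 0 ≤ cEps ε := by
  rw [cEps, deltaEps_indicator h, deltaEps]
  have : 0 ≤ (2 * Real.sqrt ε + Real.sqrt ε ^ 2) * (ε ^ 2 + 2 * ε) := by positivity
  calc 0 ≤ _ := this
    _ = _ := by ring

theorem bEps_sq {ε e : ℝ} (he : 0 ≤ e) (h : e < 1) (hε : ε = e ^ 2) :
    bEps ε ^ 2 = e ^ 2 * ((1 + e ^ 2) ^ 2 * (1 + e) ^ 2 * (2 + e ^ 2)) := by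
  have hs : Real.sqrt ε = e := by rw [hε, Real.sqrt_sq he]
  rw [bEps_eq (by rwa [hs]), deltaEps, hs, mul_pow, mul_pow,
    Real.sq_sqrt (by rw [hε]; positivity), hε]
  ring

theorem bEps_nonneg {ε : ℝ} (hε : 0 ≤ ε) (h : Real.sqrt ε < 1) : 0 ≤ bEps ε := by
  rw [bEps_eq h, deltaEps]
  positivity

theorem bEps_le {ε e : ℝ} (he : 0 ≤ e) (h : e ≤ 1 / 100) (hε : ε = e ^ 2) : bEps ε ≤ 2 * e := by
  refine abs_le_of_sq_le_sq' ?_ (by positivity) |>.2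
  rw [bEps_sq he (by linarith) hε, mul_pow, mul_comm]
  refine mul_le_mul_of_nonneg_right ?_ (by positivity)
  have h0 : e ^ 2 ≤ 1 / 100 := by nlinarith
  have h1 : (1 + e ^ 2) ^ 2 ≤ 11 / 10 := by nlinarith [sq_nonneg e]
  have h2 : (1 + e) ^ 2 ≤ 11 / 10 := by nlinarith
  have h3 : 2 + e ^ 2 ≤ 21 / 10 := by nlinarith
  calc (1 + e ^ 2) ^ 2 * (1 + e) ^ 2 * (2 + e ^ 2) ≤ 11 / 10 * (11 / 10) * (21 / 10) := by gcongr
    _ ≤ 2 ^ 2 := by norm_num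

theorem le_bEps {ε e : ℝ} (he : 0 ≤ e) (h : e ≤ 1 / 100) (hε : ε = e ^ 2) :
    7 / 5 * e ≤ bEps ε := by
  have hs : Real.sqrt ε = e := by rw [hε, Real.sqrt_sq he]
  refine abs_le_of_sq_le_sq' ?_ (bEps_nonneg (by rw [hε]; positivity) (by linarith)) |>.2
  rw [bEps_sq he (by linarith) hε, mul_pow, mul_comm]
  refine mul_le_mul_of_nonneg_left ?_ (by positivity)
  have h1 : 1 ≤ (1 + e ^ 2) ^ 2 := by nlinarith
  have h2 : 1 ≤ (1 + e) ^ 2 := by nlinarith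
  have h3 : 2 ≤ 2 + e ^ 2 := by nlinarith
  calc (7 / 5 : ℝ) ^ 2 ≤ 1 * 1 * 2 := by norm_num
    _ ≤ _ := by gcongr

/-- `√(η a)` for `η = 1 - √ε` and `a = 2 ε`. -/
theorem sq_sqrt_eta_mul {ε e : ℝ} (he : 0 ≤ e) (h : e ≤ 1 / 100) (hε : ε = e ^ 2) :
    Real.sqrt ((1 - Real.sqrt ε) * (2 * ε)) ^ 2 = (1 - e) * (2 * e ^ 2) := by
  have hs : Real.sqrt ε = e := by rw [hε, Real.sqrt_sq he]
  rw [Real.sq_sqrt, hs, hε]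
  rw [hs, hε]
  exact mul_nonneg (by linarith) (by positivity)

/-- To leading order in `e = √ε`, both `b_ε` and `√(η a)` are `√2 e`. That the quotient `β` is
within `O(e)` of `1` matters because it enters the one step inequality as `2 β - β² = 1 - (β - 1)²`.
-/
theorem one_le_bEps_div {ε e : ℝ} (he : 0 < e) (h : e ≤ 1 / 100) (hε : ε = e ^ 2) :
    1 ≤ bEps ε / Real.sqrt ((1 - Real.sqrt ε) * (2 * ε)) ∧
      bEps ε / Real.sqrt ((1 - Real.sqrt ε) * (2 * ε)) ≤ 1 + 2 * e := by
  have hs : Real.sqrt ε = e := by rw [hε, Real.sqrt_sq he.le]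
  have hg := sq_sqrt_eta_mul he.le h hε
  set g := Real.sqrt ((1 - Real.sqrt ε) * (2 * ε)) with hgdef
  have hb := bEps_sq he.le (by linarith) hε
  have hb0 := bEps_nonneg (ε := ε) (by rw [hε]; positivity) (by linarith)
  have hg0 : 0 < g := by
    rw [hgdef, hs, hε]
    exact Real.sqrt_pos.2 (mul_pos (by linarith) (by positivity))
  have h3 : (1 + e ^ 2) ^ 2 * (2 + e ^ 2) ≤ 2 + 6 * e ^ 2 := by
    have : 0 ≤ e ^ 2 * (1 - 4 * e ^ 2 - e ^ 4) := by
      apply mul_nonneg (by positivity)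
      have : e ^ 4 = e ^ 2 * e ^ 2 := by ring
      nlinarith [sq_nonneg e]
    nlinarith
  constructor
  · rw [one_le_div hg0]
    refine abs_le_of_sq_le_sq' ?_ hb0 |>.2
    rw [hg, hb]
    have h1 : 1 ≤ (1 + e ^ 2) ^ 2 := by nlinarith
    have h2 : 1 ≤ (1 + e) ^ 2 := by nlinarith
    have h4 : 2 ≤ 2 + e ^ 2 := by nlinarith
    calc (1 - e) * (2 * e ^ 2) ≤ e ^ 2 * (1 * 1 * 2) := by nlinarith [sq_nonneg e]
      _ ≤ _ := by gcongr
  · rw [div_le_iff₀ hg0]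
    refine abs_le_of_sq_le_sq' ?_ (by positivity) |>.2
    rw [mul_pow, hg, hb]
    calc e ^ 2 * ((1 + e ^ 2) ^ 2 * (1 + e) ^ 2 * (2 + e ^ 2))
        = e ^ 2 * ((1 + e) ^ 2 * ((1 + e ^ 2) ^ 2 * (2 + e ^ 2))) := by ring
      _ ≤ e ^ 2 * ((1 + e) ^ 2 * (2 + 6 * e ^ 2)) := by gcongr
      _ ≤ e ^ 2 * ((1 + 2 * e) ^ 2 * ((1 - e) * 2)) := by
          refine mul_le_mul_of_nonneg_left ?_ (by positivity)
          have h5 : e ^ 2 ≤ 1 / 100 := by nlinarith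
          have h6 : e ^ 3 ≤ 1 / 100 := by
            rw [pow_succ]
            nlinarith
          have h7 : 0 ≤ e * (2 - 8 * e - 20 * e ^ 2 - 6 * e ^ 3) :=
            mul_nonneg he.le (by linarith)
          linarith
      _ = _ := by ring

/-- Here `t = ε^{1/4}`, so `b` is of order `t²`. The errors `σ` and `4 b²` in the coefficient of
`q²` are of order `t⁴`, and the gain `2 b θ` from the shift `θ ≥ t` in the denominators is at least
of order `t³`. -/
theorem step_remainder_nonneg {t θ q b σ : ℝ} (ht : 0 < t) (ht1 : t ≤ 1 / 10)
    (hθ : t ≤ θ) (hθ1 : θ ≤ 1 / 2) (hq : 3 ≤ q) (hb : 7 / 5 * t ^ 2 ≤ b) (hb1 : b ≤ 2 * t ^ 2)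
    (hσ0 : 0 ≤ σ) (hσ1 : σ ≤ 4 * t ^ 2 * t ^ 2) :
    0 ≤ q ^ 2 * (2 * b * θ - σ - 4 * b ^ 2) + (q * (2 * θ - 2 * b * θ ^ 2 - 2 * b) - θ ^ 2)
      + (σ + 2 * b * q * σ + 4 * b ^ 2 * q * θ + 2 * b * θ) := by
  have ht2 : t ^ 2 ≤ t / 10 := by nlinarith
  have ht2' : 0 < t ^ 2 := by positivity
  have hθ0 : 0 < θ := by linarith
  have hb0 : 0 < b := by linarith
  have h1 : 0 ≤ 2 * b * θ - σ - 4 * b ^ 2 := by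
    have e1 : b * b ≤ 2 * t ^ 2 * b := by gcongr
    have e2 : t ^ 2 * t ^ 2 ≤ t ^ 2 * (5 / 7 * b) := by
      gcongr
      linarith
    have e3 : t * b ≤ θ * b := by gcongr
    have e4 : t ^ 2 * b ≤ t / 10 * b := by gcongr
    have e5 : 0 < t * b := mul_pos ht hb0
    have e6 : 4 * b ^ 2 = 4 * (b * b) := by ring
    linarith
  have h2 : 0 ≤ q * (2 * θ - 2 * b * θ ^ 2 - 2 * b) - θ ^ 2 := by
    have e1 : b ≤ θ / 5 := by linarith
    have e0 : θ ^ 2 ≤ θ * (1 / 2) := by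
      rw [sq]
      gcongr
    have e2 : b * θ ^ 2 ≤ b * 1 := by
      gcongr
      linarith
    have e3 : 6 / 5 * θ ≤ 2 * θ - 2 * b * θ ^ 2 - 2 * b := by linarith
    have e4 : 3 * (6 / 5 * θ) ≤ q * (2 * θ - 2 * b * θ ^ 2 - 2 * b) := by gcongr
    linarith
  have h3 : 0 ≤ σ + 2 * b * q * σ + 4 * b ^ 2 * q * θ + 2 * b * θ := by positivity
  have h4 := mul_nonneg (sq_nonneg q) h1
  linarith

/-- The difference of the two sides is a sum of visibly nonnegative terms carrying a factor `a`,
plus the remainder of `step_remainder_nonneg`. -/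
theorem le_mul_of_remainder_nonneg {θ q a η b σ P : ℝ} (hPe : P = (q - θ) ^ 2 - 1)
    (hP0 : 0 ≤ P) (ha0 : 0 ≤ a) (hη0 : 0 ≤ η) (hb0 : 0 ≤ b) (hq0 : 0 ≤ q) (hθq : θ ≤ q)
    (hσ2 : σ ≤ 1) (hF : 0 ≤ a - η * a - η * a ^ 2)
    (hE : 0 ≤ q ^ 2 * (2 * b * θ - σ - 4 * b ^ 2) + (q * (2 * θ - 2 * b * θ ^ 2 - 2 * b) - θ ^ 2)
      + (σ + 2 * b * q * σ + 4 * b ^ 2 * q * θ + 2 * b * θ)) :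
    q ^ 2 * P ≤ ((1 + a) * q ^ 2 - 2 * b * q - 1) *
      (P * (1 - η * a) + (1 - σ) + 2 * b * (q - θ)) := by
  have hpos : 0 ≤ q ^ 2 * P * (a - η * a - η * a ^ 2) + a * q ^ 2 * (1 - σ) +
      a * q ^ 2 * (2 * b * (q - θ)) + 2 * b * q * (η * a * P) + η * a * P := by
    have : 0 ≤ q - θ := by linarith
    have : 0 ≤ 1 - σ := by linarith
    positivity
  have hid : ((1 + a) * q ^ 2 - 2 * b * q - 1) *
      (P * (1 - η * a) + (1 - σ) + 2 * b * (q - θ)) - q ^ 2 * P =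
      (q ^ 2 * P * (a - η * a - η * a ^ 2) + a * q ^ 2 * (1 - σ) +
        a * q ^ 2 * (2 * b * (q - θ)) + 2 * b * q * (η * a * P) + η * a * P) +
      (q ^ 2 * (2 * b * θ - σ - 4 * b ^ 2) + (q * (2 * θ - 2 * b * θ ^ 2 - 2 * b) - θ ^ 2)
        + (σ + 2 * b * q * σ + 4 * b ^ 2 * q * θ + 2 * b * θ)) := by
    rw [hPe]
    ring
  linarith

/-- The one step inequality behind the lower bound for the comparison sequence. -/
theorem one_le_mul_mul_of_small {t θ q a η b c β γ : ℝ} (ht : 0 < t) (ht1 : t ≤ 1 / 10)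
    (hθ : t ≤ θ) (hθ1 : θ ≤ 1 / 2) (hq : 3 ≤ q) (ha : a = 2 * t ^ 4) (hη : η = 1 - t ^ 2)
    (hb : 7 / 5 * t ^ 2 ≤ b) (hb1 : b ≤ 2 * t ^ 2) (hc : 0 ≤ c) (hβ : 1 ≤ β)
    (hβ1 : β ≤ 1 + 2 * t ^ 2) (hβγ : β * γ = b) (hγ : γ ^ 2 = η * a) :
    1 ≤ (1 + a - 2 * b / q - (1 - c) / q ^ 2) *
      ((1 + γ - β / (q + 1 - θ)) * (1 - γ + β / (q - 1 - θ))) := by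
  have ht2 : t ^ 2 ≤ t / 10 := by nlinarith
  have ht2' : 0 < t ^ 2 := by positivity
  have hθ0 : 0 < θ := by linarith
  have hb0 : 0 < b := by linarith
  have hu : 0 < q + 1 - θ := by linarith
  have hv : 0 < q - 1 - θ := by linarith
  have hq0 : 0 < q := by linarith
  set P := (q + 1 - θ) * (q - 1 - θ) with hP
  have hP0 : 0 < P := mul_pos hu hv
  set σ := (β - 1) ^ 2 with hσ
  have hσ0 : 0 ≤ σ := sq_nonneg _
  have hσ1 : σ ≤ 4 * t ^ 2 * t ^ 2 := by
    calc σ ≤ (2 * t ^ 2) ^ 2 := pow_le_pow_left₀ (by linarith) (by linarith) 2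
      _ = _ := by ring
  have ht3 : t ^ 2 ≤ 1 / 100 := by linarith
  have hσ2 : σ ≤ 1 := by
    have : 4 * t ^ 2 * t ^ 2 ≤ 4 * (1 / 100) * (1 / 100) := by gcongr
    linarith
  have ha0 : 0 ≤ a := by rw [ha]; positivity
  have hη0 : 0 ≤ η := by rw [hη]; nlinarith
  have hη1 : η ≤ 1 := by rw [hη]; nlinarith
  -- Over the common denominator `P` the terms in `β` alone combine to `2 β - β² = 1 - σ`, and those
  -- in `β γ = b` to `2 b (q - θ)`.
  have hV : (1 + γ - β / (q + 1 - θ)) * (1 - γ + β / (q - 1 - θ)) =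
      (P * (1 - η * a) + (1 - σ) + 2 * b * (q - θ)) / P := by
    rw [← hγ, ← hβγ, hσ, hP]
    field_simp
    ring
  have hU : 1 + a - 2 * b / q - (1 - c) / q ^ 2 = ((1 + a) * q ^ 2 - 2 * b * q - (1 - c)) / q ^ 2 := by
    field_simp
  rw [hU, hV, div_mul_div_comm, one_le_div (by positivity)]
  have hV0 : 0 ≤ P * (1 - η * a) + (1 - σ) + 2 * b * (q - θ) := by
    have h1 : 0 ≤ 1 - η * a := by
      have h4 : t ^ 4 = t ^ 2 * t ^ 2 := by ring
      have h5 : t ^ 2 * t ^ 2 ≤ 1 / 100 * (1 / 100) := by gcongr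
      have h6 : a ≤ 1 := by rw [ha]; linarith
      have h7 : η * a ≤ a := mul_le_of_le_one_left ha0 hη1
      linarith
    have h2 : 0 ≤ 2 * b * (q - θ) := mul_nonneg (by positivity) (by linarith)
    have h3 := mul_nonneg hP0.le h1
    linarith
  have hPe : P = (q - θ) ^ 2 - 1 := by rw [hP]; ring
  have hE := step_remainder_nonneg ht ht1 hθ hθ1 hq hb hb1 hσ0 hσ1
  -- This is what the factor `η = 1 - √ε` buys: `a - η a = a t²` dominates `η a²`, since `a` is of
  -- order `t⁴`.
  have hF : 0 ≤ a - η * a - η * a ^ 2 := by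
    have : a - η * a - η * a ^ 2 = a * (t ^ 2 - η * a) := by rw [hη]; ring
    rw [this]
    refine mul_nonneg ha0 ?_
    have h1 : t ^ 4 = t ^ 2 * t ^ 2 := by ring
    have h2 : η * a ≤ a := mul_le_of_le_one_left ha0 hη1
    have h4 : t ^ 2 * t ^ 2 ≤ 1 / 100 * t ^ 2 := by gcongr
    have h3 : a ≤ t ^ 2 := by rw [ha, h1]; linarith
    linarith
  have key := le_mul_of_remainder_nonneg hPe hP0.le ha0 hη0 hb0.le (by linarith : 0 ≤ q)
    (by linarith : θ ≤ q) hσ2 hF hE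
  refine key.trans ?_
  gcongr
  linarith

/-- `1 + a_ε - 2 b_ε / q - (1 - c_ε) / q²` is positive for `a_ε = 2 ε`. -/
theorem denominator_pos {ε e q : ℝ} (he : 0 ≤ e) (h : e ≤ 1 / 100) (hε : ε = e ^ 2) (hq : 3 ≤ q) :
    0 < 1 + 2 * ε - 2 * bEps ε / q - (1 - cEps ε) / q ^ 2 := by
  have hs : Real.sqrt ε = e := by rw [hε, Real.sqrt_sq he]
  have hε0 : 0 ≤ ε := by rw [hε]; positivity
  have hb := bEps_le he h hε
  have hc := cEps_nonneg hε0 (by linarith)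
  have h1 : 2 * bEps ε / q ≤ 1 / 25 := by
    rw [div_le_iff₀ (by linarith)]
    linarith
  have h2 : (1 - cEps ε) / q ^ 2 ≤ 1 / 9 := by
    rw [div_le_iff₀ (by positivity)]
    nlinarith
  linarith

/-- Induction on `j`. The map `X ↦ 1 - 1 / (4 U X)` is increasing for `X > 0`, and the one step
inequality says that it sends the `j`-th bound to at least the next one. -/
theorem XLower_pos_and_le_XSeq {ν ε e t : ℝ} (ht : 0 < t) (ht1 : t ≤ 1 / 10) (he : e = t ^ 2)
    (hε : ε = e ^ 2) (hθ : t ≤ ε ^ (min (2 * (ν - 11 / 8)) (1 / 4)))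
    (hθ1 : ε ^ (min (2 * (ν - 11 / 8)) (1 / 4)) ≤ 1 / 2) {N : ℕ} {j : ℕ} (hj : 2 * j + 2 ≤ N) :
    0 < XLower ν (2 * ε) ε N j ∧ XLower ν (2 * ε) ε N j ≤ XSeq (2 * ε) ε N j := by
  have he0 : 0 < e := by rw [he]; positivity
  have he1 : e ≤ 1 / 100 := by rw [he]; nlinarith
  have hs : Real.sqrt ε = e := by rw [hε, Real.sqrt_sq he0.le]
  obtain ⟨hβ, hβ1⟩ := one_le_bEps_div he0 he1 hε
  have hγ := sq_sqrt_eta_mul he0.le he1 hε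
  have hγ0 : 0 < Real.sqrt ((1 - Real.sqrt ε) * (2 * ε)) := by
    rw [hs, hε]
    exact Real.sqrt_pos.2 (mul_pos (by linarith) (by positivity))
  have hβγ := div_mul_cancel₀ (bEps ε) hγ0.ne'
  have hpos : ∀ i : ℕ, 2 * i + 2 ≤ N → 0 < XLower ν (2 * ε) ε N i := by
    intro i hi
    have hi' : (2 * i + 2 : ℝ) ≤ N := by exact_mod_cast hi
    rw [XLower]
    -- The denominator is at least `2 - 1/2`, while the numerator is at most `1 + 2 e`.
    have h1 : bEps ε / Real.sqrt ((1 - Real.sqrt ε) * (2 * ε)) /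
        (N - 2 * i - ε ^ (min (2 * (ν - 11 / 8)) (1 / 4))) < 1 := by
      rw [div_lt_one (by linarith)]
      linarith
    linarith
  have hb0 := bEps_le he0.le he1 hε
  have hb1 := le_bEps he0.le he1 hε
  have hc := cEps_nonneg (ε := ε) (by rw [hε]; positivity) (by linarith)
  refine ⟨hpos j hj, ?_⟩
  induction j with
  | zero =>
    have hp := hpos 0 hj
    have hj' : (2 : ℝ) ≤ N := by exact_mod_cast hj
    rw [XLower, XSeq]
    have h1 : 0 ≤ bEps ε / Real.sqrt ((1 - Real.sqrt ε) * (2 * ε)) /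
        (N - 2 * (0 : ℕ) - ε ^ (min (2 * (ν - 11 / 8)) (1 / 4))) := by
      apply div_nonneg (by linarith)
      push_cast
      linarith
    have h2 : Real.sqrt ((1 - Real.sqrt ε) * (2 * ε)) ≤ 1 := by nlinarith
    linarith
  | succ j ih =>
    have ih := ih (by omega)
    have hp := hpos j (by omega)
    have hp' := hpos (j + 1) hj
    have hj' : (2 * j + 4 : ℝ) ≤ N := by exact_mod_cast hj
    rw [XSeq]
    set γ := Real.sqrt ((1 - Real.sqrt ε) * (2 * ε)) with hγdef
    set β := bEps ε / γ with hβdef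
    set θ := ε ^ (min (2 * (ν - 11 / 8)) (1 / 4)) with hθdef
    set q : ℝ := N - 2 * j - 1 with hqdef
    have hq : 3 ≤ q := by linarith
    have hU := denominator_pos he0.le he1 hε hq
    set U := 1 + 2 * ε - 2 * bEps ε / q - (1 - cEps ε) / q ^ 2 with hUdef
    have e1 : XLower ν (2 * ε) ε N j = 1 / 2 * (1 + γ - β / (q + 1 - θ)) := by
      rw [XLower, hqdef, show (N : ℝ) - 2 * j - 1 + 1 - θ = N - 2 * j - θ by ring]
    have e2 : XLower ν (2 * ε) ε N (j + 1) = 1 - 1 / 2 * (1 - γ + β / (q - 1 - θ)) := by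
      rw [XLower, hqdef]
      have : (N : ℝ) - 2 * (j + 1 : ℕ) - θ = N - 2 * j - 1 - 1 - θ := by push_cast; ring
      rw [this]
      ring
    have hstep := one_le_mul_mul_of_small (a := 2 * ε) (η := 1 - e) (c := cEps ε) (γ := γ)
      ht ht1 hθ hθ1 hq (by rw [hε, he]; ring) (by rw [he]) (by rw [← he]; exact hb1)
      (by rw [← he]; exact hb0) hc hβ (by rw [← he]; exact hβ1) hβγ
      (by rw [hγ, hε])
    rw [e2]
    have h3 : 1 / (4 * U * XSeq (2 * ε) ε N j) ≤ 1 / 2 * (1 - γ + β / (q - 1 - θ)) := by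
      have hX : 0 < XSeq (2 * ε) ε N j := hp.trans_le ih
      have hV0 : 0 ≤ 1 - γ + β / (q - 1 - θ) := by
        have : γ ≤ 1 := by nlinarith
        have : 0 ≤ β / (q - 1 - θ) := div_nonneg (by linarith) (by linarith)
        linarith
      rw [div_le_iff₀ (by positivity)]
      calc (1 : ℝ) ≤ U * ((1 + γ - β / (q + 1 - θ)) * (1 - γ + β / (q - 1 - θ))) := hstep
        _ = 1 / 2 * (1 - γ + β / (q - 1 - θ)) * (4 * U * XLower ν (2 * ε) ε N j) := by
            rw [e1]; ring
        _ ≤ _ := by gcongr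
    linarith

/-! ### Elementary estimates for the hopping term -/

/-- The lower bound `F p² (n + 1) (n + 2) ≤ N² D D'` for the product of two neighbouring diagonal
energies `D`, `D'`. -/
theorem hopping_estimate {ε N n p q y κ A : ℝ} (hε : 0 < ε) (hε1 : ε ≤ 1) (hn : 0 ≤ n)
    (hq : 3 ≤ q) (hqp : q ≤ p) (hnp : n + p ≤ N) (hy : 0 ≤ y) (hy1 : y ≤ 1 / 2)
    (hκ : κ ≤ ε ^ 2 / 8) (hA : A = 1 + ε - y - κ)
    (hN : 1 + 1 / ε ≤ ε ^ 2 / 8 * (N - 1 / ε)) :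
    (1 + 2 * ε - 2 * ((1 + ε) * y) / q - ((1 + ε) ^ 2 - y ^ 2) / q ^ 2) * p ^ 2 *
      ((n + 1) * (n + 2)) ≤
        ((ε * N + n) * p + A * N) * ((ε * N + n + 2) * (p - 2) + A * N) := by
  have hp : 3 ≤ p := hq.trans hqp
  have hε2 : ε ^ 2 ≤ 1 := by nlinarith
  have hA0 : 1 / 4 < A := by rw [hA]; linarith
  have hf1 : (n + 1) * ((1 + ε) * p + (A - ε ^ 2 / 8)) ≤ (ε * N + n) * p + A * N := by
    have h1 : p ≤ ε * p * (N - n - 1) + ε ^ 2 / 8 * (n + 1) := by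
      -- Replacing `N` by `n + 1` costs `p`. Far from full condensation the kinetic term `ε p (N - n
      -- - 1)` pays for it. Otherwise `n` is within `1 + 1/ε` of `N`, so `p ≤ N - n` stays bounded
      -- while `ε² (n + 1) / 8` is large by the choice of `N`.
      by_cases h : 1 ≤ ε * (N - n - 1)
      · have : p * 1 ≤ p * (ε * (N - n - 1)) := by gcongr
        have : 0 ≤ ε ^ 2 / 8 * (n + 1) := by positivity
        linarith
      · push Not at h
        have h2 : N - n - 1 < 1 / ε := by
          rw [lt_div_iff₀ hε]
          linarith
        have h3 : ε ^ 2 / 8 * (N - 1 / ε) ≤ ε ^ 2 / 8 * (n + 1) := by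
          gcongr
          linarith
        have h4 : 0 ≤ ε * p * (N - n - 1) :=
          mul_nonneg (by positivity) (by linarith)
        linarith
    have h5 : 0 ≤ A * (N - n - 1) := mul_nonneg (by linarith) (by linarith)
    nlinarith
  have hf2 : (n + 2) * ((1 + ε) * (p - 2) + A) ≤ (ε * N + n + 2) * (p - 2) + A * N := by
    have h1 : 0 ≤ (ε * (p - 2) + A) * (N - n - 2) :=
      mul_nonneg (add_nonneg (mul_nonneg hε.le (by linarith)) (by linarith)) (by linarith)
    nlinarith
  have hf0 : 0 ≤ (1 + ε) * p + (A - ε ^ 2 / 8) :=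
    add_nonneg (mul_nonneg (by linarith) (by linarith)) (by linarith)
  have hf0' : 0 ≤ (1 + ε) * (p - 2) + (A - ε ^ 2 / 8) :=
    add_nonneg (mul_nonneg (by linarith) (by linarith)) (by linarith)
  have hmain : (1 + 2 * ε - 2 * ((1 + ε) * y) / q - ((1 + ε) ^ 2 - y ^ 2) / q ^ 2) * p ^ 2 ≤
      ((1 + ε) * p + (A - ε ^ 2 / 8)) * ((1 + ε) * (p - 2) + (A - ε ^ 2 / 8)) := by
    -- The first factor is nondecreasing in `q`, so `q` may be replaced by the larger `p`, one value
    -- of `q` serving both pair numbers in a block.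
    have e1 : 2 * ((1 + ε) * y) / p ≤ 2 * ((1 + ε) * y) / q := by gcongr
    have e2 : ((1 + ε) ^ 2 - y ^ 2) / p ^ 2 ≤ ((1 + ε) ^ 2 - y ^ 2) / q ^ 2 := by
      have : 0 ≤ (1 + ε) ^ 2 - y ^ 2 := by nlinarith
      gcongr
    have e3 : (1 + 2 * ε - 2 * ((1 + ε) * y) / q - ((1 + ε) ^ 2 - y ^ 2) / q ^ 2) * p ^ 2 ≤
        (1 + 2 * ε - 2 * ((1 + ε) * y) / p - ((1 + ε) ^ 2 - y ^ 2) / p ^ 2) * p ^ 2 := by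
      gcongr
    have e4 : (1 + 2 * ε - 2 * ((1 + ε) * y) / p - ((1 + ε) ^ 2 - y ^ 2) / p ^ 2) * p ^ 2 =
        (1 + 2 * ε) * p ^ 2 - 2 * ((1 + ε) * y) * p - ((1 + ε) ^ 2 - y ^ 2) := by
      field_simp
    -- Without `κ` and `ε²/8` the right side would be `p²` times the factor in the recursion with
    -- `(1 + ε)²` in place of `1 + 2 ε`. The surplus `ε² p²` is what `e8` spends on these two
    -- errors.
    have e5 : ((1 + ε) * p + (A - ε ^ 2 / 8)) * ((1 + ε) * (p - 2) + (A - ε ^ 2 / 8)) =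
        ((1 + ε) * p - (y + κ + ε ^ 2 / 8)) ^ 2 - (1 + ε) ^ 2 := by
      rw [hA]
      ring
    rw [e5]
    refine e3.trans (e4.le.trans ?_)
    have e6 : (κ + ε ^ 2 / 8) ≤ ε ^ 2 / 4 := by linarith
    have e7 : ((1 + ε) * p - (y + ε ^ 2 / 4)) ^ 2 ≤ ((1 + ε) * p - (y + κ + ε ^ 2 / 8)) ^ 2 := by
      have : 0 ≤ (1 + ε) * p - (y + ε ^ 2 / 4) := by nlinarith
      exact pow_le_pow_left₀ this (by linarith) 2
    have e8 : 2 * ((1 + ε) * p) * (ε ^ 2 / 4) ≤ ε ^ 2 * p ^ 2 := by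
      have h1 : 2 * (1 + ε) ≤ 4 * p := by linarith
      calc 2 * ((1 + ε) * p) * (ε ^ 2 / 4) = 2 * (1 + ε) * (ε ^ 2 * p / 4) := by ring
        _ ≤ 4 * p * (ε ^ 2 * p / 4) := by gcongr
        _ = _ := by ring
    have e9 : 0 ≤ ε ^ 2 * y := by positivity
    have e10 : 0 ≤ (ε ^ 2) ^ 2 := by positivity
    linarith
  calc _ ≤ ((1 + ε) * p + (A - ε ^ 2 / 8)) * ((1 + ε) * (p - 2) + (A - ε ^ 2 / 8)) *
        ((n + 1) * (n + 2)) := by gcongr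
    _ = ((n + 1) * ((1 + ε) * p + (A - ε ^ 2 / 8))) *
        ((n + 2) * ((1 + ε) * (p - 2) + (A - ε ^ 2 / 8))) := by ring
    _ ≤ ((ε * N + n) * p + A * N) * ((n + 2) * ((1 + ε) * (p - 2) + (A - ε ^ 2 / 8))) := by gcongr
    _ ≤ ((ε * N + n) * p + A * N) * ((n + 2) * ((1 + ε) * (p - 2) + A)) := by
        have : 0 ≤ (ε * N + n) * p + A * N := le_trans (by positivity) hf1
        gcongr
        have : 0 ≤ ε ^ 2 := sq_nonneg ε
        linarith
    _ ≤ _ := by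
        have : 0 ≤ (ε * N + n) * p + A * N := le_trans (by positivity) hf1
        gcongr

/-! ### Reduced inverses of Feshbach-Schur Hamiltonians -/

section Perturbed

variable {ι : Type}

theorem tsum_eq_one_add_mul {A : Type*} [NormedRing A] [CompleteSpace A] {Γ r : A}
    (h : ‖r * Γ * r‖ < 1) :
    ∑' l : ℕ, (Γ * (r * r)) ^ l = 1 + Γ * (r * r * ∑' l : ℕ, (Γ * (r * r)) ^ l) := by
  rw [sq_mul_tsum_mul_sq_pow h, tsum_mul_sq_pow h]
  simp only [mul_assoc]

/-- On the range of the projection the new operator is the old one minus `Γ`, the cutoff being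
invisible there. The Neumann series inverts it, and only the symmetric ratio `r Γ r` has to be
small. -/
theorem IsReducedInverse.geometric {f : ι → ℝ} {B B' Γ R r : L2 ι →L[ℂ] L2 ι} {p q : ι → Prop}
    (hqp : ∀ k, q k → p k) (hR : IsReducedInverse (coordProj q) (diagPMap f + ofCLM B) R)
    (hr : R = r * r) (hΓ : coordProj q * Γ = Γ)
    (hB : coordProj q * B' * coordProj q = coordProj q * B * coordProj q - Γ)
    (h1 : ‖r * Γ * r‖ < 1) :
    IsReducedInverse (coordProj q) (diagPMap (cutoff p f) + ofCLM B')
      (R * ∑' l : ℕ, (Γ * R) ^ l) := by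
  have hS := tsum_eq_one_add_mul h1
  have hRS := sq_mul_tsum_eq_right h1
  rw [← hr] at hS hRS
  set Q : L2 ι →L[ℂ] L2 ι := coordProj q with hQ
  set S : L2 ι →L[ℂ] L2 ι := ∑' l : ℕ, (Γ * R) ^ l
  have hQR : Q * R = R := hR.left
  have hRQ : R * Q = R := hR.right
  have hdiag : ∀ x k, Q x = x → ((cutoff p f k : ℝ) : ℂ) * x k = (f k : ℂ) * x k := by
    intro x k hx
    by_cases hq : q k
    · rw [cutoff_of_pos (hqp k hq)]
    · rw [← hx, coordProj_apply_of_neg hq, mul_zero, mul_zero]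
  have hB' : ∀ x, Q x = x → Q (B' x) = Q (B x) - Γ x := by
    intro x hx
    have h := congrArg (fun A : L2 ι →L[ℂ] L2 ι => A x) hB
    change Q (B' (Q x)) = Q (B (Q x)) - Γ x at h
    rwa [hx] at h
  refine IsReducedInverse.of_graph ?_ ?_ ?_ ?_
  · show Q * (R * S) = R * S
    rw [← mul_assoc, hQR]
  · show R * S * Q = R * S
    rw [hRS, add_mul, hRQ, mul_assoc _ R Q, hRQ]
  · intro ψ
    obtain ⟨z, hz, hQz⟩ := hR.exists_graph (S ψ)
    rw [mem_graph_diagPMap_add] at hz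
    have hx : Q (R (S ψ)) = R (S ψ) := congrArg (fun A : L2 ι →L[ℂ] L2 ι => A (S ψ)) hQR
    refine ⟨z - B (R (S ψ)) + B' (R (S ψ)), ?_, ?_⟩
    · rw [mem_graph_diagPMap_add]
      intro k
      show z k - B (R (S ψ)) k + B' (R (S ψ)) k = _ * R (S ψ) k + B' (R (S ψ)) k
      rw [hdiag _ k hx, hz k]
      ring
    · rw [map_add, map_sub, hQz, hB' _ hx]
      have e1 : S ψ = ψ + Γ (R (S ψ)) := congrArg (fun A : L2 ι →L[ℂ] L2 ι => A ψ) hS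
      have e2 : Q (Γ (R (S ψ))) = Γ (R (S ψ)) :=
        congrArg (fun A : L2 ι →L[ℂ] L2 ι => A (R (S ψ))) hΓ
      have e3 : Q (S ψ) = Q ψ + Γ (R (S ψ)) := by
        conv_lhs => rw [e1, map_add, e2]
      rw [e3]
      abel
  · intro x z hz hx
    rw [mem_graph_diagPMap_add] at hz
    have hz0 : (x, z - B' x + B x) ∈ (diagPMap f + ofCLM B).graph := by
      rw [mem_graph_diagPMap_add]
      intro k
      show z k - B' x k + B x k = _
      rw [hz k, hdiag x k hx]
      ring
    have h2 := hR.apply_of_graph hz0 hx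
    have e1 : Q z = Q (z - B' x + B x) - Γ x := by
      rw [map_add, map_sub, hB' x hx]
      abel
    have e2 : R (S (Q (z - B' x + B x))) = R (Q (z - B' x + B x)) +
        R (S (Γ (R (Q (z - B' x + B x))))) :=
      congrArg (fun A : L2 ι →L[ℂ] L2 ι => A (Q (z - B' x + B x))) hRS
    show R (S (Q z)) = x
    rw [e1, map_sub, map_sub, e2, h2]
    abel

end Perturbed

/-! ### The algebra of the flow -/

section FlowAlgebra

/-- The relations between the pair number projections and the parts `A`, `W`, `V = W*` of the
Hamiltonian that preserve, lower and raise the pair number. -/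
structure FlowRelations {𝔄 : Type*} [Ring 𝔄] (A W V : 𝔄) (P Q : ℕ → 𝔄) : Prop where
  A_P : ∀ s, A * P s = P s * A
  W_Q : ∀ s, W * Q s = Q (s + 1) * W
  W_P : ∀ s, W * P s = P (s + 1) * W
  V_Q : ∀ s, V * Q (s + 1) = Q s * V
  V_P : ∀ s, V * P (s + 1) = P s * V
  Q_Q : ∀ s, Q s * Q s = Q s
  P_Q : ∀ s, P s * Q s = 0
  Q_P : ∀ s, Q s * P s = 0
  P_Q_succ : ∀ s, P s * Q (s + 1) = Q (s + 1)
  Q_succ_P : ∀ s, Q (s + 1) * P s = Q (s + 1)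
  P_P_succ : ∀ s, P s * P (s + 1) = P (s + 1)
  P_succ_P : ∀ s, P (s + 1) * P s = P (s + 1)

variable {𝔄 : Type*} [Ring 𝔄] {A W V : 𝔄} {P Q : ℕ → 𝔄}

theorem FlowRelations.P_succ_Q (h : FlowRelations A W V P Q) (s : ℕ) : P (s + 1) * Q s = 0 := by
  rw [← h.P_succ_P, mul_assoc, h.P_Q, mul_zero]

theorem FlowRelations.Q_P_succ (h : FlowRelations A W V P Q) (s : ℕ) : Q s * P (s + 1) = 0 := by
  rw [← h.P_P_succ, ← mul_assoc, h.Q_P, zero_mul]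

theorem FlowRelations.Q_Q_succ (h : FlowRelations A W V P Q) (s : ℕ) : Q s * Q (s + 1) = 0 := by
  rw [← h.P_Q_succ, ← mul_assoc, h.Q_P, zero_mul]

theorem FlowRelations.Q_succ_Q (h : FlowRelations A W V P Q) (s : ℕ) : Q (s + 1) * Q s = 0 := by
  rw [← h.Q_succ_P, mul_assoc, h.P_Q, mul_zero]

theorem FlowRelations.compress_Q (h : FlowRelations A W V P Q) (s : ℕ) :
    Q s * (A + W + V) * Q s = Q s * A * Q s := by
  have e1 : Q s * W * Q s = 0 := by rw [mul_assoc, h.W_Q, ← mul_assoc, h.Q_Q_succ, zero_mul]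
  have e2 : Q s * V * Q s = 0 := by rw [← h.V_Q, mul_assoc, h.Q_succ_Q, mul_zero]
  rw [mul_add, mul_add, add_mul, add_mul, e1, e2, add_zero, add_zero]

theorem FlowRelations.P_mul_Q (h : FlowRelations A W V P Q) (s : ℕ) :
    P s * (A + W + V) * Q s = P s * W * Q s := by
  have e1 : P s * A * Q s = 0 := by rw [← h.A_P, mul_assoc, h.P_Q, mul_zero]
  have e2 : P s * V * Q s = 0 := by rw [← h.V_P, mul_assoc, h.P_succ_Q, mul_zero]
  rw [mul_add, mul_add, add_mul, add_mul, e1, e2, zero_add, add_zero]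

theorem FlowRelations.Q_mul_P (h : FlowRelations A W V P Q) (s : ℕ) :
    Q s * (A + W + V) * P s = Q s * V * P s := by
  have e1 : Q s * A * P s = 0 := by rw [mul_assoc, h.A_P, ← mul_assoc, h.Q_P, zero_mul]
  have e2 : Q s * W * P s = 0 := by rw [mul_assoc, h.W_P, ← mul_assoc, h.Q_P_succ, zero_mul]
  rw [mul_add, mul_add, add_mul, add_mul, e1, e2, zero_add, zero_add]

/-- The bounded part of the Feshbach-Schur Hamiltonian after a step with reduced inverse `R`. -/
def flowBounded (A W V : 𝔄) (P : 𝔄) (R : 𝔄) : 𝔄 :=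
  P * (A + W + V) * P - P * W * R * V * P

/-- Nothing is asked of `B` in the `Q`-block: that block enters only through `R`. This lets the
lemma serve at every step, where `B` differs from `A + W + V` just there. -/
theorem FlowRelations.feshbach_initial (h : FlowRelations A W V P Q) {s : ℕ} {B R : 𝔄}
    (hPP : P s * B * P s = P s * (A + W + V) * P s)
    (hPQ : P s * B * Q s = P s * (A + W + V) * Q s)
    (hQP : Q s * B * P s = Q s * (A + W + V) * P s) (hQR : Q s * R = R) (hRQ : R * Q s = R) :
    P s * B * P s - P s * B * R * B * P s = flowBounded A W V (P s) R := by
  have hR : R = Q s * R * Q s := by rw [hQR, hRQ]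
  have e : P s * B * R * B * P s = P s * W * R * V * P s := by
    calc P s * B * R * B * P s = P s * B * (Q s * R * Q s) * B * P s := by rw [← hR]
      _ = (P s * B * Q s) * R * (Q s * B * P s) := by simp only [mul_assoc]
      _ = (P s * W * Q s) * R * (Q s * V * P s) := by rw [hPQ, hQP, h.P_mul_Q, h.Q_mul_P]
      _ = P s * W * (Q s * R * Q s) * V * P s := by simp only [mul_assoc]
      _ = _ := by rw [← hR]
  rw [e, hPP, flowBounded]

/-- The correction made at step `s` has range and support in block `s + 1`, because `W` and `V`
connect neighbouring blocks only. It is thus annihilated by `P (s + 1)` on either side, and survives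
only inside the new inverse `R'`. No corrections accumulate. -/
theorem FlowRelations.feshbach_succ (h : FlowRelations A W V P Q) {s : ℕ} {R R' : 𝔄}
    (hQR : Q s * R = R) (hRQ : R * Q s = R) (hQR' : Q (s + 1) * R' = R')
    (hRQ' : R' * Q (s + 1) = R') :
    P (s + 1) * flowBounded A W V (P s) R * P (s + 1) -
        P (s + 1) * flowBounded A W V (P s) R * R' * flowBounded A W V (P s) R * P (s + 1) =
      flowBounded A W V (P (s + 1)) R' := by
  have e1 : P (s + 1) * W * R = 0 := by
    rw [← h.W_P, ← hQR, mul_assoc, ← mul_assoc (P s), h.P_Q, zero_mul, mul_zero]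
  have e2 : R * V * P (s + 1) = 0 := by
    rw [mul_assoc, h.V_P, ← mul_assoc, ← hRQ, mul_assoc R, h.Q_P, mul_zero, zero_mul]
  have f1 : ∀ Y, P (s + 1) * flowBounded A W V (P s) R * Y =
      P (s + 1) * (A + W + V) * (P s * Y) := by
    intro Y
    calc P (s + 1) * flowBounded A W V (P s) R * Y
        = (P (s + 1) * P s) * (A + W + V) * P s * Y -
          (P (s + 1) * P s) * W * R * (V * P s * Y) := by
            rw [flowBounded]
            noncomm_ring
      _ = _ := by rw [h.P_succ_P, e1]; simp only [zero_mul, sub_zero, mul_assoc]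
  have f2 : ∀ Y, Y * flowBounded A W V (P s) R * P (s + 1) =
      (Y * P s) * (A + W + V) * P (s + 1) := by
    intro Y
    calc Y * flowBounded A W V (P s) R * P (s + 1)
        = Y * P s * (A + W + V) * (P s * P (s + 1)) -
          Y * P s * W * (R * V * (P s * P (s + 1))) := by
            rw [flowBounded]
            noncomm_ring
      _ = _ := by rw [h.P_P_succ, e2]; simp only [mul_zero, sub_zero]
  refine h.feshbach_initial ?_ ?_ ?_ hQR' hRQ'
  · rw [f1, h.P_P_succ]
  · rw [f1, h.P_Q_succ]
  · rw [f2, h.Q_succ_P]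

theorem FlowRelations.compress_flowBounded (h : FlowRelations A W V P Q) (s : ℕ) (R : 𝔄) :
    Q (s + 1) * flowBounded A W V (P s) R * Q (s + 1) =
      Q (s + 1) * (A + W + V) * Q (s + 1) - Q (s + 1) * W * R * V * Q (s + 1) := by
  calc Q (s + 1) * flowBounded A W V (P s) R * Q (s + 1)
      = (Q (s + 1) * P s) * (A + W + V) * (P s * Q (s + 1)) -
        (Q (s + 1) * P s) * W * R * V * (P s * Q (s + 1)) := by
          rw [flowBounded]
          noncomm_ring
    _ = _ := by rw [h.Q_succ_P, h.P_Q_succ]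

end FlowAlgebra

/-! ### The Feshbach-Schur flow -/

section Flow

variable {d : ℕ} {L : ℝ} (φ : PairPotential d L) (N : ℕ) (J : ℕ → Mode d) (m : ℕ) (w : ℝ)

/-- The part of the bounded Hamiltonian that preserves the number of particles in `±j_m`. -/
def pairPreserving : FockN d N →L[ℂ] FockN d N :=
  sumHhatBog φ N J m + Hhat0 φ N (J (m + 1)) - (w : ℂ) • ContinuousLinearMap.id ℂ _

/-- The bounded part of `H^Bog_{j_1,…,j_m} - w`. -/
def boundedPart : FockN d N →L[ℂ] FockN d N :=
  pairPreserving φ N J m w + W φ N (J (m + 1)) + Wstar φ N (J (m + 1))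

open Classical in
/-- The kinetic energy outside of the interacting modes of an occupation number state. -/
def kineticValue (L : ℝ) (J : ℕ → Mode d) (m : ℕ) (n : Occ d N) : ℝ :=
  ∑ j ∈ n.1.support.filter (fun j => ∀ l ∈ Finset.Icc 1 m, j ≠ J l ∧ j ≠ -J l),
    kSq L j * (n.1 j : ℝ)

theorem HBogSub_eq : HBogSub φ N J (m + 1) w =
    diagPMap (kineticValue N L J (m + 1)) + ofCLM (boundedPart φ N J m w) := by
  have h : sumHhatBog φ N J (m + 1) - (w : ℂ) • ContinuousLinearMap.id ℂ _ =
      boundedPart φ N J m w := by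
    rw [sumHhatBog, Finset.sum_Icc_succ_top (by omega), HhatBog, boundedPart, pairPreserving,
      sumHhatBog]
    abel
  rw [HBogSub, HBog, ← h, ← diagPMap_add_ofCLM_sub]
  rfl

variable {φ N J m w}

theorem pairProj_mul_pairProj {j : Mode d} (π π' : ℕ → Prop) :
    pairProj N j π * pairProj N j π' = pairProj N j fun k => π k ∧ π' k := coordProj_mul _ _

theorem pairProj_congr {j : Mode d} {π π' : ℕ → Prop} (h : ∀ k, π k ↔ π' k) :
    pairProj N j π = pairProj N j π' := by
  rw [show π = π' from funext fun k => propext (h k)]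

theorem pairProj_eq_zero {j : Mode d} {π : ℕ → Prop} (h : ∀ k, ¬ π k) : pairProj N j π = 0 :=
  coordProj_false fun _ => h _

theorem Qeq_eq_pairProj (j : Mode d) (i : ℕ) :
    Qeq N j i = pairProj N j fun k => k + i = N ∨ k + (i + 1) = N := rfl

theorem Qgt_eq_pairProj (j : Mode d) (i : ℕ) :
    Qgt N j i = pairProj N j fun k => k + (i + 1) < N := rfl

theorem pairPreserving_mul_pairProj (hJ : InteractingModes φ (m + 1) J) (π : ℕ → Prop) :
    pairPreserving φ N J m w * pairProj N (J (m + 1)) π =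
      pairProj N (J (m + 1)) π * pairPreserving φ N J m w := by
  have h1 : Hhat0 φ N (J (m + 1)) * pairProj N (J (m + 1)) π =
      pairProj N (J (m + 1)) π * Hhat0 φ N (J (m + 1)) :=
    (isDiagonal_Hhat0 φ N (J (m + 1))).mul_coordProj _
  have h2 : ((w : ℂ) • ContinuousLinearMap.id ℂ (FockN d N)) * pairProj N (J (m + 1)) π =
      pairProj N (J (m + 1)) π * ((w : ℂ) • ContinuousLinearMap.id ℂ (FockN d N)) := by
    rw [smul_mul_assoc, mul_smul_comm]
    rfl
  rw [pairPreserving, sub_mul, add_mul, mul_sub, mul_add, sumHhatBog_mul_pairProj hJ, h1, h2]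

theorem InteractingModes.last_ne_zero (hJ : InteractingModes φ (m + 1) J) : J (m + 1) ≠ 0 :=
  hJ.ne_zero _ (Finset.mem_Icc.2 ⟨by omega, le_rfl⟩)

theorem flowRelations (hJ : InteractingModes φ (m + 1) J) :
    FlowRelations (pairPreserving φ N J m w) (W φ N (J (m + 1))) (Wstar φ N (J (m + 1)))
      (fun s => Qgt N (J (m + 1)) (2 * s)) (fun s => Qeq N (J (m + 1)) (2 * s)) := by
  have hj := hJ.last_ne_zero
  constructor <;> intro s <;> simp only [Qeq_eq_pairProj, Qgt_eq_pairProj]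
  · exact pairPreserving_mul_pairProj hJ _
  · rw [← pairProj_mul_W φ hj]
    congr 1
    exact pairProj_congr fun k => by omega
  · rw [← pairProj_mul_W φ hj]
    congr 1
    exact pairProj_congr fun k => by omega
  · rw [← Wstar_mul_pairProj φ hj]
    congr 1
    exact pairProj_congr fun k => by omega
  · rw [← Wstar_mul_pairProj φ hj]
    congr 1
    exact pairProj_congr fun k => by omega
  · rw [pairProj_mul_pairProj]
    exact pairProj_congr fun k => by omega
  · rw [pairProj_mul_pairProj]
    exact pairProj_eq_zero fun k => by omega
  · rw [pairProj_mul_pairProj]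
    exact pairProj_eq_zero fun k => by omega
  · rw [pairProj_mul_pairProj]
    exact pairProj_congr fun k => by omega
  · rw [pairProj_mul_pairProj]
    exact pairProj_congr fun k => by omega
  · rw [pairProj_mul_pairProj]
    exact pairProj_congr fun k => by omega
  · rw [pairProj_mul_pairProj]
    exact pairProj_congr fun k => by omega

variable (φ N J m w)

/-- `R_{i,i} ∑_l [Γ_{i,i} R_{i,i}]^l` at `i = 2s`. -/
def dressedInverse (s : ℕ) : FockN d N →L[ℂ] FockN d N :=
  RBog φ N J m w s * ∑' l : ℕ, (GammaBog φ N J m w s * RBog φ N J m w s) ^ l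

theorem tsum_zero_pow {A : Type*} [NormedRing A] : ∑' l : ℕ, (0 : A) ^ l = 1 := by
  rw [tsum_eq_single 0 fun l hl => zero_pow hl, pow_zero]

theorem dressedInverse_zero : dressedInverse φ N J m w 0 = RBog φ N J m w 0 := by
  rw [dressedInverse, GammaBog, zero_mul, tsum_zero_pow, mul_one]

/-- The default value `GammaBog 0 = 0` makes the series at `s = 0` equal to `1`, so the separate
starting case of the definition follows the general recursion. -/
theorem GammaBog_succ (s : ℕ) : GammaBog φ N J m w (s + 1) =
    WBlock φ N J m (2 * (s + 1)) (2 * s) * dressedInverse φ N J m w s *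
      WstarBlock φ N J m (2 * s) (2 * (s + 1)) := by
  cases s with
  | zero =>
    show WBlock φ N J m (2 * (0 + 1)) (2 * 0) * (RBog φ N J m w 0 *
      WstarBlock φ N J m (2 * 0) (2 * (0 + 1))) = _
    rw [dressedInverse_zero, mul_assoc]
  | succ s =>
    show WBlock φ N J m (2 * (s + 2)) (2 * (s + 1)) * (RBog φ N J m w (s + 1) *
      ((∑' l : ℕ, (GammaBog φ N J m w (s + 1) * RBog φ N J m w (s + 1)) ^ l) *
        WstarBlock φ N J m (2 * (s + 1)) (2 * (s + 2)))) = _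
    rw [dressedInverse]
    simp only [mul_assoc]

theorem GammaCheck_zero : GammaCheck φ N J m w 0 = 1 := by
  have h : GammaSym φ N J m w 0 = 0 := by
    show posSqrt _ * (0 * posSqrt _) = 0
    rw [zero_mul, mul_zero]
  rw [GammaCheck, h, tsum_zero_pow]

theorem KFormula_zero : KFormula φ N J m w 0 = KFormulaZero φ N J m w := by
  have h : ∑' l : ℕ, (GammaBog φ N J m w 0 ∘L RBog φ N J m w 0) ^ l = 1 := by
    show ∑' l : ℕ, ((0 : FockN d N →L[ℂ] FockN d N) * RBog φ N J m w 0) ^ l = 1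
    rw [zero_mul, tsum_zero_pow]
  rw [KFormula, KFormulaZero, h]
  rfl

theorem KFormula_eq (s : ℕ) : KFormula φ N J (m + 1) w s =
    diagPMap (cutoff (fun n : Occ d N => n.pair (J (m + 1)) + (2 * s + 1) < N)
        (kineticValue N L J (m + 1))) +
      ofCLM (flowBounded (pairPreserving φ N J m w) (W φ N (J (m + 1))) (Wstar φ N (J (m + 1)))
        (Qgt N (J (m + 1)) (2 * s)) (dressedInverse φ N J (m + 1) w s)) := by
  have h := coordProj_compress (kineticValue N L J (m + 1)) (boundedPart φ N J m w)
    fun n : Occ d N => n.pair (J (m + 1)) + (2 * s + 1) < N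
  rw [← HBogSub_eq] at h
  have h' : pcomp (ofCLM (Qgt N (J (m + 1)) (2 * s))) (pcomp (HBogSub φ N J (m + 1) w)
      (ofCLM (Qgt N (J (m + 1)) (2 * s)))) = _ := h
  rw [KFormula, h', diagPMap_add_ofCLM_sub]
  rfl

variable {φ N J m w}

theorem star_WBlock (i i' : ℕ) : star (WBlock φ N J m i i') = WstarBlock φ N J m i' i := by
  show star (Qeq N (J m) i * (W φ N (J m) * Qeq N (J m) i')) =
    Qeq N (J m) i' * (Wstar φ N (J m) * Qeq N (J m) i)
  rw [star_mul, star_mul, star_W, Qeq_eq_pairProj, Qeq_eq_pairProj,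
    (isSelfAdjoint_pairProj _ _).star_eq, (isSelfAdjoint_pairProj _ _).star_eq, mul_assoc]

theorem posSqrt_mul_self {H : Type} [NormedAddCommGroup H] [InnerProductSpace ℂ H]
    [CompleteSpace H] {R : H →L[ℂ] H} (h : 0 ≤ R) : posSqrt R * posSqrt R = R :=
  CFC.sqrt_mul_sqrt_self R h

theorem RBog_eq_sq {s : ℕ} (h : 0 ≤ RBog φ N J m w s) :
    RBog φ N J m w s = posSqrt (RBog φ N J m w s) * posSqrt (RBog φ N J m w s) :=
  (posSqrt_mul_self h).symm

theorem isSelfAdjoint_posSqrt {H : Type} [NormedAddCommGroup H] [InnerProductSpace ℂ H]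
    [CompleteSpace H] (R : H →L[ℂ] H) : IsSelfAdjoint (posSqrt R) :=
  (CFC.sqrt_nonneg R).isSelfAdjoint

theorem GammaSym_eq (s : ℕ) : GammaSym φ N J m w s =
    posSqrt (RBog φ N J m w s) * GammaBog φ N J m w s * posSqrt (RBog φ N J m w s) := by
  rw [mul_assoc]
  rfl

theorem dressedInverse_eq {s : ℕ} (h : 0 ≤ RBog φ N J m w s)
    (h1 : ‖GammaSym φ N J m w s‖ < 1) : dressedInverse φ N J m w s =
      posSqrt (RBog φ N J m w s) * GammaCheck φ N J m w s * posSqrt (RBog φ N J m w s) := by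
  rw [GammaSym_eq] at h1
  rw [GammaCheck, GammaSym_eq, ← sq_mul_tsum_mul_sq_pow h1, ← RBog_eq_sq h]
  rfl

theorem summable_GammaBog_pow {s : ℕ} (h : 0 ≤ RBog φ N J m w s)
    (h1 : ‖GammaSym φ N J m w s‖ < 1) :
    Summable fun l : ℕ => (GammaBog φ N J m w s ∘L RBog φ N J m w s) ^ l := by
  rw [GammaSym_eq] at h1
  have := summable_mul_sq_pow h1
  rwa [← RBog_eq_sq h] at this

theorem isSelfAdjoint_GammaSym {s : ℕ} (h : IsSelfAdjoint (GammaBog φ N J m w s)) :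
    IsSelfAdjoint (GammaSym φ N J m w s) := by
  rw [GammaSym_eq, IsSelfAdjoint, star_mul, star_mul, h.star_eq,
    (isSelfAdjoint_posSqrt _).star_eq, mul_assoc]

theorem isSelfAdjoint_dressedInverse {s : ℕ} (h : IsSelfAdjoint (GammaBog φ N J m w s))
    (hR : 0 ≤ RBog φ N J m w s) (h1 : ‖GammaSym φ N J m w s‖ < 1) :
    IsSelfAdjoint (dressedInverse φ N J m w s) := by
  have hC : IsSelfAdjoint (GammaCheck φ N J m w s) :=
    isSelfAdjoint_tsum_pow (isSelfAdjoint_GammaSym h)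
  rw [dressedInverse_eq hR h1, IsSelfAdjoint, star_mul, star_mul, hC.star_eq,
    (isSelfAdjoint_posSqrt _).star_eq, mul_assoc]

theorem isSelfAdjoint_GammaBog_succ {s : ℕ} (h : IsSelfAdjoint (dressedInverse φ N J m w s)) :
    IsSelfAdjoint (GammaBog φ N J m w (s + 1)) := by
  rw [GammaBog_succ, IsSelfAdjoint, star_mul, star_mul, h.star_eq, ← star_WBlock, star_star,
    mul_assoc]

/-- With `Y` the symmetrized hopping, the new term is `Y Γ̌ Y*`: the square roots of the resolvent
inside the dressed inverse are shared out to the two hopping factors. -/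
theorem norm_GammaSym_succ_le {s : ℕ} {G x : ℝ} (hR : 0 ≤ RBog φ N J m w s)
    (h1 : ‖GammaSym φ N J m w s‖ < 1) (hG : ‖GammaCheck φ N J m w s‖ ≤ G)
    (hx : ‖posSqrt (RBog φ N J m w (s + 1)) * WBlock φ N J m (2 * (s + 1)) (2 * s) *
      posSqrt (RBog φ N J m w s)‖ ≤ Real.sqrt x) (hx0 : 0 ≤ x) :
    ‖GammaSym φ N J m w (s + 1)‖ ≤ x * G := by
  set r := posSqrt (RBog φ N J m w s) with hr
  set r' := posSqrt (RBog φ N J m w (s + 1)) with hr'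
  set Y := WBlock φ N J m (2 * (s + 1)) (2 * s) with hY
  have e : GammaSym φ N J m w (s + 1) =
      (r' * Y * r) * GammaCheck φ N J m w s * star (r' * Y * r) := by
    rw [star_mul, star_mul, (isSelfAdjoint_posSqrt _).star_eq, (isSelfAdjoint_posSqrt _).star_eq,
      hY, star_WBlock, GammaSym_eq, GammaBog_succ, dressedInverse_eq hR h1, ← hr, ← hr']
    simp only [mul_assoc]
  rw [e]
  calc _ ≤ ‖r' * Y * r‖ * ‖GammaCheck φ N J m w s‖ * ‖star (r' * Y * r)‖ := norm_mul₃_le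
    _ ≤ Real.sqrt x * G * Real.sqrt x := by
        rw [norm_star]
        have : 0 ≤ G := (norm_nonneg _).trans hG
        gcongr
    _ = Real.sqrt x * Real.sqrt x * G := by ring
    _ = x * G := by rw [Real.mul_self_sqrt hx0]

theorem norm_GammaCheck_le {s : ℕ} {y : ℝ} (h : ‖GammaSym φ N J m w s‖ ≤ y) (hy : y < 1) :
    ‖GammaCheck φ N J m w s‖ ≤ 1 / (1 - y) := by
  have h1 := tsum_geometric_le_of_norm_lt_one (GammaSym φ N J m w s) (h.trans_lt hy)
  have h2 : ‖(1 : FockN d N →L[ℂ] FockN d N)‖ ≤ 1 := ContinuousLinearMap.norm_id_le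
  rw [GammaCheck]
  calc _ ≤ _ := h1
    _ ≤ 1 - 1 + (1 - y)⁻¹ := by
        gcongr
    _ = _ := by rw [one_div]; ring

/-- The series `Γ̌` is controlled by any sequence with `X_{s+1} = 1 - x_s / X_s`. -/
theorem norm_GammaSym_lt_and_GammaCheck_le {X x : ℕ → ℝ} (hX0 : X 0 = 1)
    (hX : ∀ s, X (s + 1) = 1 - x s * (1 / X s)) {n : ℕ} (hpos : ∀ s ≤ n, 0 < X s)
    (hx0 : ∀ s < n, 0 ≤ x s)
    (hR : ∀ s ≤ n, 0 ≤ RBog φ N J m w s)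
    (hx : ∀ s < n, ‖posSqrt (RBog φ N J m w (s + 1)) * WBlock φ N J m (2 * (s + 1)) (2 * s) *
      posSqrt (RBog φ N J m w s)‖ ≤ Real.sqrt (x s)) :
    ∀ s ≤ n, ‖GammaSym φ N J m w s‖ < 1 ∧ ‖GammaCheck φ N J m w s‖ ≤ 1 / X s ∧
      IsSelfAdjoint (GammaBog φ N J m w s) := by
  intro s
  induction s with
  | zero =>
    intro _
    refine ⟨?_, ?_, IsSelfAdjoint.zero _⟩
    · have h : GammaSym φ N J m w 0 = 0 := by
        show posSqrt _ * (0 * posSqrt _) = 0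
        rw [zero_mul, mul_zero]
      rw [h, norm_zero]
      exact one_pos
    · rw [GammaCheck_zero, hX0, div_one]
      exact ContinuousLinearMap.norm_id_le
  | succ s ih =>
    intro hs
    obtain ⟨h1, h2, h3⟩ := ih (by omega)
    have h4 := norm_GammaSym_succ_le (hR s (by omega)) h1 h2 (hx s (by omega)) (hx0 s (by omega))
    have h5 := hpos (s + 1) hs
    rw [hX] at h5 ⊢
    refine ⟨by linarith, norm_GammaCheck_le h4 (by linarith), ?_⟩
    exact isSelfAdjoint_GammaBog_succ (isSelfAdjoint_dressedInverse h3 (hR s (by omega)) h1)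

theorem Qeq_mul_GammaBog (s : ℕ) :
    Qeq N (J m) (2 * s) * GammaBog φ N J m w s = GammaBog φ N J m w s := by
  cases s with
  | zero => exact mul_zero _
  | succ s =>
    rw [GammaBog_succ, ← mul_assoc, ← mul_assoc]
    congr 2
    show Qeq N (J m) _ * (Qeq N (J m) _ * _) = Qeq N (J m) _ * _
    rw [← mul_assoc, Qeq_eq_pairProj, pairProj_mul_pairProj]
    congr 1
    exact pairProj_congr fun k => and_self_iff

/-- The iterated Feshbach-Schur Hamiltonians. -/
theorem stepDefined_and_KBog_eq (hJ : InteractingModes φ (m + 1) J) {n : ℕ}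
    (hR : ∀ s ≤ n, ReducedInvertible (Qeq N (J (m + 1)) (2 * s)) (HBogSub φ N J (m + 1) w))
    (hR0 : ∀ s ≤ n, 0 ≤ RBog φ N J (m + 1) w s)
    (h1 : ∀ s ≤ n, ‖GammaSym φ N J (m + 1) w s‖ < 1) :
    ∀ s ≤ n, StepDefined φ N J (m + 1) w s ∧
      KBog φ N J (m + 1) w s = KFormula φ N J (m + 1) w s ∧
      Qeq N (J (m + 1)) (2 * s) * dressedInverse φ N J (m + 1) w s =
        dressedInverse φ N J (m + 1) w s ∧
      dressedInverse φ N J (m + 1) w s * Qeq N (J (m + 1)) (2 * s) =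
        dressedInverse φ N J (m + 1) w s := by
  classical
  have hrel := flowRelations (N := N) (w := w) hJ
  intro s
  induction s with
  | zero =>
    intro h0
    have hinv := (hR 0 h0).isReducedInverse
    refine ⟨hR 0 h0, ?_, ?_, ?_⟩
    · rw [KFormula_eq]
      show feshbach (Qgt N (J (m + 1)) 0) (Qeq N (J (m + 1)) 0) (HBogSub φ N J (m + 1) w) = _
      rw [HBogSub_eq] at hinv ⊢
      have := feshbach_diagPMap_add (p := fun n : Occ d N => n.pair (J (m + 1)) + (2 * 0 + 1) < N)
        (fun k hk => by omega) hinv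
      refine Eq.trans this ?_
      congr 2
      refine Eq.trans (hrel.feshbach_initial (s := 0) (B := boundedPart φ N J m w) rfl rfl rfl
        hinv.left hinv.right) ?_
      rw [dressedInverse_zero, ← HBogSub_eq]
      rfl
    · rw [dressedInverse_zero]
      exact hinv.left
    · rw [dressedInverse_zero]
      exact hinv.right
  | succ s ih =>
    intro hs
    obtain ⟨-, hK, hQD, hDQ⟩ := ih (by omega)
    have hinv := (hR (s + 1) hs).isReducedInverse
    rw [HBogSub_eq] at hinv
    have hRe : reducedInv (Qeq N (J (m + 1)) (2 * (s + 1))) (diagPMap (kineticValue N L J (m + 1))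
        + ofCLM (boundedPart φ N J m w)) = RBog φ N J (m + 1) w (s + 1) := by
      rw [← HBogSub_eq]
      rfl
    rw [hRe] at hinv
    have hΓ := Qeq_mul_GammaBog (φ := φ) (N := N) (J := J) (m := m + 1) (w := w) (s + 1)
    have hΓ' : Qeq N (J (m + 1)) (2 * (s + 1)) * W φ N (J (m + 1)) *
        dressedInverse φ N J (m + 1) w s * Wstar φ N (J (m + 1)) *
        Qeq N (J (m + 1)) (2 * (s + 1)) = GammaBog φ N J (m + 1) w (s + 1) := by
      rw [GammaBog_succ]
      -- The dressed inverse absorbs the projections of block `s` on both sides, which turns `W` and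
      -- `Wstar` into the blocks in the recursion for `GammaBog`.
      conv_lhs => rw [← hDQ, ← hQD]
      show _ = Qeq N _ _ * (W φ N _ * Qeq N _ _) * _ * (Qeq N _ _ * (Wstar φ N _ * Qeq N _ _))
      simp only [mul_assoc]
    have hnew := IsReducedInverse.geometric (p := fun n : Occ d N =>
        n.pair (J (m + 1)) + (2 * s + 1) < N)
      (B' := flowBounded (pairPreserving φ N J m w) (W φ N (J (m + 1))) (Wstar φ N (J (m + 1)))
        (Qgt N (J (m + 1)) (2 * s)) (dressedInverse φ N J (m + 1) w s))
      (fun k hk => by omega) hinv (RBog_eq_sq (hR0 _ hs)) hΓ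
      (by
        refine (hrel.compress_flowBounded s _).trans ?_
        rw [hΓ']
        rfl)
      (by
        have := h1 _ hs
        rwa [GammaSym_eq] at this)
    have hK' := hK.trans (KFormula_eq φ N J m w s)
    rw [← hK'] at hnew
    refine ⟨⟨_, hnew⟩, ?_, hnew.left, hnew.right⟩
    rw [KFormula_eq]
    show feshbach (Qgt N (J (m + 1)) (2 * (s + 1))) (Qeq N (J (m + 1)) (2 * (s + 1)))
      (KBog φ N J (m + 1) w s) = _
    rw [hK'] at hnew ⊢
    have := feshbach_diagPMap_add
      (p := fun n : Occ d N => n.pair (J (m + 1)) + (2 * (s + 1) + 1) < N)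
      (fun k hk => by omega) hnew
    refine Eq.trans this ?_
    congr 2
    · exact cutoff_cutoff (fun k hk => by omega) _
    · exact hrel.feshbach_succ hQD hDQ hnew.left hnew.right

theorem isSelfAdjoint_ofReal_smul_one {H : Type} [NormedAddCommGroup H] [InnerProductSpace ℂ H]
    [CompleteSpace H] (w : ℝ) : IsSelfAdjoint ((w : ℂ) • (1 : H →L[ℂ] H)) := by
  rw [IsSelfAdjoint, star_smul, star_one, RCLike.star_def, Complex.conj_ofReal]

theorem isSelfAdjoint_boundedPart :
    IsSelfAdjoint (boundedPart φ N J m w) := by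
  have h1 := (isSelfAdjoint_sumHhatBog φ N J m).star_eq
  have h2 := (isDiagonal_Hhat0 φ N (J (m + 1))).isSelfAdjoint.star_eq
  have h3 := (isSelfAdjoint_ofReal_smul_one (H := FockN d N) w).star_eq
  have h4 : star (pairPreserving φ N J m w) = pairPreserving φ N J m w := by
    change star (sumHhatBog φ N J m + Hhat0 φ N (J (m + 1)) - (w : ℂ) • 1) = _
    rw [star_sub, star_add, h1, h2, h3]
    rfl
  rw [IsSelfAdjoint, boundedPart, star_add, star_add, h4, star_W, star_Wstar]
  abel

theorem isSelfAdjoint_KFormula {s : ℕ}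
    (h : IsSelfAdjoint (dressedInverse φ N J (m + 1) w s)) :
    IsSelfAdjoint (KFormula φ N J (m + 1) w s) := by
  rw [KFormula_eq]
  apply isSelfAdjoint_diagPMap_add
  have hP : IsSelfAdjoint (Qgt N (J (m + 1)) (2 * s)) := by
    rw [Qgt_eq_pairProj]
    exact isSelfAdjoint_pairProj _ _
  have hB := isSelfAdjoint_boundedPart (φ := φ) (N := N) (J := J) (m := m) (w := w)
  rw [flowBounded]
  rw [boundedPart] at hB
  refine IsSelfAdjoint.sub ?_ ?_
  · rw [IsSelfAdjoint, star_mul, star_mul, hP.star_eq, hB.star_eq, mul_assoc]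
  · rw [IsSelfAdjoint, star_mul, star_mul, star_mul, star_mul, hP.star_eq, h.star_eq, star_W,
      star_Wstar]
    simp only [mul_assoc]

end Flow

/-! ### Lower bounds for the diagonal blocks -/

section LowerBounds

/-- The spectrum is compact, hence bounded below, so its infimum really bounds each spectral value;
positivity of `T - r` is then read from the spectrum. -/
theorem le_re_inner_of_le_sInf_spectrum {H : Type} [NormedAddCommGroup H] [InnerProductSpace ℂ H]
    [CompleteSpace H] {T : H →L[ℂ] H} (hT : IsSelfAdjoint T) {r : ℝ}
    (hr : r ≤ sInf (spectrum ℝ T)) (ψ : H) : r * ‖ψ‖ ^ 2 ≤ (inner ℂ ψ (T ψ) : ℂ).re := by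
  have h : algebraMap ℝ (H →L[ℂ] H) r ≤ T := by
    rw [algebraMap_le_iff_le_spectrum]
    intro x hx
    exact hr.trans (csInf_le (spectrum.isCompact (𝕜 := ℝ) T).bddBelow hx)
  have h1 := ((ContinuousLinearMap.le_def _ _).1 h).re_inner_nonneg_right ψ
  have h2 : (T - algebraMap ℝ (H →L[ℂ] H) r) ψ = T ψ - (r : ℂ) • ψ := by
    rw [Complex.coe_smul, Algebra.algebraMap_eq_smul_one]
    rfl
  rw [h2, inner_sub_right, inner_smul_right, inner_self_eq_norm_sq_to_K] at h1
  change 0 ≤ (inner ℂ ψ (T ψ) - (r : ℂ) * ((‖ψ‖ : ℝ) : ℂ) ^ 2).re at h1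
  rw [← Complex.ofReal_pow, ← Complex.ofReal_mul, Complex.sub_re, Complex.ofReal_re] at h1
  linarith

theorem IsDiagonal.re_inner_nonneg {ι : Type} {T : L2 ι →L[ℂ] L2 ι} {c : ι → ℝ}
    (h : IsDiagonal T c) (hc : ∀ k, 0 ≤ c k) (ψ : L2 ι) : 0 ≤ (inner ℂ ψ (T ψ) : ℂ).re := by
  have e : inner ℂ ψ (T ψ) = ((∑' k, c k * ‖ψ k‖ ^ 2 : ℝ) : ℂ) := by
    rw [lp.inner_eq_tsum, Complex.ofReal_tsum]
    congr 1
    funext k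
    rw [h, RCLike.inner_apply, mul_assoc, Complex.mul_conj']
    push_cast
    ring
  rw [e, Complex.ofReal_re]
  exact tsum_nonneg fun k => mul_nonneg (hc k) (sq_nonneg _)

theorem kSq_nonneg {d : ℕ} (L : ℝ) (j : Mode d) : 0 ≤ kSq L j :=
  mul_nonneg (sq_nonneg _) (Finset.sum_nonneg fun _ _ => sq_nonneg _)

theorem kSq_pos {d : ℕ} {L : ℝ} (hL : 0 < L) {j : Mode d} (hj : j ≠ 0) : 0 < kSq L j := by
  obtain ⟨i, hi⟩ := Function.ne_iff.1 hj
  have hi' : (j i : ℝ) ≠ 0 := by exact_mod_cast hi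
  refine mul_pos (by positivity) ?_
  exact Finset.sum_pos' (fun _ _ => sq_nonneg _) ⟨i, Finset.mem_univ i, by positivity⟩

theorem kineticValue_nonneg {d N : ℕ} (L : ℝ) (J : ℕ → Mode d) (m : ℕ) (n : Occ d N) :
    0 ≤ kineticValue N L J m n :=
  Finset.sum_nonneg fun _ _ => mul_nonneg (kSq_nonneg L _) (Nat.cast_nonneg _)

variable {d : ℕ} {L : ℝ} {φ : PairPotential d L} {N : ℕ} {J : ℕ → Mode d} {m : ℕ}

/-- The diagonal energy `(k_j² + φ_j n_0 / N) (n_j + n_{-j}) + c`. -/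
def diagEnergy (φ : PairPotential d L) (N : ℕ) (j : Mode d) (c : ℝ) (n : Occ d N) : ℝ :=
  (kSq L j + φ.coeff j / N * (n.1 0 : ℝ)) * (n.pair j : ℝ) + c

theorem le_diagEnergy {j : Mode d} (hφ : 0 < φ.coeff j) (c : ℝ) (n : Occ d N) :
    c ≤ diagEnergy φ N j c n := by
  have h1 := kSq_nonneg L j
  have h2 : 0 ≤ (kSq L j + φ.coeff j / N * (n.1 0 : ℝ)) * (n.pair j : ℝ) := by positivity
  rw [diagEnergy]
  linarith

theorem diagEnergy_le {j : Mode d} (hj : j ≠ 0) (hφ : 0 < φ.coeff j) (c : ℝ) (n : Occ d N) :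
    diagEnergy φ N j c n ≤ (kSq L j + φ.coeff j / N * N) * N + c := by
  have h := Occ.zero_add_pair_le hj n
  have h1 : (n.1 0 : ℝ) ≤ N := by exact_mod_cast (by omega : n.1 0 ≤ N)
  have h2 : (n.pair j : ℝ) ≤ N := by exact_mod_cast (by omega : n.pair j ≤ N)
  have h3 := kSq_nonneg L j
  rw [diagEnergy]
  gcongr

theorem isDiagonal_Hhat0_add (φ : PairPotential d L) (N : ℕ) (j : Mode d) (c : ℝ) :
    IsDiagonal (Hhat0 φ N j + (c : ℂ) • 1) (diagEnergy φ N j c) := by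
  intro ψ n
  show Hhat0 φ N j ψ n + (c : ℂ) * ψ n = _
  rw [isDiagonal_Hhat0, diagEnergy]
  push_cast
  ring

theorem re_inner_Hhat0_add (j : Mode d) (c : ℝ) (ψ : FockN d N) :
    (inner ℂ ψ ((Hhat0 φ N j + (c : ℂ) • (1 : FockN d N →L[ℂ] FockN d N)) ψ) : ℂ).re =
      (inner ℂ ψ (Hhat0 φ N j ψ) : ℂ).re + c * ‖ψ‖ ^ 2 := by
  have h : (Hhat0 φ N j + (c : ℂ) • (1 : FockN d N →L[ℂ] FockN d N)) ψ =
    Hhat0 φ N j ψ + (c : ℂ) • ψ := rfl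
  have h2 : (inner ℂ ψ ψ : ℂ) = ((‖ψ‖ : ℝ) : ℂ) ^ 2 := inner_self_eq_norm_sq_to_K ψ
  rw [h, inner_add_right, inner_smul_right, h2, ← Complex.ofReal_pow, ← Complex.ofReal_mul,
    Complex.add_re, Complex.ofReal_re]

/-- The bounded part of the Hamiltonian dominates the diagonal energy on the states with a fixed
index. -/
theorem re_inner_Hhat0_le_boundedPart (hJ : InteractingModes φ (m + 1) J) {w c : ℝ}
    (hw : w + c ≤ sInf (spectrum ℝ (sumHhatBog φ N J m))) (s : ℕ) {ψ : FockN d N}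
    (hψ : Qeq N (J (m + 1)) (2 * s) ψ = ψ) :
    (inner ℂ ψ ((Hhat0 φ N (J (m + 1)) + (c : ℂ) • (1 : FockN d N →L[ℂ] FockN d N)) ψ) : ℂ).re ≤
      (inner ℂ ψ (boundedPart φ N J m w ψ) : ℂ).re := by
  have hQ : IsSelfAdjoint (Qeq N (J (m + 1)) (2 * s)) := by
    rw [Qeq_eq_pairProj]
    exact isSelfAdjoint_pairProj _ _
  have hQs := ContinuousLinearMap.isSelfAdjoint_iff_isSymmetric.1 hQ
  -- Inside one block `W` and `Wstar` have no matrix elements, so they drop out of the quadratic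
  -- form. The other couples contribute at least the bottom of their spectrum.
  have hrel := (flowRelations (N := N) (w := w) hJ).compress_Q s
  have h1 : Qeq N (J (m + 1)) (2 * s) (boundedPart φ N J m w (Qeq N (J (m + 1)) (2 * s) ψ)) =
      Qeq N (J (m + 1)) (2 * s) (pairPreserving φ N J m w (Qeq N (J (m + 1)) (2 * s) ψ)) :=
    congrArg (fun A : FockN d N →L[ℂ] FockN d N => A ψ) hrel
  rw [hψ] at h1
  have h2 : ∀ χ : FockN d N, inner ℂ ψ (Qeq N (J (m + 1)) (2 * s) χ) = inner ℂ ψ χ := by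
    intro χ
    have := hQs ψ χ
    rw [ContinuousLinearMap.coe_coe, hψ] at this
    exact this.symm
  have h3 : inner ℂ ψ (boundedPart φ N J m w ψ) = inner ℂ ψ (pairPreserving φ N J m w ψ) := by
    rw [← h2, h1, h2]
  have h4 : pairPreserving φ N J m w ψ =
      sumHhatBog φ N J m ψ + Hhat0 φ N (J (m + 1)) ψ - (w : ℂ) • ψ := rfl
  have h5 : (inner ℂ ψ ψ : ℂ) = ((‖ψ‖ : ℝ) : ℂ) ^ 2 := inner_self_eq_norm_sq_to_K ψ
  have h6 := le_re_inner_of_le_sInf_spectrum (isSelfAdjoint_sumHhatBog φ N J m) hw ψ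
  rw [h3, h4, re_inner_Hhat0_add, inner_sub_right, inner_add_right, inner_smul_right, h5,
    ← Complex.ofReal_pow, ← Complex.ofReal_mul, Complex.sub_re, Complex.add_re, Complex.ofReal_re]
  linarith

theorem reducedInvertible_HBogSub (hJ : InteractingModes φ (m + 1) J)
    (hφ : 0 < φ.coeff (J (m + 1))) {w c : ℝ} (hc : 0 < c)
    (hw : w + c ≤ sInf (spectrum ℝ (sumHhatBog φ N J m))) (s : ℕ) :
    ReducedInvertible (Qeq N (J (m + 1)) (2 * s)) (HBogSub φ N J (m + 1) w) := by
  rw [HBogSub_eq]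
  refine reducedInvertible_of_bounded_below (kineticValue_nonneg L J (m + 1))
    isSelfAdjoint_boundedPart _ hc fun ψ hψ => ?_
  refine le_trans ?_ (re_inner_Hhat0_le_boundedPart hJ hw s hψ)
  rw [re_inner_Hhat0_add]
  have h : 0 ≤ (inner ℂ ψ (Hhat0 φ N (J (m + 1)) ψ) : ℂ).re := by
    refine (isDiagonal_Hhat0 φ N (J (m + 1))).re_inner_nonneg (fun n => ?_) ψ
    have := kSq_nonneg L (J (m + 1))
    positivity
  linarith

theorem mul_self_nonneg_of_isSelfAdjoint {H : Type} [NormedAddCommGroup H]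
    [InnerProductSpace ℂ H] [CompleteSpace H] {E : H →L[ℂ] H} (hE : IsSelfAdjoint E) :
    0 ≤ E * E := by
  have := star_mul_self_nonneg E
  rwa [hE.star_eq] at this

theorem norm_posSqrt_mul_mul_posSqrt_le {H : Type} [NormedAddCommGroup H]
    [InnerProductSpace ℂ H] [CompleteSpace H] {R R' E F V : H →L[ℂ] H} (hR : 0 ≤ R)
    (hR' : 0 ≤ R') (hE : IsSelfAdjoint E) (hEF : E * F = 1) (hFE : F * E = 1)
    (h : R * (E * E) * R ≤ R) (h' : R' * (E * E) * R' ≤ R') :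
    ‖posSqrt R' * V * posSqrt R‖ ≤ ‖F * V * F‖ :=
  norm_sqrt_mul_mul_sqrt_le hR hR' hE hEF hFE h h'

/-- `W` maps block `s` into block `s + 1`, so the left projection is redundant. Only the initial
projection then remains in the weighted norm. -/
theorem WBlock_eq (hJ : InteractingModes φ (m + 1) J) (s : ℕ) :
    WBlock φ N J (m + 1) (2 * (s + 1)) (2 * s) =
      W φ N (J (m + 1)) * Qeq N (J (m + 1)) (2 * s) := by
  have hrel := flowRelations (N := N) (w := 0) hJ
  have h1 := hrel.W_Q s
  have h2 := hrel.Q_Q (s + 1)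
  show Qeq N (J (m + 1)) (2 * (s + 1)) * (W φ N (J (m + 1)) * Qeq N (J (m + 1)) (2 * s)) = _
  rw [h1, ← mul_assoc, h2]

/-- The resolvents are nonnegative and the symmetrized hopping terms are controlled by the diagonal
energies. -/
theorem RBog_nonneg_and_norm_hopping_le (hJ : InteractingModes φ (m + 1) J)
    (hφ : 0 < φ.coeff (J (m + 1))) {w c : ℝ} (hc : 0 < c)
    (hw : w + c ≤ sInf (spectrum ℝ (sumHhatBog φ (N + 2) J m))) :
    (∀ s, 0 ≤ RBog φ (N + 2) J (m + 1) w s) ∧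
    ∀ (s : ℕ) (G : ℝ), (∀ n : Occ d N,
      (n.pair (J (m + 1)) + 2 + 2 * s = N + 2 ∨ n.pair (J (m + 1)) + 2 + (2 * s + 1) = N + 2) →
      (φ.coeff (J (m + 1)) / (N + 2 : ℕ)) ^ 2 * ((n.1 (J (m + 1)) + 1) * (n.1 (-J (m + 1)) + 1) *
        ((n.1 0 + 1 + 1) * (n.1 0 + 1))) ≤
        G * (diagEnergy φ (N + 2) (J (m + 1)) c ((n.addOne 0).addOne 0) *
          diagEnergy φ (N + 2) (J (m + 1)) c ((n.addOne (J (m + 1))).addOne (-J (m + 1))))) →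
      ‖posSqrt (RBog φ (N + 2) J (m + 1) w (s + 1)) *
        WBlock φ (N + 2) J (m + 1) (2 * (s + 1)) (2 * s) *
          posSqrt (RBog φ (N + 2) J (m + 1) w s)‖ ≤ Real.sqrt G := by
  have hj := hJ.last_ne_zero
  set D := diagEnergy φ (N + 2) (J (m + 1)) c with hD
  have hD0 : ∀ n, 0 < D n := fun n => hc.trans_le (le_diagEnergy hφ c n)
  -- `E = D^{1/2}` and, below, `F = D^{-1/2}`. Both are bounded: `D` is at least `c`, and at fixed
  -- particle number it is bounded above.
  obtain ⟨E, hE⟩ := exists_isDiagonal (c := fun n => Real.sqrt (D n))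
    (C := Real.sqrt ((kSq L (J (m + 1)) + φ.coeff (J (m + 1)) / (N + 2 : ℕ) * (N + 2 : ℕ)) *
      (N + 2 : ℕ) + c)) (fun n => by
      rw [abs_of_nonneg (Real.sqrt_nonneg _)]
      exact Real.sqrt_le_sqrt (diagEnergy_le hj hφ c n))
  obtain ⟨F, hF⟩ := exists_isDiagonal (c := fun n => (Real.sqrt (D n))⁻¹)
    (C := (Real.sqrt c)⁻¹) (fun n => by
      rw [abs_of_nonneg (by positivity)]
      have := Real.sqrt_pos.2 hc
      gcongr
      exact le_diagEnergy hφ c n)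
  have hEF : E * F = 1 := (hE.mul hF).ext isDiagonal_one fun n =>
    mul_inv_cancel₀ (Real.sqrt_pos.2 (hD0 n)).ne'
  have hFE : F * E = 1 := (hF.mul hE).ext isDiagonal_one fun n =>
    inv_mul_cancel₀ (Real.sqrt_pos.2 (hD0 n)).ne'
  have hEE : E * E =
      Hhat0 φ (N + 2) (J (m + 1)) + (c : ℂ) • (1 : FockN d (N + 2) →L[ℂ] FockN d (N + 2)) :=
    (hE.mul hE).ext (isDiagonal_Hhat0_add φ (N + 2) (J (m + 1)) c) fun n =>
      Real.mul_self_sqrt (hD0 n).le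
  have hRR : ∀ s, 0 ≤ RBog φ (N + 2) J (m + 1) w s ∧
      RBog φ (N + 2) J (m + 1) w s * (E * E) * RBog φ (N + 2) J (m + 1) w s ≤
        RBog φ (N + 2) J (m + 1) w s := by
    intro s
    have hinv := (reducedInvertible_HBogSub hJ hφ hc hw s).isReducedInverse
    change IsReducedInverse _ _ (RBog φ (N + 2) J (m + 1) w s) at hinv
    rw [HBogSub_eq] at hinv
    refine hinv.nonneg_and_mul_le (kineticValue_nonneg L J (m + 1)) isSelfAdjoint_boundedPart
      (mul_self_nonneg_of_isSelfAdjoint hE.isSelfAdjoint) ?_ ?_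
    · rw [Qeq_eq_pairProj]
      exact isSelfAdjoint_pairProj _ _
    · intro ψ hψ
      rw [hEE]
      exact re_inner_Hhat0_le_boundedPart hJ hw s hψ
  refine ⟨fun s => (hRR s).1, fun s G hG => ?_⟩
  refine (norm_posSqrt_mul_mul_posSqrt_le (hRR s).1 (hRR (s + 1)).1 hE.isSelfAdjoint hEF hFE
    (hRR s).2 (hRR (s + 1)).2).trans ?_
  rw [WBlock_eq hJ, Qeq_eq_pairProj]
  exact norm_weighted_W_le φ hj hD0 hF hG

end LowerBounds

/-! ### Estimates in terms of `ε` -/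

section Estimates

variable {d : ℕ} {L : ℝ} {φ : PairPotential d L} {j : Mode d}

theorem kSq_eq_eps_mul (hφ : 0 < φ.coeff j) : kSq L j = φ.eps j * φ.coeff j := by
  rw [PairPotential.eps, div_mul_cancel₀ _ hφ.ne']

/-- The spectral threshold is `-φ (1 + ε - y)` with `y = δ √(ε² + 2 ε)`. The same `y` appears in
`b_ε = (1 + ε) y` and `1 - c_ε = (1 + ε)² - y²`, which is how the threshold enters the comparison
sequence. -/
theorem energyBog_add_eq (hφ : 0 < φ.coeff j) :
    φ.energyBog j + (deltaEps (φ.eps j) - 1) * φ.coeff j *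
      Real.sqrt (φ.eps j ^ 2 + 2 * φ.eps j) =
      -(φ.coeff j * (1 + φ.eps j - deltaEps (φ.eps j) *
        Real.sqrt (φ.eps j ^ 2 + 2 * φ.eps j))) := by
  have h : Real.sqrt (kSq L j ^ 2 + 2 * φ.coeff j * kSq L j) =
      φ.coeff j * Real.sqrt (φ.eps j ^ 2 + 2 * φ.eps j) := by
    rw [kSq_eq_eps_mul hφ, show (φ.eps j * φ.coeff j) ^ 2 + 2 * φ.coeff j * (φ.eps j * φ.coeff j) =
      φ.coeff j ^ 2 * (φ.eps j ^ 2 + 2 * φ.eps j) by ring, Real.sqrt_mul (sq_nonneg _),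
      Real.sqrt_sq hφ.le]
  rw [PairPotential.energyBog, h, kSq_eq_eps_mul hφ]
  ring

theorem deltaEps_mul_sqrt_bounds {ε e : ℝ} (he : 0 ≤ e) (h : e ≤ 1 / 100) (hε : ε = e ^ 2) :
    0 ≤ deltaEps ε * Real.sqrt (ε ^ 2 + 2 * ε) ∧
      deltaEps ε * Real.sqrt (ε ^ 2 + 2 * ε) ≤ 1 / 2 := by
  have hs : Real.sqrt ε = e := by rw [hε, Real.sqrt_sq he]
  have hε0 : 0 ≤ ε := by rw [hε]; positivity
  have h0 : 0 ≤ deltaEps ε * Real.sqrt (ε ^ 2 + 2 * ε) := by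
    rw [deltaEps]
    positivity
  have hb := bEps_le he h hε
  rw [bEps_eq (by linarith)] at hb
  exact ⟨h0, by nlinarith⟩

/-- The hopping estimate for occupation number states. -/
theorem hopping_le {N : ℕ} (hj : j ≠ 0) (hφ : 0 < φ.coeff j) {e c : ℝ} (he : 0 < e)
    (he1 : e ≤ 1 / 100) (hε : φ.eps j = e ^ 2)
    (hc : φ.coeff j * (1 + φ.eps j - deltaEps (φ.eps j) * Real.sqrt (φ.eps j ^ 2 + 2 * φ.eps j)
      - φ.eps j ^ 2 / 8) ≤ c)
    (hN : 1 + 1 / φ.eps j ≤ φ.eps j ^ 2 / 8 * ((N + 2 : ℕ) - 1 / φ.eps j)) {s : ℕ}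
    (hs : 2 * (s + 1) + 2 ≤ N + 2) (n : Occ d N)
    (hn : n.pair j + 2 + 2 * s = N + 2 ∨ n.pair j + 2 + (2 * s + 1) = N + 2) :
    (φ.coeff j / (N + 2 : ℕ)) ^ 2 * ((n.1 j + 1) * (n.1 (-j) + 1) *
      ((n.1 0 + 1 + 1) * (n.1 0 + 1))) ≤
      1 / (4 * (1 + 2 * φ.eps j - 2 * bEps (φ.eps j) / ((N + 2 : ℕ) - 2 * s - 1) -
        (1 - cEps (φ.eps j)) / ((N + 2 : ℕ) - 2 * s - 1) ^ 2)) *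
      (diagEnergy φ (N + 2) j c ((n.addOne 0).addOne 0) *
        diagEnergy φ (N + 2) j c ((n.addOne j).addOne (-j))) := by
  have hs0 : Real.sqrt (φ.eps j) = e := by rw [hε, Real.sqrt_sq he.le]
  have hε0 : 0 < φ.eps j := by rw [hε]; positivity
  have hε1 : φ.eps j ≤ 1 := by rw [hε]; nlinarith
  obtain ⟨hy0, hy1⟩ := deltaEps_mul_sqrt_bounds he.le he1 hε
  have hb := bEps_eq (ε := φ.eps j) (by linarith)
  have hcc := one_sub_cEps_eq hε0.le (by linarith)
  have hle := Occ.zero_add_pair_le hj n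
  have hle' : (n.1 0 : ℝ) + ((n.pair j : ℝ) + 2) ≤ (N + 2 : ℕ) := by
    exact_mod_cast (by omega : n.1 0 + (n.pair j + 2) ≤ N + 2)
  have hq3 : (3 : ℝ) ≤ (N + 2 : ℕ) - 2 * s - 1 := by
    have : (2 * s + 4 : ℝ) ≤ (N + 2 : ℕ) := by exact_mod_cast (by omega : 2 * s + 4 ≤ N + 2)
    linarith
  have hqp : ((N + 2 : ℕ) : ℝ) - 2 * s - 1 ≤ (n.pair j : ℝ) + 2 := by
    have : ((N + 2 : ℕ) : ℝ) ≤ n.pair j + 2 + (2 * s + 1) := by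
      exact_mod_cast (by omega : N + 2 ≤ n.pair j + 2 + (2 * s + 1))
    linarith
  have hU := denominator_pos he.le he1 hε hq3
  have e1 : diagEnergy φ (N + 2) j c ((n.addOne 0).addOne 0) =
      φ.coeff j / (N + 2 : ℕ) * ((φ.eps j * (N + 2 : ℕ) + n.1 0 + 2) * ((n.pair j : ℝ) + 2 - 2) +
        c / φ.coeff j * (N + 2 : ℕ)) := by
    have hN0 : ((N + 2 : ℕ) : ℝ) ≠ 0 := by positivity
    rw [diagEnergy, Occ.pair_addOne_of_ne hj.symm (neg_ne_zero.2 hj).symm,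
      Occ.pair_addOne_of_ne hj.symm (neg_ne_zero.2 hj).symm, Occ.addOne_apply_self,
      Occ.addOne_apply_self, kSq_eq_eps_mul hφ]
    field_simp
    push_cast
    ring
  have e2 : diagEnergy φ (N + 2) j c ((n.addOne j).addOne (-j)) =
      φ.coeff j / (N + 2 : ℕ) * ((φ.eps j * (N + 2 : ℕ) + n.1 0) * ((n.pair j : ℝ) + 2) +
        c / φ.coeff j * (N + 2 : ℕ)) := by
    have hN0 : ((N + 2 : ℕ) : ℝ) ≠ 0 := by positivity
    rw [diagEnergy, Occ.pair_addOne_neg hj, Occ.pair_addOne_self hj,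
      Occ.addOne_apply_of_ne (neg_ne_zero.2 hj), Occ.addOne_apply_of_ne hj, kSq_eq_eps_mul hφ]
    field_simp
    push_cast
    ring
  have hest := hopping_estimate (κ := 1 + φ.eps j - deltaEps (φ.eps j) *
      Real.sqrt (φ.eps j ^ 2 + 2 * φ.eps j) - c / φ.coeff j) (A := c / φ.coeff j) hε0 hε1
    (Nat.cast_nonneg (n.1 0)) hq3 hqp hle' hy0 hy1
    (by
      have := (le_div_iff₀' hφ).2 hc
      linarith) (by ring) hN
  rw [← hb, ← hcc] at hest
  set U := 1 + 2 * φ.eps j - 2 * bEps (φ.eps j) / ((N + 2 : ℕ) - 2 * s - 1) -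
        (1 - cEps (φ.eps j)) / ((N + 2 : ℕ) - 2 * s - 1) ^ 2 with hUdef
  have hpair : (n.pair j : ℝ) = n.1 j + n.1 (-j) := by
    rw [Occ.pair]
    push_cast
    rfl
  -- The factor `4` of the recursion comes from the arithmetic-geometric inequality for the
  -- occupations of `j` and `-j`.
  have hxy : 4 * (((n.1 j : ℝ) + 1) * (n.1 (-j) + 1)) ≤ ((n.pair j : ℝ) + 2) ^ 2 := by
    rw [hpair]
    nlinarith [sq_nonneg ((n.1 j : ℝ) - n.1 (-j))]
  rw [e1, e2, one_div, ← div_eq_inv_mul, le_div_iff₀ (by positivity)]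
  calc (φ.coeff j / (N + 2 : ℕ)) ^ 2 * (((n.1 j : ℝ) + 1) * (n.1 (-j) + 1) *
        ((n.1 0 + 1 + 1) * (n.1 0 + 1))) * (4 * U)
      = (φ.coeff j / (N + 2 : ℕ)) ^ 2 * (U * (4 * (((n.1 j : ℝ) + 1) * (n.1 (-j) + 1))) *
        (((n.1 0 : ℝ) + 1) * (n.1 0 + 2))) := by ring
    _ ≤ (φ.coeff j / (N + 2 : ℕ)) ^ 2 * (U * ((n.pair j : ℝ) + 2) ^ 2 *
        (((n.1 0 : ℝ) + 1) * (n.1 0 + 2))) := by gcongr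
    _ ≤ (φ.coeff j / (N + 2 : ℕ)) ^ 2 * _ := mul_le_mul_of_nonneg_left hest (sq_nonneg _)
    _ = _ := by ring

theorem exists_threshold (m : ℕ) {ε p : ℝ} (hε : 0 < ε) (hp : 0 < p) :
    ∃ N₀ : ℕ, ∀ N : ℕ, N₀ ≤ N → (m : ℝ) / Real.log N ^ (1 / 8 : ℝ) ≤ p ∧
      1 + 1 / ε ≤ ε ^ 2 / 8 * (N - 1 / ε) := by
  have h1 : Filter.Tendsto (fun N : ℕ => (m : ℝ) / Real.log N ^ (1 / 8 : ℝ)) Filter.atTop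
      (nhds 0) := by
    refine Filter.Tendsto.const_div_atTop ?_ _
    exact (tendsto_rpow_atTop (by norm_num)).comp
      (Real.tendsto_log_atTop.comp tendsto_natCast_atTop_atTop)
  have h2 : Filter.Tendsto (fun N : ℕ => ε ^ 2 / 8 * ((N : ℝ) - 1 / ε)) Filter.atTop
      Filter.atTop := by
    refine Filter.Tendsto.const_mul_atTop (by positivity) ?_
    exact Filter.tendsto_atTop_add_const_right _ _ tendsto_natCast_atTop_atTop
  have h3 := ((h1.eventually (gt_mem_nhds hp)).and
    (h2.eventually (Filter.eventually_ge_atTop (1 + 1 / ε))))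
  obtain ⟨N₀, h⟩ := Filter.eventually_atTop.1 h3
  exact ⟨N₀, fun N hN => ⟨(h N hN).1.le, (h N hN).2⟩⟩

/-- All powers of `ε` are expressed through `t = ε^{1/4}`. The bound `1/10000` makes `t ≤ 1/10`, the
other makes `ε^Θ ≤ 1/2`, and `Θ ≤ 1/4` gives `t ≤ ε^Θ`. -/
theorem rpow_threshold {ε Θ : ℝ} (hε : 0 < ε) (hΘ : 0 < Θ) (hΘ1 : Θ ≤ 1 / 4)
    (h : ε < min (1 / 10000) ((1 / 2) ^ (1 / Θ))) :
    0 < ε ^ (1 / 4 : ℝ) ∧ ε ^ (1 / 4 : ℝ) ≤ 1 / 10 ∧ Real.sqrt ε = (ε ^ (1 / 4 : ℝ)) ^ 2 ∧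
      ε ^ (1 / 4 : ℝ) ≤ ε ^ Θ ∧ ε ^ Θ ≤ 1 / 2 := by
  obtain ⟨h1, h2⟩ := lt_min_iff.1 h
  refine ⟨by positivity, ?_, ?_, ?_, ?_⟩
  · calc ε ^ (1 / 4 : ℝ) ≤ (1 / 10000 : ℝ) ^ (1 / 4 : ℝ) := by gcongr
      _ = ((1 / 10 : ℝ) ^ (4 : ℝ)) ^ (1 / 4 : ℝ) := by norm_num
      _ = 1 / 10 := by
        rw [← Real.rpow_mul (by norm_num)]
        norm_num
  · rw [Real.sqrt_eq_rpow, ← Real.rpow_natCast, ← Real.rpow_mul hε.le]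
    norm_num
  · exact Real.rpow_le_rpow_of_exponent_ge hε (by linarith) hΘ1
  · calc ε ^ Θ ≤ ((1 / 2 : ℝ) ^ (1 / Θ)) ^ Θ := by gcongr
      _ = 1 / 2 := by
        rw [← Real.rpow_mul (by norm_num), one_div_mul_cancel hΘ.ne', Real.rpow_one]

theorem InteractingModes.coeff_pos {J : ℕ → Mode d} {m : ℕ}
    (hJ : InteractingModes φ (m + 1) J) : 0 < φ.coeff (J (m + 1)) :=
  lt_of_le_of_ne (φ.positive_type _).1
    (hJ.interacting _ (Finset.mem_Icc.2 ⟨by omega, le_rfl⟩)).symm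

end Estimates

end BoseGas

end

/-! ### Assembly of the estimates -/

theorem mainTheorem3 (ν : ℝ) (hν : 11 / 8 < ν) :
    ∃ (C ε₀ : ℝ) (a : ℝ → ℝ), 0 < C ∧ 0 < ε₀ ∧
      (∀ ε : ℝ, 0 < ε → ε < ε₀ → |a ε - 2 * ε| ≤ C * ε ^ ν) ∧
      ∀ (d : ℕ) (L : ℝ), 0 < L → ∀ (φ : BoseGas.PairPotential d L) (m : ℕ) (J : ℕ → BoseGas.Mode d),
        1 ≤ m → BoseGas.InteractingModes φ m J → φ.eps (J m) < ε₀ →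
        φ.energyBog (J m) + (BoseGas.deltaEps (φ.eps (J m)) - 1) * φ.coeff (J m) *
          Real.sqrt (φ.eps (J m) ^ 2 + 2 * φ.eps (J m)) < 0 ∧
        ∃ N₀ : ℕ, ∀ N : ℕ, N₀ ≤ N → Even N → 2 ≤ N →
          -((m : ℝ) - 1) / Real.log N ^ (1 / 8 : ℝ) ≤
            sInf (spectrum ℝ (BoseGas.sumHhatBog φ N J (m - 1))) - BoseGas.zBog φ N J (m - 1) →
          ∀ z w : ℝ,
            z ≤ φ.energyBog (J m) + (BoseGas.deltaEps (φ.eps (J m)) - 1) * φ.coeff (J m) *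
              Real.sqrt (φ.eps (J m) ^ 2 + 2 * φ.eps (J m)) →
            w = z + BoseGas.zBog φ N J (m - 1) →
            (∀ s : ℕ, 2 * s + 2 ≤ N →
              BoseGas.StepDefined φ N J m w s ∧
              IsSelfAdjoint (BoseGas.KBog φ N J m w s) ∧
              BoseGas.ReducedInvertible (BoseGas.Qeq N (J m) (2 * s)) (BoseGas.HBogSub φ N J m w) ∧
              (BoseGas.RBog φ N J m w s).IsPositive) ∧
            BoseGas.KBog φ N J m w 0 = BoseGas.KFormulaZero φ N J m w ∧
            (∀ s : ℕ, 1 ≤ s → 2 * s + 2 ≤ N →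
              Summable (fun l : ℕ =>
                (BoseGas.GammaBog φ N J m w s ∘L BoseGas.RBog φ N J m w s) ^ l) ∧
              BoseGas.KBog φ N J m w s = BoseGas.KFormula φ N J m w s) ∧
            (∀ s : ℕ, 1 ≤ s → 2 * s + 2 ≤ N →
              Summable (fun l : ℕ => BoseGas.GammaSym φ N J m w s ^ l) ∧
              ‖BoseGas.GammaCheck φ N J m w s‖ ≤
                1 / BoseGas.XSeq (a (φ.eps (J m))) (φ.eps (J m)) N s) ∧
            (∀ j : ℕ, 2 * j + 2 ≤ N →
              0 < BoseGas.XLower ν (a (φ.eps (J m))) (φ.eps (J m)) N j ∧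
              BoseGas.XLower ν (a (φ.eps (J m))) (φ.eps (J m)) N j ≤
                BoseGas.XSeq (a (φ.eps (J m))) (φ.eps (J m)) N j) := by
  have hΘ : 0 < min (2 * (ν - 11 / 8)) (1 / 4 : ℝ) := lt_min (by linarith) (by norm_num)
  refine ⟨1, min (1 / 10000) ((1 / 2) ^ (1 / min (2 * (ν - 11 / 8)) (1 / 4 : ℝ))), fun ε => 2 * ε,
    one_pos, lt_min (by norm_num) (by positivity), ?_, ?_⟩
  · intro ε hε _
    rw [sub_self, abs_zero]
    positivity
  intro d L hL φ m J hm hJ hε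
  obtain ⟨m, rfl⟩ : ∃ m', m = m' + 1 := ⟨m - 1, by omega⟩
  have hj := hJ.last_ne_zero
  have hφ := hJ.coeff_pos
  have hε0 : 0 < φ.eps (J (m + 1)) := div_pos (BoseGas.kSq_pos hL hj) hφ
  obtain ⟨ht0, ht1, hst, hθ, hθ1⟩ := BoseGas.rpow_threshold hε0 hΘ (min_le_right _ _) hε
  have he0 : 0 < Real.sqrt (φ.eps (J (m + 1))) := Real.sqrt_pos.2 hε0
  have he1 : Real.sqrt (φ.eps (J (m + 1))) ≤ 1 / 100 := by rw [hst]; nlinarith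
  have hεe : φ.eps (J (m + 1)) = Real.sqrt (φ.eps (J (m + 1))) ^ 2 := (Real.sq_sqrt hε0.le).symm
  have hε1 : φ.eps (J (m + 1)) ≤ 1 := by rw [hεe]; nlinarith
  obtain ⟨hy0, hy1⟩ := BoseGas.deltaEps_mul_sqrt_bounds he0.le he1 hεe
  rw [BoseGas.energyBog_add_eq hφ]
  refine ⟨neg_neg_of_pos (mul_pos hφ (by linarith)), ?_⟩
  -- For large `N` the spectral loss is at most `φ ε² / 8`, which is the error the hopping estimate
  -- tolerates.
  obtain ⟨N₀, hN₀⟩ := BoseGas.exists_threshold m hε0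
    (show 0 < φ.coeff (J (m + 1)) * (φ.eps (J (m + 1)) ^ 2 / 8) by positivity)
  refine ⟨N₀, ?_⟩
  intro N hN _ hN2 hspec z w hz hw
  obtain ⟨hκ, hNlarge⟩ := hN₀ N hN
  obtain ⟨N, rfl⟩ : ∃ N', N = N' + 2 := ⟨N - 2, by omega⟩
  rw [add_tsub_cancel_right] at hspec hw
  have hm1 : (((m + 1 : ℕ) : ℝ) - 1) = m := by push_cast; ring
  rw [hm1, neg_div] at hspec
  set κ := (m : ℝ) / Real.log (N + 2 : ℕ) ^ (1 / 8 : ℝ) with hκdef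
  -- The constant `c = -z - κ` in the diagonal energy is the largest that the spectral assumption
  -- yields: `w + c` equals the ground state energy of the other couples minus the loss `κ`.
  have hc : φ.coeff (J (m + 1)) * (1 + φ.eps (J (m + 1)) -
      BoseGas.deltaEps (φ.eps (J (m + 1))) *
        Real.sqrt (φ.eps (J (m + 1)) ^ 2 + 2 * φ.eps (J (m + 1))) -
      φ.eps (J (m + 1)) ^ 2 / 8) ≤ -z - κ := by
    rw [mul_sub]
    linarith
  have hc0 : 0 < -z - κ := by
    refine lt_of_lt_of_le (mul_pos hφ ?_) hc
    nlinarith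
  have hwc : w + (-z - κ) ≤ sInf (spectrum ℝ (BoseGas.sumHhatBog φ (N + 2) J m)) := by linarith
  have hR := BoseGas.reducedInvertible_HBogSub hJ hφ hc0 hwc
  obtain ⟨hR0, hhop⟩ := BoseGas.RBog_nonneg_and_norm_hopping_le hJ hφ hc0 hwc
  have hX := fun (s : ℕ) (hs : 2 * s + 2 ≤ N + 2) =>
    BoseGas.XLower_pos_and_le_XSeq (ν := ν) ht0 ht1 hst hεe hθ hθ1 hs
  -- The particle number is now `N + 2`, so `s ≤ N / 2` is exactly `2 s + 2 ≤ N + 2`. Hopping is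
  -- needed only for `s < N / 2`, which keeps the denominators `N + 2 - 2 s - 1` at least `3`.
  have hflow := BoseGas.norm_GammaSym_lt_and_GammaCheck_le (φ := φ) (N := N + 2) (J := J)
    (m := m + 1) (w := w) (X := BoseGas.XSeq (2 * φ.eps (J (m + 1))) (φ.eps (J (m + 1))) (N + 2))
    (x := fun s => 1 / (4 * (1 + 2 * φ.eps (J (m + 1)) -
      2 * BoseGas.bEps (φ.eps (J (m + 1))) / ((N + 2 : ℕ) - 2 * s - 1) -
        (1 - BoseGas.cEps (φ.eps (J (m + 1)))) / ((N + 2 : ℕ) - 2 * s - 1) ^ 2))) (n := N / 2)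
    rfl (fun s => by rw [BoseGas.XSeq, one_div_mul_one_div])
    (fun s hs => (hX s (by omega)).1.trans_le (hX s (by omega)).2)
    (fun s hs => by
      have hq : (3 : ℝ) ≤ (N + 2 : ℕ) - 2 * s - 1 := by
        have : (2 * s + 4 : ℝ) ≤ (N + 2 : ℕ) := by exact_mod_cast (by omega : 2 * s + 4 ≤ N + 2)
        linarith
      have := BoseGas.denominator_pos he0.le he1 hεe hq
      positivity)
    (fun s _ => hR0 s)
    (fun s hs => hhop s _ fun n hn =>
      BoseGas.hopping_le hj hφ he0 he1 hεe hc hNlarge (by omega) n hn)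
  have hK := BoseGas.stepDefined_and_KBog_eq hJ (n := N / 2) (fun s _ => hR s) (fun s _ => hR0 s)
    (fun s hs => (hflow s hs).1)
  refine ⟨?_, ?_, ?_, ?_, hX⟩
  · intro s hs
    have hs' : s ≤ N / 2 := by omega
    refine ⟨(hK s hs').1, ?_, hR s, (ContinuousLinearMap.nonneg_iff_isPositive _).1 (hR0 s)⟩
    rw [(hK s hs').2.1]
    exact BoseGas.isSelfAdjoint_KFormula
      (BoseGas.isSelfAdjoint_dressedInverse (hflow s hs').2.2 (hR0 s) (hflow s hs').1)
  · rw [(hK 0 (Nat.zero_le _)).2.1, BoseGas.KFormula_zero]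
  · intro s _ hs
    have hs' : s ≤ N / 2 := by omega
    exact ⟨BoseGas.summable_GammaBog_pow (hR0 s) (hflow s hs').1, (hK s hs').2.1⟩
  · intro s _ hs
    have hs' : s ≤ N / 2 := by omega
    exact ⟨summable_geometric_of_norm_lt_one (hflow s hs').1, (hflow s hs').2.1⟩
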